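/- **Setting.** Let $E_0,E_1$ be real Banach spaces with $E_1$ continuously and densely embedded in $E_0$. For $\theta\in(0,1)$ let $E_\theta=(E_0,E_1)^0_{\theta,\infty}$ be the continuous interpolation space, i.e. all $x\in E_0$ with $|x|_{E_\theta}:=\sup_{t>0}t^{-\theta}K(t,x)<\infty$ and $t^{-\theta}K(t,x)\to0$ as $t\to0^+$, where $K(t,x)=\inf_{y\in E_1}(|x-y|_{E_0}+t|y|_{E_1})$. Write $B_{E_\theta}(x,r)$, $\bar B_{E_\theta}(x,r)$ for the open and closed balls of $E_\theta$, and $B_{E_1}(x,r)$ for the open balls of $E_1$. For $\nu\in(0,1)$, $T>0$ and a Banach space $E$ let $BC_{1-\nu}([0,T],E)$ be the set of $v\in C((0,T],E)$ such that $t^{1-\nu}v(t)$ is bounded on $(0,T]$ and tends to $0$ in $E$ as $t\to0^+$. Put $\mathbb E_{0,\nu}=BC_{1-\nu}([0,T],E_0)$, and let $\mathbb E_{1,\nu}([0,T])$ be the set of $u\in BC_{1-\nu}([0,T],E_1)\cap C^1((0,T],E_0)$ with $u,\dot u\in BC_{1-\nu}([0,T],E_0)$; the initial value $u(0)$ of such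 $u$ is its limit in $E_0$ as $t\to0^+$. Let $\mathcal M_\nu(E_1,E_0)$ be the set of $B\in\mathcal L(E_1,E_0)$ such that for some $T>0$ and every $(f,x)\in\mathbb E_{0,\nu}\times E_\nu$ there is a unique $u\in\mathbb E_{1,\nu}([0,T])$ with $\dot u+Bu=f$ on $(0,T]$ and $u(0)=x$. Let $0<\mu<\beta\le\bar\mu<1$, let $V_\mu\subset E_\mu$ be open, and let $A:V_\mu\to\mathcal L(E_1,E_0)$, $F_1:V_\mu\to E_0$, $F_2:V_\mu\cap E_\beta\to E_0$. Consider $$\dot u+A(u)u=F_1(u)+F_2(u)\quad(t>0),\qquad u(0)=x. \tag{1}$$ A solution of (1) on $[0,T]$ is a function $u\in\mathbb E_{1,\mu}([0,T])$ with $u(0)=x$ that takes values in $V_\mu$ and satisfies the equation on $(0,T]$. A global solution is a function on $[0,\infty)$ that is a solution on $[0,T]$ for every $T>0$. Let $\mathcal E=\{u\in V_\mu\cap E_1: A(u)u=F_1(u)+F_2(u)\}$ be the set of equilibria. **Theorem.** Assume: * **(H1)** $(A,F_1):V_\mu\to\mathcal L(E_1,E_0)\times E_0$ is locally Lipschitz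 continuous for the topology of $E_\mu$, and $A(x)\in\mathcal M_\mu(E_1,E_0)$ for all $x\in V_\mu$. * **(H2)** There are finitely many numbers $\beta_j\in[\mu,\beta]$, $\rho_j\ge0$ with $\frac{\rho_j(\beta-\mu)+(\beta_j-\mu)}{1-\mu}\le1$ such that for each $x_0\in V_\mu$ and $R>0$ there is $C_R=C_R(x_0)>0$ with $$|F_2(x_1)-F_2(x_2)|_{E_0}\le C_R\sum_j\bigl(1+|x_1|_{E_\beta}^{\rho_j}+|x_2|_{E_\beta}^{\rho_j}\bigr)|x_1-x_2|_{E_{\beta_j}}$$ for all $x_1,x_2\in\bar B_{E_\mu}(x_0,R)\cap V_\mu\cap E_\beta$. * $(A,F_1,F_2)\in C^1(V_\mu\cap E_{\bar\mu},\ \mathcal L(E_1,E_0)\times E_0\times E_0)$ with respect to the topology of $E_{\bar\mu}$. * $u_*\in\mathcal E$ is normally stable: with $A_0v=A(u_*)v+(A'(u_*)v)u_*-F_1'(u_*)v-F_2'(u_*)v$ for $v\in E_1$ (Fréchet derivatives in $E_{\bar\mu}$), * (i) there are $m\ge 0$, an open set $U\subset\mathbb R^m$ with $0\in U$, and a $C^1$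 map $\Psi:U\to E_1$ with $\Psi(0)=u_*$, $\operatorname{rank}\Psi'(0)=m$, and $\mathcal E\cap B_{E_1}(u_*,r_1)=\Psi(U)$ for some $r_1>0$; * (ii) the tangent space $R(\Psi'(0))$ equals the kernel $N(A_0)$; * (iii) $N(A_0)\oplus R(A_0)=E_0$; * (iv) $\sigma(-A_0)\setminus\{0\}\subset\{z\in\mathbb C:\operatorname{Re}z<0\}$, where $\sigma$ is the spectrum of the complexification of $-A_0$, regarded as an operator in $E_0$ with domain $E_1$. Then $u_*$ is stable in $E_\mu$: for every $\varepsilon>0$ there is $\delta>0$ such that for every $x_0\in B_{E_\mu}(u_*,\delta)$ one has $x_0\in V_\mu$, (1) with $u(0)=x_0$ has a global solution $u(\cdot,x_0)$ of which every solution on an interval $[0,T]$ with the same initial value is a restriction, and $|u(t,x_0)-u_*|_{E_\mu}<\varepsilon$ for all $t\ge0$. Moreover, there is $\delta=\delta(\bar\mu)>0$ such that for every $x_0\in B_{E_\mu}(u_*,\delta)$ one has $x_0\in V_\mu$, the unique solution $u(\cdot,x_0)$ exists globally in the same sense, and it converges in $E_{\bar\mu}$ at an exponential rate to some $u_\infty\in\mathcal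 E$: there are $C\in\mathbb R$ and $\omega>0$ with $|u(t,x_0)-u_\infty|_{E_{\bar\mu}}\le Ce^{-\omega t}$ for all $t\ge1$. -/

import Mathlib

open Set Filter Topology

namespace QuasiPar

noncomputable section

/-!
Throughout, `E₀` and `E₁` are real Banach spaces and `j : E₁ →L[ℝ] E₀` is the (injective, dense)
embedding of `E₁` in `E₀`. All intermediate spaces are realised inside `E₀`.
-/

section Spaces

variable {E₀ E₁ : Type*} [NormedAddCommGroup E₀] [NormedSpace ℝ E₀]
  [NormedAddCommGroup E₁] [NormedSpace ℝ E₁]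

/-! ### Continuous interpolation spaces -/

/-- Peetre's functional `K(t, x) = inf { |x - y|_{E₀} + t |y|_{E₁} : y ∈ E₁ }`. -/
def peetreK (j : E₁ →L[ℝ] E₀) (t : ℝ) (x : E₀) : ℝ :=
  ⨅ y : E₁, (‖x - j y‖ + t * ‖y‖)

/-- The norm `sup_{t > 0} t^{-θ} K(t, x)` of the real interpolation space `(E₀, E₁)_{θ,∞}`. -/
def interpNorm (j : E₁ →L[ℝ] E₀) (θ : ℝ) (x : E₀) : ℝ :=
  ⨆ t : Ioi (0 : ℝ), (t : ℝ) ^ (-θ) * peetreK j t x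

theorem peetreK_bddBelow (j : E₁ →L[ℝ] E₀) {t : ℝ} (ht : 0 < t) (x : E₀) :
    BddBelow (range fun y : E₁ => ‖x - j y‖ + t * ‖y‖) :=
  ⟨0, by rintro _ ⟨y, rfl⟩; positivity⟩

theorem peetreK_le (j : E₁ →L[ℝ] E₀) {t : ℝ} (ht : 0 < t) (x : E₀) (y : E₁) :
    peetreK j t x ≤ ‖x - j y‖ + t * ‖y‖ :=
  ciInf_le (peetreK_bddBelow j ht x) y

theorem peetreK_nonneg (j : E₁ →L[ℝ] E₀) {t : ℝ} (ht : 0 < t) (x : E₀) : 0 ≤ peetreK j t x :=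
  le_ciInf fun y => by positivity

theorem peetreK_zero (j : E₁ →L[ℝ] E₀) {t : ℝ} (ht : 0 < t) : peetreK j t 0 = 0 :=
  le_antisymm (by simpa using peetreK_le j ht 0 0) (peetreK_nonneg j ht 0)

theorem peetreK_add_le (j : E₁ →L[ℝ] E₀) {t : ℝ} (ht : 0 < t) (x y : E₀) :
    peetreK j t (x + y) ≤ peetreK j t x + peetreK j t y := by
  refine le_ciInf_add_ciInf fun a b => ?_
  refine (peetreK_le j ht (x + y) (a + b)).trans ?_
  have h1 : ‖x + y - j (a + b)‖ ≤ ‖x - j a‖ + ‖y - j b‖ := by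
    rw [map_add, add_sub_add_comm]; exact norm_add_le _ _
  have h2 : t * ‖a + b‖ ≤ t * ‖a‖ + t * ‖b‖ := by
    rw [← mul_add]; exact mul_le_mul_of_nonneg_left (norm_add_le _ _) ht.le
  linarith

theorem peetreK_smul_le (j : E₁ →L[ℝ] E₀) {t : ℝ} (ht : 0 < t) (c : ℝ) (x : E₀) :
    peetreK j t (c • x) ≤ |c| * peetreK j t x := by
  rw [peetreK.eq_def j t x, Real.mul_iInf_of_nonneg (abs_nonneg c)]
  refine le_ciInf fun y => (peetreK_le j ht _ (c • y)).trans (le_of_eq ?_)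
  rw [map_smul, ← smul_sub, norm_smul, norm_smul, Real.norm_eq_abs]
  ring

theorem peetreK_smul (j : E₁ →L[ℝ] E₀) {t : ℝ} (ht : 0 < t) (c : ℝ) (x : E₀) :
    peetreK j t (c • x) = |c| * peetreK j t x := by
  refine le_antisymm (peetreK_smul_le j ht c x) ?_
  rcases eq_or_ne c 0 with rfl | hc
  · simpa using peetreK_nonneg j ht 0
  · have h := peetreK_smul_le j ht c⁻¹ (c • x)
    rw [inv_smul_smul₀ hc, abs_inv] at h
    have hc' : 0 < |c| := abs_pos.mpr hc
    calc |c| * peetreK j t x ≤ |c| * (|c|⁻¹ * peetreK j t (c • x)) :=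
          mul_le_mul_of_nonneg_left h hc'.le
      _ = peetreK j t (c • x) := by rw [mul_inv_cancel_left₀ hc'.ne']

theorem weighted_nonneg (j : E₁ →L[ℝ] E₀) (θ : ℝ) (x : E₀) (t : Ioi (0 : ℝ)) :
    0 ≤ (t : ℝ) ^ (-θ) * peetreK j t x :=
  mul_nonneg (Real.rpow_nonneg (le_of_lt t.2) _) (peetreK_nonneg j t.2 x)

/-- The continuous interpolation space `(E₀, E₁)⁰_{θ,∞}`: all `x ∈ E₀` for which
`sup_{t > 0} t^{-θ} K(t, x)` is finite and `t^{-θ} K(t, x) → 0` as `t → 0+`. -/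
def contInterp (j : E₁ →L[ℝ] E₀) (θ : ℝ) : Submodule ℝ E₀ where
  carrier := {x | BddAbove (range fun t : Ioi (0 : ℝ) => (t : ℝ) ^ (-θ) * peetreK j t x) ∧
    Tendsto (fun t : ℝ => t ^ (-θ) * peetreK j t x) (𝓝[>] 0) (𝓝 0)}
  zero_mem' := by
    refine ⟨⟨0, ?_⟩, ?_⟩
    · rintro _ ⟨t, rfl⟩
      simp [peetreK_zero j t.2]
    · refine tendsto_const_nhds.congr' ?_
      filter_upwards [self_mem_nhdsWithin] with t ht
      simp [peetreK_zero j ht]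
  add_mem' := by
    rintro x y ⟨⟨a, ha⟩, hx⟩ ⟨⟨b, hb⟩, hy⟩
    refine ⟨⟨a + b, ?_⟩, ?_⟩
    · rintro _ ⟨t, rfl⟩
      have h1 := ha ⟨t, rfl⟩
      have h2 := hb ⟨t, rfl⟩
      have h3 := mul_le_mul_of_nonneg_left (peetreK_add_le j t.2 x y)
        (Real.rpow_nonneg (le_of_lt t.2) (-θ))
      simp only at h1 h2 ⊢
      linarith
    · have hxy := hx.add hy
      rw [add_zero] at hxy
      refine squeeze_zero' ?_ ?_ hxy
      · filter_upwards [self_mem_nhdsWithin] with t ht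
        exact weighted_nonneg j θ (x + y) ⟨t, ht⟩
      · filter_upwards [self_mem_nhdsWithin] with t ht
        rw [← mul_add]
        exact mul_le_mul_of_nonneg_left (peetreK_add_le j ht x y)
          (Real.rpow_nonneg (le_of_lt ht) (-θ))
  smul_mem' := by
    rintro c x ⟨⟨a, ha⟩, hx⟩
    refine ⟨⟨|c| * a, ?_⟩, ?_⟩
    · rintro _ ⟨t, rfl⟩
      have h1 := mul_le_mul_of_nonneg_left (ha ⟨t, rfl⟩) (abs_nonneg c)
      simp only [peetreK_smul j t.2] at h1 ⊢
      linarith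
    · have h := hx.const_mul |c|
      rw [mul_zero] at h
      refine h.congr' ?_
      filter_upwards [self_mem_nhdsWithin] with t ht
      rw [peetreK_smul j ht]
      ring

/-- The space `E_θ = (E₀, E₁)⁰_{θ,∞}` as a type of its own, to carry its own norm. -/
def InterpSpace (j : E₁ →L[ℝ] E₀) (θ : ℝ) : Type _ := ↥(contInterp j θ)

instance (j : E₁ →L[ℝ] E₀) (θ : ℝ) : AddCommGroup (InterpSpace j θ) :=
  inferInstanceAs (AddCommGroup ↥(contInterp j θ))

instance (j : E₁ →L[ℝ] E₀) (θ : ℝ) : Module ℝ (InterpSpace j θ) :=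
  inferInstanceAs (Module ℝ ↥(contInterp j θ))

/-- The inclusion of `E_θ` in `E₀`. -/
def incl (j : E₁ →L[ℝ] E₀) (θ : ℝ) : InterpSpace j θ →ₗ[ℝ] E₀ := (contInterp j θ).subtype

theorem incl_injective (j : E₁ →L[ℝ] E₀) (θ : ℝ) : Function.Injective (incl j θ) :=
  Subtype.val_injective

theorem incl_mem (j : E₁ →L[ℝ] E₀) (θ : ℝ) (x : InterpSpace j θ) : incl j θ x ∈ contInterp j θ :=
  x.2

instance (j : E₁ →L[ℝ] E₀) (θ : ℝ) : Norm (InterpSpace j θ) := ⟨fun x => interpNorm j θ (incl j θ x)⟩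

theorem interpSpace_norm_def (j : E₁ →L[ℝ] E₀) (θ : ℝ) (x : InterpSpace j θ) :
    ‖x‖ = interpNorm j θ (incl j θ x) := rfl

theorem eq_zero_of_peetreK_one (j : E₁ →L[ℝ] E₀) {x : E₀} (h : peetreK j 1 x ≤ 0) : x = 0 := by
  have key : ‖x‖ ≤ (1 + ‖j‖) * peetreK j 1 x := by
    rw [peetreK, Real.mul_iInf_of_nonneg (by positivity)]
    refine le_ciInf fun y => ?_
    have h1 : ‖x‖ ≤ ‖x - j y‖ + ‖j y‖ := by
      simpa using norm_add_le (x - j y) (j y)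
    have h2 := j.le_opNorm y
    nlinarith [norm_nonneg (x - j y), norm_nonneg y, norm_nonneg j,
      mul_nonneg (norm_nonneg j) (norm_nonneg (x - j y))]
  have h0 : (1 + ‖j‖) * peetreK j 1 x ≤ 0 :=
    mul_nonpos_of_nonneg_of_nonpos (by positivity) h
  exact norm_le_zero_iff.mp (key.trans h0)

theorem interpSpace_core (j : E₁ →L[ℝ] E₀) (θ : ℝ) : NormedSpace.Core ℝ (InterpSpace j θ) where
  norm_nonneg x := Real.iSup_nonneg fun t => weighted_nonneg j θ _ t
  norm_smul c x := by
    simp only [interpSpace_norm_def, interpNorm, map_smul]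
    rw [Real.norm_eq_abs, Real.mul_iSup_of_nonneg (abs_nonneg c)]
    refine iSup_congr fun t => ?_
    rw [peetreK_smul j t.2]
    ring
  norm_triangle x y := by
    simp only [interpSpace_norm_def, interpNorm, map_add]
    refine ciSup_le fun t => ?_
    have h1 := le_ciSup (incl_mem j θ x).1 t
    have h2 := le_ciSup (incl_mem j θ y).1 t
    have h3 := mul_le_mul_of_nonneg_left (peetreK_add_le j t.2 (incl j θ x) (incl j θ y))
      (Real.rpow_nonneg (le_of_lt t.2) (-θ))
    linarith
  norm_eq_zero_iff x := by
    constructor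
    · intro h
      have h1 := le_ciSup (incl_mem j θ x).1 ⟨1, by simp⟩
      rw [interpSpace_norm_def, interpNorm] at h
      rw [h] at h1
      simp only [Real.one_rpow, one_mul] at h1
      exact incl_injective j θ ((eq_zero_of_peetreK_one j h1).trans (map_zero _).symm)
    · rintro rfl
      simp only [interpSpace_norm_def, interpNorm, map_zero]
      have : ∀ t : Ioi (0 : ℝ), (t : ℝ) ^ (-θ) * peetreK j t (0 : E₀) = 0 := fun t => by
        rw [peetreK_zero j t.2, mul_zero]
      simp [this]

instance (j : E₁ →L[ℝ] E₀) (θ : ℝ) : NormedAddCommGroup (InterpSpace j θ) :=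
  NormedAddCommGroup.ofCore (interpSpace_core j θ)

instance (j : E₁ →L[ℝ] E₀) (θ : ℝ) : NormedSpace ℝ (InterpSpace j θ) :=
  NormedSpace.ofCore (interpSpace_core j θ)

theorem weighted_embed_le (j : E₁ →L[ℝ] E₀) {θ : ℝ} (hθ : θ ∈ Ioo (0 : ℝ) 1) (y : E₁) {t : ℝ}
    (ht : 0 < t) : t ^ (-θ) * peetreK j t (j y) ≤ (1 + ‖j‖) * ‖y‖ := by
  have hp := Real.rpow_nonneg ht.le (-θ)
  have hj := norm_nonneg j
  have hy := norm_nonneg y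
  rcases le_total t 1 with h | h
  · have h1 : peetreK j t (j y) ≤ t * ‖y‖ := by simpa using peetreK_le j ht (j y) y
    have h2 : t ^ (-θ) * t ≤ 1 := by
      rw [← Real.rpow_add_one ht.ne']
      exact Real.rpow_le_one ht.le h (by linarith [hθ.2])
    calc t ^ (-θ) * peetreK j t (j y) ≤ t ^ (-θ) * (t * ‖y‖) := mul_le_mul_of_nonneg_left h1 hp
      _ = (t ^ (-θ) * t) * ‖y‖ := by ring
      _ ≤ 1 * ‖y‖ := mul_le_mul_of_nonneg_right h2 hy
      _ ≤ (1 + ‖j‖) * ‖y‖ := mul_le_mul_of_nonneg_right (by linarith) hy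
  · have h1 : peetreK j t (j y) ≤ ‖j‖ * ‖y‖ :=
      (by simpa using peetreK_le j ht (j y) 0 : peetreK j t (j y) ≤ ‖j y‖).trans (j.le_opNorm y)
    have h2 : t ^ (-θ) ≤ 1 := Real.rpow_le_one_of_one_le_of_nonpos h (by linarith [hθ.1])
    calc t ^ (-θ) * peetreK j t (j y) ≤ 1 * (‖j‖ * ‖y‖) :=
          mul_le_mul h2 h1 (peetreK_nonneg j ht _) zero_le_one
      _ ≤ (1 + ‖j‖) * ‖y‖ := by nlinarith

theorem embed_mem (j : E₁ →L[ℝ] E₀) {θ : ℝ} (hθ : θ ∈ Ioo (0 : ℝ) 1) (y : E₁) :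
    j y ∈ contInterp j θ := by
  refine ⟨⟨(1 + ‖j‖) * ‖y‖, ?_⟩, ?_⟩
  · rintro _ ⟨t, rfl⟩
    exact weighted_embed_le j hθ y t.2
  · have h0 : Tendsto (fun t : ℝ => t ^ (1 - θ) * ‖y‖) (𝓝[>] 0) (𝓝 0) := by
      have hc : ContinuousAt (fun t : ℝ => t ^ (1 - θ)) 0 :=
        Real.continuousAt_rpow_const _ _ (Or.inr (by linarith [hθ.2]))
      have h := (hc.tendsto.mono_left (nhdsWithin_le_nhds (s := Ioi (0 : ℝ)))).mul_const ‖y‖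
      rwa [Real.zero_rpow (by linarith [hθ.2]), zero_mul] at h
    refine squeeze_zero' ?_ ?_ h0
    · filter_upwards [self_mem_nhdsWithin] with t ht
      exact weighted_nonneg j θ (j y) ⟨t, ht⟩
    · filter_upwards [self_mem_nhdsWithin] with t ht
      have ht' : 0 < t := ht
      have h1 : peetreK j t (j y) ≤ t * ‖y‖ := by simpa using peetreK_le j ht' (j y) y
      calc t ^ (-θ) * peetreK j t (j y) ≤ t ^ (-θ) * (t * ‖y‖) :=
            mul_le_mul_of_nonneg_left h1 (Real.rpow_nonneg ht'.le _)
        _ = t ^ (1 - θ) * ‖y‖ := by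
            rw [← mul_assoc, ← Real.rpow_add_one ht'.ne']
            congr 2
            ring

/-- The continuous embedding `E₁ ↪ E_θ`, for `0 < θ < 1`. -/
def embed (j : E₁ →L[ℝ] E₀) (θ : ℝ) (hθ : θ ∈ Ioo (0 : ℝ) 1) : E₁ →L[ℝ] InterpSpace j θ :=
  LinearMap.mkContinuous
    { toFun := fun y => (⟨j y, embed_mem j hθ y⟩ : ↥(contInterp j θ))
      map_add' := fun x y => Subtype.ext (map_add j x y)
      map_smul' := fun c x => Subtype.ext (map_smul j c x) }
    (1 + ‖j‖) (fun y => ciSup_le fun t => weighted_embed_le j hθ y t.2)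

theorem incl_embed (j : E₁ →L[ℝ] E₀) (θ : ℝ) (hθ : θ ∈ Ioo (0 : ℝ) 1) (y : E₁) :
    incl j θ (embed j θ hθ y) = j y := rfl

/-! ### Time-weighted spaces and maximal regularity -/

/-- `v ∈ BC_{1-ν}([0,T], E)`: `v` is continuous on `(0,T]`, `t^{1-ν} v(t)` is bounded there, and
`t^{1-ν} |v(t)| → 0` as `t → 0+`. Only the values of `v` on `(0,T]` matter. -/
def MemBC {E : Type*} [NormedAddCommGroup E] (ν T : ℝ) (v : ℝ → E) : Prop :=
  ContinuousOn v (Ioc 0 T) ∧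
  (∃ C : ℝ, ∀ t ∈ Ioc 0 T, t ^ (1 - ν) * ‖v t‖ ≤ C) ∧
  Tendsto (fun t => t ^ (1 - ν) * ‖v t‖) (𝓝[>] 0) (𝓝 0)

/-- `u ∈ 𝔼_{1,ν}([0,T]) = BC¹_{1-ν}([0,T], E₀) ∩ BC_{1-ν}([0,T], E₁)`, with time derivative `u'`
on `(0,T]` (one-sided at `T`). -/
def MemMaxRegSpace (j : E₁ →L[ℝ] E₀) (ν T : ℝ) (u : ℝ → E₁) (u' : ℝ → E₀) : Prop :=
  MemBC ν T u ∧ MemBC ν T (fun t => j (u t)) ∧ MemBC ν T u' ∧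
  ∀ t ∈ Ioc 0 T, HasDerivWithinAt (fun s => j (u s)) (u' t) (Ioc 0 T) t

/-- The initial value (trace at time `0`) of `u` is `x`: `u(t) → x` in `E₀` as `t → 0+`. -/
def HasInitialValue (j : E₁ →L[ℝ] E₀) (u : ℝ → E₁) (x : E₀) : Prop :=
  Tendsto (fun t => j (u t)) (𝓝[>] 0) (𝓝 x)

/-- `u ∈ 𝔼_{1,ν}([0,T])` solves `u̇ + B u = f` on `(0,T]`, `u(0) = x`. -/
def IsLinearSolution (j : E₁ →L[ℝ] E₀) (ν T : ℝ) (B : E₁ →L[ℝ] E₀) (f : ℝ → E₀) (x : E₀)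
    (u : ℝ → E₁) : Prop :=
  HasInitialValue j u x ∧
  ∃ u' : ℝ → E₀, MemMaxRegSpace j ν T u u' ∧ ∀ t ∈ Ioc 0 T, u' t + B (u t) = f t

/-- The set `𝓜_ν(E₁, E₀)` of operators with continuous maximal regularity: for some `T > 0` and
every `(f, x) ∈ BC_{1-ν}([0,T], E₀) × E_ν` there is exactly one solution in `𝔼_{1,ν}([0,T])`. -/
def maxReg (j : E₁ →L[ℝ] E₀) (ν : ℝ) : Set (E₁ →L[ℝ] E₀) :=
  {B | ∃ T : ℝ, 0 < T ∧ ∀ f : ℝ → E₀, MemBC ν T f → ∀ x ∈ contInterp j ν,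
    (∃ u, IsLinearSolution j ν T B f x u) ∧
    ∀ u v, IsLinearSolution j ν T B f x u → IsLinearSolution j ν T B f x v →
      EqOn u v (Ioc 0 T)}

/-! ### The structural hypotheses

`V` is a subset of `E_μ ⊆ E₀`. The maps `A`, `F₁` are only used on `V` and `F₂` only on
`V ∩ E_β`; their values elsewhere are irrelevant. -/

/-- `V` is an open subset of `E_μ`. -/
def IsOpenInInterp (j : E₁ →L[ℝ] E₀) (μ : ℝ) (V : Set E₀) : Prop :=
  V ⊆ contInterp j μ ∧ IsOpen (incl j μ ⁻¹' V)

/-- `(A, F₁) ∈ C^{1-}(V, 𝓜_μ(E₁, E₀) × E₀)`, where `C^{1-}` means locally Lipschitz continuous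
and `V` carries the topology of `E_μ`. -/
def HypH1 (j : E₁ →L[ℝ] E₀) (μ : ℝ) (V : Set E₀) (A : E₀ → E₁ →L[ℝ] E₀) (F₁ : E₀ → E₀) : Prop :=
  (∀ x ∈ V, A x ∈ maxReg j μ) ∧
  LocallyLipschitzOn (incl j μ ⁻¹' V) (fun x => (A (incl j μ x), F₁ (incl j μ x)))

/-- The structural condition on the singular nonlinearity `F₂ : V ∩ E_β → E₀`. -/
def HypH2 (j : E₁ →L[ℝ] E₀) (μ β : ℝ) (V : Set E₀) (F₂ : E₀ → E₀) : Prop :=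
  ∃ (m : ℕ) (b ρ : Fin m → ℝ),
    (∀ i, b i ∈ Icc μ β ∧ 0 ≤ ρ i ∧ (ρ i * (β - μ) + (b i - μ)) / (1 - μ) ≤ 1) ∧
    ∀ x₀ ∈ V, ∀ R : ℝ, 0 < R → ∃ C : ℝ, 0 < C ∧
      ∀ x₁ ∈ V ∩ contInterp j β, ∀ x₂ ∈ V ∩ contInterp j β,
        interpNorm j μ (x₁ - x₀) ≤ R → interpNorm j μ (x₂ - x₀) ≤ R →
        ‖F₂ x₁ - F₂ x₂‖ ≤ C * ∑ i, (1 + interpNorm j β x₁ ^ ρ i + interpNorm j β x₂ ^ ρ i) *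
          interpNorm j (b i) (x₁ - x₂)

/-- `(A, F₁, F₂) ∈ C¹(V ∩ E_θ, 𝓛(E₁, E₀) × E₀ × E₀)` with respect to the topology of `E_θ`. -/
def HypC1 (j : E₁ →L[ℝ] E₀) (θ : ℝ) (V : Set E₀) (A : E₀ → E₁ →L[ℝ] E₀) (F₁ F₂ : E₀ → E₀) :
    Prop :=
  ContDiffOn ℝ 1 (fun x : InterpSpace j θ => (A (incl j θ x), F₁ (incl j θ x), F₂ (incl j θ x)))
    (incl j θ ⁻¹' V)

/-! ### Solutions of `u̇ + A(u) u = F₁(u) + F₂(u)`, `u(0) = x` -/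

/-- `u` is a solution on `[0,T]`, in the class `𝔼_{1,μ}([0,T])`. -/
def IsSolution (j : E₁ →L[ℝ] E₀) (μ : ℝ) (V : Set E₀) (A : E₀ → E₁ →L[ℝ] E₀) (F₁ F₂ : E₀ → E₀)
    (x : E₀) (T : ℝ) (u : ℝ → E₁) : Prop :=
  HasInitialValue j u x ∧
  ∃ u' : ℝ → E₀, MemMaxRegSpace j μ T u u' ∧
    ∀ t ∈ Ioc 0 T, j (u t) ∈ V ∧ u' t + A (j (u t)) (u t) = F₁ (j (u t)) + F₂ (j (u t))

/-- `u` is the global solution: it is a solution on `[0,T]` for every `T > 0`, and every solution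
with the same initial value, on any interval `[0,T]`, is a restriction of it. -/
def IsGlobalSolution (j : E₁ →L[ℝ] E₀) (μ : ℝ) (V : Set E₀) (A : E₀ → E₁ →L[ℝ] E₀)
    (F₁ F₂ : E₀ → E₀) (x : E₀) (u : ℝ → E₁) : Prop :=
  (∀ T : ℝ, 0 < T → IsSolution j μ V A F₁ F₂ x T u) ∧
  ∀ (T : ℝ) (v : ℝ → E₁), 0 < T → IsSolution j μ V A F₁ F₂ x T v → EqOn v u (Ioc 0 T)

/-- The set `𝓔 ⊆ V ∩ E₁` of equilibria. -/
def equilibria (j : E₁ →L[ℝ] E₀) (V : Set E₀) (A : E₀ → E₁ →L[ℝ] E₀) (F₁ F₂ : E₀ → E₀) :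
    Set E₁ :=
  {u | j u ∈ V ∧ A (j u) u = F₁ (j u) + F₂ (j u)}

/-- Stability of the equilibrium `w` in `E_μ`: every solution that starts `E_μ`-close to `w`
exists globally and stays `E_μ`-close to `w`. -/
def IsStable (j : E₁ →L[ℝ] E₀) (μ : ℝ) (V : Set E₀) (A : E₀ → E₁ →L[ℝ] E₀) (F₁ F₂ : E₀ → E₀)
    (w : E₁) : Prop :=
  ∀ ε : ℝ, 0 < ε → ∃ δ : ℝ, 0 < δ ∧
    ∀ x ∈ contInterp j μ, interpNorm j μ (x - j w) < δ →
      x ∈ V ∧ interpNorm j μ (x - j w) < ε ∧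
      ∃ u : ℝ → E₁, IsGlobalSolution j μ V A F₁ F₂ x u ∧
        ∀ t : ℝ, 0 < t → interpNorm j μ (j (u t) - j w) < ε

/-! ### Linearization and normal stability -/

/-- The linearization `A₀ v = A(w) v + (A'(w) v) w - F₁'(w) v - F₂'(w) v`, `v ∈ E₁`, with the
Fréchet derivatives taken in `E_θ`. -/
def linearization (j : E₁ →L[ℝ] E₀) (θ : ℝ) (hθ : θ ∈ Ioo (0 : ℝ) 1) (A : E₀ → E₁ →L[ℝ] E₀)
    (F₁ F₂ : E₀ → E₀) (w : E₁) : E₁ →L[ℝ] E₀ :=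
  A (j w)
    + (((fderiv ℝ (fun x => A (incl j θ x)) (embed j θ hθ w)).flip w).comp (embed j θ hθ))
    - (fderiv ℝ (fun x => F₁ (incl j θ x)) (embed j θ hθ w)).comp (embed j θ hθ)
    - (fderiv ℝ (fun x => F₂ (incl j θ x)) (embed j θ hθ w)).comp (embed j θ hθ)

/-- The spectrum of the complexification of the operator `B` in `E₀` with domain `E₁`: all `z ∈ ℂ`
for which `z - B` is not bijective from `E₁ ⊕ i E₁` to `E₀ ⊕ i E₀`; here `p` stands for
`p.1 + i p.2`. (As `B` is bounded from `E₁` to `E₀`, a bijective `z - B` has a bounded inverse.) -/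
def complexSpectrum (j B : E₁ →L[ℝ] E₀) : Set ℂ :=
  {z | ¬ Function.Bijective (fun p : E₁ × E₁ =>
    ((z.re • j p.1 - z.im • j p.2 - B p.1, z.re • j p.2 + z.im • j p.1 - B p.2) : E₀ × E₀))}

/-- The equilibrium `w` is normally stable: near `w` the equilibria form an `m`-dimensional
`C¹`-manifold in `E₁`, parametrised by `Ψ`, whose tangent space at `w` is the kernel `N(A₀)`;
`N(A₀) ⊕ R(A₀) = E₀`; and `σ(-A₀) \ {0}` lies in the open left half-plane. -/
def NormallyStable (j : E₁ →L[ℝ] E₀) (θ : ℝ) (hθ : θ ∈ Ioo (0 : ℝ) 1) (V : Set E₀)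
    (A : E₀ → E₁ →L[ℝ] E₀) (F₁ F₂ : E₀ → E₀) (w : E₁) : Prop :=
  let A₀ : E₁ →L[ℝ] E₀ := linearization j θ hθ A F₁ F₂ w
  (∃ (m : ℕ) (U : Set (EuclideanSpace ℝ (Fin m))) (Ψ : EuclideanSpace ℝ (Fin m) → E₁),
    IsOpen U ∧ 0 ∈ U ∧ ContDiffOn ℝ 1 Ψ U ∧ Ψ 0 = w ∧
    Module.finrank ℝ (LinearMap.range (fderiv ℝ Ψ 0).toLinearMap) = m ∧
    (∃ r : ℝ, 0 < r ∧ equilibria j V A F₁ F₂ ∩ Metric.ball w r = Ψ '' U) ∧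
    LinearMap.range (fderiv ℝ Ψ 0).toLinearMap = LinearMap.ker A₀.toLinearMap) ∧
  IsCompl ((LinearMap.ker A₀.toLinearMap).map j.toLinearMap) (LinearMap.range A₀.toLinearMap) ∧
  complexSpectrum j (-A₀) \ {0} ⊆ {z : ℂ | z.re < 0}

end Spaces

end

end QuasiPar

/-! Write N(u) = A(u)u - F₁(u) - F₂(u), so that (1) reads u' + N(u) = 0. As a map from E₁ to E₀, N
is strictly differentiable at u_* with derivative A₀. If e is an equilibrium near u_*, then v = u -
e solves v' + A₀v = f with |f| ≤ η|v|_{E₁}, where η is as small as desired near u_*. The space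
splits into the kernel of A₀, which is tangent to the manifold of equilibria, and a complement on
which the linear flow contracts.

Convergence. For a solution that stays near u_* up to time R, let e_R be the equilibrium with the
same kernel component as u(R) (`exists_equilibria_graph`). The kernel component of u - e_R vanishes
at R, so integrating its equation backwards from R bounds it by the exponentially weighted size of
f. The other component is handled by the linear contraction. The resulting inequality for sup
e^{ωt}|u(t) - e_R|_{E₁} improves itself, and its constants do not depend on R
(`exists_decay_estimate`). These bounds keep the solution near u_*, so it can be continued forever,
and e_R converges to the limit equilibrium as R → ∞ (`exists_global_near`).

Linear decay. Maximal regularity of A(u_*) gives, by the open mapping theorem, an a priori estimate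
in time-weighted norms (`exists_aPriori_of_maxReg`). It passes to A₀, which differs from A(u_*) by a
lower-order operator. Tested on exponentials e^{λt}p, it yields resolvent bounds for large Re λ; a
shift extends them to large |λ| with Re λ ≥ 0, and compactness with the spectral hypothesis covers
the rest, except that at λ = 0 one must stay in the stable complement (`exists_resolvent_bound`).
Fourier inversion applied to the squared resolvent bounds t|u(t)|_{E₀} by a multiple of e^{σt} for
every σ ≥ 0 that is a limit of admissible growth rates. Through the a priori estimate the factor 1/t
strictly lowers the rate, so the infimum of the rates is negative (`exists_growth_lt`,
`exists_growth_neg`).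

Local theory. Around u_* the equation is u' + A(u_*)u = Φ(u) up to translation, with Φ a small
Lipschitz perturbation in the weighted norms (`exists_smallPert`): the quasilinear term is small
with the E_μ-norm of the deviation. The singular term F₂ is small even when the exponents are
critical, because t^{1-μ}|u|_{E₁} → 0 forces t^{β-μ}|u|_{E_β} → 0 by interpolation. A contraction
argument then gives solutions on an interval of uniform length, and a self-improving bound gives
uniqueness. -/

namespace QuasiPar

set_option linter.unusedSectionVars false

section Interpolation

variable {E₀ E₁ : Type*} [NormedAddCommGroup E₀] [NormedSpace ℝ E₀]
  [NormedAddCommGroup E₁] [NormedSpace ℝ E₁]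

/-! ### Interpolation spaces -/

theorem interpNorm_nonneg (j : E₁ →L[ℝ] E₀) (θ : ℝ) (x : E₀) : 0 ≤ interpNorm j θ x :=
  Real.iSup_nonneg fun t => weighted_nonneg j θ _ t

/-- An element of `E_θ`, as an element of the normed space `InterpSpace j θ`. -/
def toInterp (j : E₁ →L[ℝ] E₀) (θ : ℝ) (x : E₀) (hx : x ∈ contInterp j θ) : InterpSpace j θ :=
  (⟨x, hx⟩ : ↥(contInterp j θ))

theorem incl_toInterp (j : E₁ →L[ℝ] E₀) (θ : ℝ) (x : E₀) (hx : x ∈ contInterp j θ) :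
    incl j θ (toInterp j θ x hx) = x := rfl

theorem interpNorm_zero (j : E₁ →L[ℝ] E₀) (θ : ℝ) : interpNorm j θ 0 = 0 := by
  have h : ‖(0 : InterpSpace j θ)‖ = 0 := norm_zero
  rwa [interpSpace_norm_def, map_zero] at h

theorem interpNorm_add_le (j : E₁ →L[ℝ] E₀) (θ : ℝ) {x y : E₀} (hx : x ∈ contInterp j θ)
    (hy : y ∈ contInterp j θ) : interpNorm j θ (x + y) ≤ interpNorm j θ x + interpNorm j θ y := by
  have h := norm_add_le (toInterp j θ x hx) (toInterp j θ y hy)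
  simpa only [interpSpace_norm_def, map_add, incl_toInterp] using h

theorem interpNorm_smul (j : E₁ →L[ℝ] E₀) (θ : ℝ) (c : ℝ) {x : E₀} (hx : x ∈ contInterp j θ) :
    interpNorm j θ (c • x) = |c| * interpNorm j θ x := by
  have h := norm_smul c (toInterp j θ x hx)
  simpa only [interpSpace_norm_def, map_smul, incl_toInterp, Real.norm_eq_abs] using h

theorem interpNorm_neg (j : E₁ →L[ℝ] E₀) (θ : ℝ) {x : E₀} (hx : x ∈ contInterp j θ) :
    interpNorm j θ (-x) = interpNorm j θ x := by
  simpa using interpNorm_smul j θ (-1) hx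

theorem interpNorm_sub_le (j : E₁ →L[ℝ] E₀) (θ : ℝ) {x y : E₀} (hx : x ∈ contInterp j θ)
    (hy : y ∈ contInterp j θ) : interpNorm j θ (x - y) ≤ interpNorm j θ x + interpNorm j θ y := by
  simpa [sub_eq_add_neg, interpNorm_neg j θ hy] using
    interpNorm_add_le j θ hx ((contInterp j θ).neg_mem hy)

theorem peetreK_le_rpow (j : E₁ →L[ℝ] E₀) {θ : ℝ} {x : E₀} (hx : x ∈ contInterp j θ) {t : ℝ}
    (ht : 0 < t) : peetreK j t x ≤ t ^ θ * interpNorm j θ x := by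
  have h := le_ciSup hx.1 ⟨t, ht⟩
  simp only at h
  have hp : 0 < t ^ θ := Real.rpow_pos_of_pos ht θ
  calc peetreK j t x = t ^ θ * (t ^ (-θ) * peetreK j t x) := by
        rw [← mul_assoc, ← Real.rpow_add ht]; simp
    _ ≤ _ := mul_le_mul_of_nonneg_left h hp.le

theorem interpNorm_le_of_peetreK_le (j : E₁ →L[ℝ] E₀) {θ M : ℝ} {x : E₀}
    (h : ∀ t : ℝ, 0 < t → peetreK j t x ≤ t ^ θ * M) : interpNorm j θ x ≤ M := by
  refine ciSup_le fun t => ?_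
  have ht : (0 : ℝ) < t := t.2
  calc (t : ℝ) ^ (-θ) * peetreK j t x ≤ (t : ℝ) ^ (-θ) * ((t : ℝ) ^ θ * M) :=
        mul_le_mul_of_nonneg_left (h t ht) (Real.rpow_nonneg ht.le _)
    _ = M := by rw [← mul_assoc, ← Real.rpow_add ht]; simp

theorem interpNorm_embed_le (j : E₁ →L[ℝ] E₀) {θ : ℝ} (hθ : θ ∈ Ioo (0 : ℝ) 1) (y : E₁) :
    interpNorm j θ (j y) ≤ (1 + ‖j‖) * ‖y‖ :=
  ciSup_le fun t => weighted_embed_le j hθ y t.2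

theorem peetreK_le_norm (j : E₁ →L[ℝ] E₀) {t : ℝ} (ht : 0 < t) (x : E₀) : peetreK j t x ≤ ‖x‖ := by
  simpa using peetreK_le j ht x 0

theorem norm_le_peetreK_one (j : E₁ →L[ℝ] E₀) (x : E₀) : ‖x‖ ≤ (1 + ‖j‖) * peetreK j 1 x := by
  rw [peetreK, Real.mul_iInf_of_nonneg (by positivity)]
  refine le_ciInf fun y => ?_
  have h1 : ‖x‖ ≤ ‖x - j y‖ + ‖j y‖ := by
    simpa using norm_add_le (x - j y) (j y)
  have h2 := j.le_opNorm y
  nlinarith [norm_nonneg (x - j y), norm_nonneg y, norm_nonneg j,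
    mul_nonneg (norm_nonneg j) (norm_nonneg (x - j y))]

theorem norm_le_interpNorm (j : E₁ →L[ℝ] E₀) {θ : ℝ} {x : E₀} (hx : x ∈ contInterp j θ) :
    ‖x‖ ≤ (1 + ‖j‖) * interpNorm j θ x := by
  refine (norm_le_peetreK_one j x).trans (mul_le_mul_of_nonneg_left ?_ (by positivity))
  simpa using peetreK_le_rpow j hx one_pos

/-- K(t,·) is subadditive and at most the E₀-norm, hence 1-Lipschitz. This lets estimates in E_θ
pass to limits taken in E₀. -/
theorem peetreK_continuous (j : E₁ →L[ℝ] E₀) {t : ℝ} (ht : 0 < t) :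
    Continuous fun x : E₀ => peetreK j t x := by
  refine LipschitzWith.continuous (K := 1) (LipschitzWith.of_le_add fun x y => ?_)
  have h := peetreK_add_le j ht y (x - y)
  have h2 := peetreK_le_norm j ht (x - y)
  rw [add_sub_cancel] at h
  rw [dist_eq_norm]
  linarith

/-- `E_θ` is a Banach space. -/
instance instCompleteSpaceInterpSpace [CompleteSpace E₀] (j : E₁ →L[ℝ] E₀) (θ : ℝ) :
    CompleteSpace (InterpSpace j θ) := by
  refine Metric.complete_of_cauchySeq_tendsto fun u hu => ?_
  have hc : CauchySeq fun n => incl j θ (u n) :=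
    hu.map (LinearMap.mkContinuous (incl j θ) (1 + ‖j‖) fun x =>
      norm_le_interpNorm j x.2).uniformContinuous
  obtain ⟨x, hx⟩ := cauchySeq_tendsto_of_complete hc
  -- The Cauchy bound is tested at each fixed t, where the limit m → ∞ is legitimate by continuity
  -- of K(t,·) on E₀; uniformity in t is kept.
  have key : ∀ ε > 0, ∃ N, ∀ n ≥ N, ∀ t : ℝ, 0 < t →
      t ^ (-θ) * peetreK j t (incl j θ (u n) - x) ≤ ε := by
    intro ε hε
    obtain ⟨N, hN⟩ := Metric.cauchySeq_iff.1 hu ε hε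
    refine ⟨N, fun n hn t ht => ?_⟩
    have hlim : Tendsto (fun m => t ^ (-θ) * peetreK j t (incl j θ (u n) - incl j θ (u m))) atTop
        (𝓝 (t ^ (-θ) * peetreK j t (incl j θ (u n) - x))) :=
      (((peetreK_continuous j ht).tendsto _).comp (hx.const_sub _)).const_mul _
    refine le_of_tendsto hlim ?_
    filter_upwards [eventually_ge_atTop N] with m hm
    have h1 := hN n hn m hm
    rw [dist_eq_norm, interpSpace_norm_def] at h1
    have h2 := le_ciSup (incl_mem j θ (u n - u m)).1 ⟨t, ht⟩
    rw [map_sub] at h2 h1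
    exact h2.trans h1.le
  have hmem : x ∈ contInterp j θ := by
    refine ⟨?_, ?_⟩
    · obtain ⟨N, hN⟩ := key 1 one_pos
      refine ⟨1 + interpNorm j θ (incl j θ (u N)), ?_⟩
      rintro _ ⟨⟨t, ht⟩, rfl⟩
      have h1 := hN N le_rfl t ht
      have h2 := le_ciSup (incl_mem j θ (u N)).1 ⟨t, ht⟩
      have h3 := peetreK_add_le j ht (incl j θ (u N)) (-(1 : ℝ) • (incl j θ (u N) - x))
      rw [peetreK_smul j ht] at h3
      simp only [neg_smul, one_smul, abs_neg, abs_one, one_mul, neg_sub,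
        add_sub_cancel] at h3
      have h4 := mul_le_mul_of_nonneg_left h3 (Real.rpow_nonneg (le_of_lt ht) (-θ))
      simp only [interpNorm] at h2 ⊢
      linarith
    · rw [Metric.tendsto_nhds]
      intro ε hε
      obtain ⟨N, hN⟩ := key (ε / 2) (half_pos hε)
      have h0 := (incl_mem j θ (u N)).2
      filter_upwards [h0.eventually (gt_mem_nhds (half_pos hε)), self_mem_nhdsWithin] with t h2 ht
      have h1 := hN N le_rfl t ht
      have h3 := peetreK_add_le j ht (incl j θ (u N)) (-(1 : ℝ) • (incl j θ (u N) - x))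
      rw [peetreK_smul j ht] at h3
      simp only [neg_smul, one_smul, abs_neg, abs_one, one_mul, neg_sub,
        add_sub_cancel] at h3
      have h4 := mul_le_mul_of_nonneg_left h3 (Real.rpow_nonneg (le_of_lt ht) (-θ))
      have h5 := weighted_nonneg j θ x ⟨t, ht⟩
      rw [Real.dist_eq, sub_zero, abs_of_nonneg h5]
      simp only
      linarith
  refine ⟨toInterp j θ x hmem, ?_⟩
  rw [tendsto_iff_norm_sub_tendsto_zero, Metric.tendsto_atTop]
  intro ε hε
  obtain ⟨N, hN⟩ := key (ε / 2) (half_pos hε)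
  refine ⟨N, fun n hn => ?_⟩
  have h1 : interpNorm j θ (incl j θ (u n) - x) ≤ ε / 2 := ciSup_le fun t => hN n hn t t.2
  rw [Real.dist_eq, sub_zero, abs_of_nonneg (norm_nonneg _)]
  exact h1.trans_lt (by linarith)

/-- For t ≤ 1 the power t^θ is dominated by t^μ; for t ≥ 1 the trivial bound K(t,x) ≤ |x| in E₀ is
enough. -/
theorem interpNorm_mono_exponent (j : E₁ →L[ℝ] E₀) {μ θ : ℝ} (hμ : 0 < μ) (h : μ ≤ θ) {x : E₀}
    (hx : x ∈ contInterp j θ) {t : ℝ} (ht : 0 < t) :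
    peetreK j t x ≤ t ^ μ * ((1 + ‖j‖) * interpNorm j θ x) := by
  have hn := interpNorm_nonneg j θ x
  rcases le_total t 1 with h1 | h1
  · refine (peetreK_le_rpow j hx ht).trans ?_
    have h2 : t ^ θ ≤ t ^ μ := Real.rpow_le_rpow_of_exponent_ge ht h1 h
    refine mul_le_mul h2 ?_ hn (Real.rpow_nonneg ht.le _)
    nlinarith [norm_nonneg j]
  · refine (peetreK_le_norm j ht x).trans ((norm_le_interpNorm j hx).trans ?_)
    exact le_mul_of_one_le_left (by positivity) (Real.one_le_rpow h1 hμ.le)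

theorem contInterp_anti (j : E₁ →L[ℝ] E₀) {μ θ : ℝ} (hμ : 0 < μ) (h : μ ≤ θ) :
    contInterp j θ ≤ contInterp j μ := by
  intro x hx
  refine ⟨⟨(1 + ‖j‖) * interpNorm j θ x, ?_⟩, ?_⟩
  · rintro _ ⟨⟨t, ht⟩, rfl⟩
    calc t ^ (-μ) * peetreK j t x ≤ t ^ (-μ) * (t ^ μ * ((1 + ‖j‖) * interpNorm j θ x)) :=
          mul_le_mul_of_nonneg_left (interpNorm_mono_exponent j hμ h hx ht)
            (Real.rpow_nonneg (le_of_lt ht) _)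
      _ = _ := by rw [← mul_assoc, ← Real.rpow_add ht]; simp
  · refine squeeze_zero' ?_ ?_ hx.2
    · filter_upwards [self_mem_nhdsWithin] with t ht
      exact weighted_nonneg j μ x ⟨t, ht⟩
    · filter_upwards [Ioo_mem_nhdsGT (zero_lt_one' ℝ)] with t ht
      exact mul_le_mul_of_nonneg_right
        (Real.rpow_le_rpow_of_exponent_ge ht.1 ht.2.le (neg_le_neg h)) (peetreK_nonneg j ht.1 x)

/-- The continuous inclusion `E_θ ↪ E_μ` for `μ ≤ θ`. -/
noncomputable def inclOfLE (j : E₁ →L[ℝ] E₀) {μ θ : ℝ} (hμ : 0 < μ) (h : μ ≤ θ) :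
    InterpSpace j θ →L[ℝ] InterpSpace j μ :=
  LinearMap.mkContinuous
    { toFun := fun x => (⟨incl j θ x, contInterp_anti j hμ h x.2⟩ : ↥(contInterp j μ))
      map_add' := fun _ _ => rfl
      map_smul' := fun _ _ => rfl }
    (1 + ‖j‖) fun x => interpNorm_le_of_peetreK_le j fun _ ht =>
      interpNorm_mono_exponent j hμ h x.2 ht

/-- Interpolation inequality between `E_μ` and `E₁`, with scaling parameter `t`. -/
theorem interpNorm_interpolate (j : E₁ →L[ℝ] E₀) {μ b : ℝ} (hμ : μ ∈ Ioo (0 : ℝ) 1) (hb : μ ≤ b)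
    (hb1 : b < 1) {t D : ℝ} (ht : 0 < t) {u : E₁} (h1 : interpNorm j μ (j u) ≤ D)
    (h2 : t ^ (1 - μ) * ‖u‖ ≤ D) : t ^ (b - μ) * interpNorm j b (j u) ≤ D := by
  have hp : 0 < t ^ (b - μ) := Real.rpow_pos_of_pos ht _
  have hD : 0 ≤ D := (interpNorm_nonneg j μ (j u)).trans h1
  have key : interpNorm j b (j u) ≤ t ^ (μ - b) * D := by
    -- For s ≥ t the E_μ-bound controls K(s,u), for s ≤ t the choice y = u gives K(s,u) ≤ s|u|_{E₁};
    -- the two bounds agree at s = t.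
    refine interpNorm_le_of_peetreK_le j fun s hs => ?_
    rcases le_total t s with hst | hst
    · calc peetreK j s (j u) ≤ s ^ μ * D := (peetreK_le_rpow j (embed_mem j hμ u) hs).trans
            (mul_le_mul_of_nonneg_left h1 (Real.rpow_nonneg hs.le _))
        _ = s ^ b * (s ^ (μ - b) * D) := by
            rw [← mul_assoc, ← Real.rpow_add hs]; congr 2; ring
        _ ≤ s ^ b * (t ^ (μ - b) * D) := by
            refine mul_le_mul_of_nonneg_left (mul_le_mul_of_nonneg_right ?_ hD)
              (Real.rpow_nonneg hs.le _)
            exact Real.rpow_le_rpow_of_nonpos ht hst (by linarith)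
    · have h3 : ‖u‖ ≤ t ^ (μ - 1) * D := by
        calc ‖u‖ = t ^ (μ - 1) * (t ^ (1 - μ) * ‖u‖) := by
              rw [← mul_assoc, ← Real.rpow_add ht]; simp
          _ ≤ _ := mul_le_mul_of_nonneg_left h2 (Real.rpow_nonneg ht.le _)
      calc peetreK j s (j u) ≤ s * ‖u‖ := by simpa using peetreK_le j hs (j u) u
        _ ≤ s * (t ^ (μ - 1) * D) := mul_le_mul_of_nonneg_left h3 hs.le
        _ = s ^ b * (s ^ (1 - b) * (t ^ (μ - 1) * D)) := by
            rw [← mul_assoc (s ^ b), ← Real.rpow_add hs]; simp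
        _ ≤ s ^ b * (t ^ (1 - b) * (t ^ (μ - 1) * D)) := by
            refine mul_le_mul_of_nonneg_left (mul_le_mul_of_nonneg_right ?_ (by positivity))
              (Real.rpow_nonneg hs.le _)
            exact Real.rpow_le_rpow hs.le hst (by linarith)
        _ = s ^ b * (t ^ (μ - b) * D) := by
            rw [← mul_assoc (t ^ (1 - b)), ← Real.rpow_add ht]; congr 3; ring
  calc t ^ (b - μ) * interpNorm j b (j u) ≤ t ^ (b - μ) * (t ^ (μ - b) * D) :=
        mul_le_mul_of_nonneg_left key hp.le
    _ = D := by rw [← mul_assoc, ← Real.rpow_add ht]; simp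

/-- For `b > μ`, smallness of `t^{1-μ} |u|_{E₁}` alone makes `t^{b-μ} |u|_{E_b}` small on bounded
subsets of `E_μ`. -/
theorem exists_interpNorm_small (j : E₁ →L[ℝ] E₀) {μ b : ℝ} (hμ : μ ∈ Ioo (0 : ℝ) 1) (hb : μ < b)
    (hb1 : b < 1) {R ε : ℝ} (hR : 0 < R) (hε : 0 < ε) :
    ∃ r : ℝ, 0 < r ∧ ∀ (t : ℝ) (u : E₁), 0 < t → interpNorm j μ (j u) ≤ R →
      t ^ (1 - μ) * ‖u‖ ≤ r → t ^ (b - μ) * interpNorm j b (j u) ≤ ε := by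
  -- The interpolation inequality is applied at time lt instead of t. Since l^{b-μ} = R/ε, its bound
  -- R on (lt)^{b-μ}|u|_{E_b} becomes ε on t^{b-μ}|u|_{E_b}.
  set l : ℝ := (R / ε) ^ (1 / (b - μ)) with hl
  have hbm : 0 < b - μ := sub_pos.2 hb
  have hlpos : 0 < l := Real.rpow_pos_of_pos (div_pos hR hε) _
  have hlb : l ^ (b - μ) = R / ε := by
    rw [hl, ← Real.rpow_mul (div_pos hR hε).le, one_div_mul_cancel hbm.ne', Real.rpow_one]
  refine ⟨R / l ^ (1 - μ), by positivity, fun t u ht h1 h2 => ?_⟩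
  have h3 := interpNorm_interpolate j hμ hb.le hb1 (mul_pos hlpos ht) (D := R) h1 (by
    rw [Real.mul_rpow hlpos.le ht.le]
    calc l ^ (1 - μ) * t ^ (1 - μ) * ‖u‖ = l ^ (1 - μ) * (t ^ (1 - μ) * ‖u‖) := by ring
      _ ≤ l ^ (1 - μ) * (R / l ^ (1 - μ)) := by gcongr
      _ = R := by field_simp)
  rw [Real.mul_rpow hlpos.le ht.le, hlb, mul_assoc, div_mul_eq_mul_div, div_le_iff₀ hε] at h3
  exact le_of_mul_le_mul_left (by linarith) hR

end Interpolation

section MemBC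

variable {E F : Type*} [NormedAddCommGroup E] [NormedSpace ℝ E] [NormedAddCommGroup F]
  [NormedSpace ℝ F]

/-! ### Time-weighted continuous functions -/

theorem MemBC.congr {ν T : ℝ} {v w : ℝ → E} (hT : 0 < T) (hv : MemBC ν T v)
    (h : EqOn w v (Ioc 0 T)) : MemBC ν T w := by
  obtain ⟨h1, ⟨C, hC⟩, h3⟩ := hv
  refine ⟨h1.congr h, ⟨C, fun t ht => by rw [h ht]; exact hC t ht⟩, h3.congr' ?_⟩
  filter_upwards [Ioc_mem_nhdsGT hT] with t ht
  rw [h ht]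

theorem MemBC.mono {ν T T' : ℝ} {v : ℝ → E} (hv : MemBC ν T v) (h : T' ≤ T) : MemBC ν T' v :=
  ⟨hv.1.mono (Ioc_subset_Ioc_right h), hv.2.1.imp fun _ hC t ht => hC t ⟨ht.1, ht.2.trans h⟩, hv.2.2⟩

/-- A function dominated by one in the weighted space. -/
theorem MemBC.of_norm_le {ν T : ℝ} {w : ℝ → F} {v : ℝ → E} (hT : 0 < T) (hw : MemBC ν T w)
    (hv : ContinuousOn v (Ioc 0 T)) {c : ℝ} (hc : 0 ≤ c) (h : ∀ t ∈ Ioc 0 T, ‖v t‖ ≤ c * ‖w t‖) :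
    MemBC ν T v := by
  obtain ⟨-, ⟨C, hC⟩, h3⟩ := hw
  have key : ∀ t ∈ Ioc 0 T, t ^ (1 - ν) * ‖v t‖ ≤ c * (t ^ (1 - ν) * ‖w t‖) := fun t ht => by
    have := mul_le_mul_of_nonneg_left (h t ht) (Real.rpow_nonneg ht.1.le (1 - ν))
    linarith
  refine ⟨hv, ⟨c * C, fun t ht => (key t ht).trans (mul_le_mul_of_nonneg_left (hC t ht) hc)⟩, ?_⟩
  have h4 := h3.const_mul c
  rw [mul_zero] at h4
  refine squeeze_zero' ?_ ?_ h4
  · filter_upwards [self_mem_nhdsWithin] with t ht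
    exact mul_nonneg (Real.rpow_nonneg (le_of_lt ht) _) (norm_nonneg _)
  · filter_upwards [Ioc_mem_nhdsGT hT] with t ht using key t ht

theorem MemBC.add {ν T : ℝ} {v w : ℝ → E} (hv : MemBC ν T v) (hw : MemBC ν T w) :
    MemBC ν T (fun t => v t + w t) := by
  obtain ⟨h1, ⟨C, hC⟩, h3⟩ := hv
  obtain ⟨g1, ⟨D, hD⟩, g3⟩ := hw
  have key : ∀ t : ℝ, 0 < t → t ^ (1 - ν) * ‖v t + w t‖ ≤
      t ^ (1 - ν) * ‖v t‖ + t ^ (1 - ν) * ‖w t‖ := fun t ht => by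
    rw [← mul_add]
    exact mul_le_mul_of_nonneg_left (norm_add_le _ _) (Real.rpow_nonneg ht.le _)
  refine ⟨h1.add g1, ⟨C + D, fun t ht => (key t ht.1).trans (add_le_add (hC t ht) (hD t ht))⟩, ?_⟩
  have h4 := h3.add g3
  rw [add_zero] at h4
  refine squeeze_zero' ?_ ?_ h4
  · filter_upwards [self_mem_nhdsWithin] with t ht
    exact mul_nonneg (Real.rpow_nonneg (le_of_lt ht) _) (norm_nonneg _)
  · filter_upwards [self_mem_nhdsWithin] with t ht using key t ht

theorem MemBC.clm {ν T : ℝ} {v : ℝ → E} (hT : 0 < T) (B : E →L[ℝ] F) (hv : MemBC ν T v) :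
    MemBC ν T (fun t => B (v t)) :=
  hv.of_norm_le hT (B.continuous.comp_continuousOn hv.1) (norm_nonneg B) fun _ _ => B.le_opNorm _

theorem MemBC.const_smul {ν T : ℝ} {v : ℝ → E} (hT : 0 < T) (c : ℝ) (hv : MemBC ν T v) :
    MemBC ν T (fun t => c • v t) :=
  hv.of_norm_le hT (hv.1.const_smul c) (norm_nonneg c) fun _ _ => norm_smul_le _ _

theorem MemBC.sub {ν T : ℝ} {v w : ℝ → E} (hT : 0 < T) (hv : MemBC ν T v) (hw : MemBC ν T w) :
    MemBC ν T (fun t => v t - w t) :=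
  (hv.add (hw.const_smul hT (-1))).congr hT fun t _ => by simp [sub_eq_add_neg]

theorem tendsto_rpow_nhdsGT_zero {a : ℝ} (ha : 0 < a) :
    Tendsto (fun t : ℝ => t ^ a) (𝓝[>] 0) (𝓝 0) := by
  have h := (Real.continuousAt_rpow_const (0 : ℝ) a (Or.inr ha.le)).tendsto
  rw [Real.zero_rpow ha.ne'] at h
  exact h.mono_left nhdsWithin_le_nhds

theorem MemBC.of_continuousOn {ν T : ℝ} (hν : ν < 1) {v : ℝ → E} (hT : 0 < T)
    (hv : ContinuousOn v (Icc 0 T)) : MemBC ν T v := by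
  obtain ⟨C, hC⟩ := isCompact_Icc.exists_bound_of_continuousOn hv
  have hC0 : 0 ≤ C := (norm_nonneg _).trans (hC 0 ⟨le_rfl, hT.le⟩)
  have hν' : 0 < 1 - ν := sub_pos.2 hν
  have key : ∀ t ∈ Ioc 0 T, t ^ (1 - ν) * ‖v t‖ ≤ t ^ (1 - ν) * C := fun t ht =>
    mul_le_mul_of_nonneg_left (hC t ⟨ht.1.le, ht.2⟩) (Real.rpow_nonneg ht.1.le _)
  refine ⟨hv.mono Ioc_subset_Icc_self, ⟨T ^ (1 - ν) * C, fun t ht => (key t ht).trans ?_⟩, ?_⟩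
  · exact mul_le_mul_of_nonneg_right (Real.rpow_le_rpow ht.1.le ht.2 hν'.le) hC0
  · have h4 := (tendsto_rpow_nhdsGT_zero hν').mul_const C
    rw [zero_mul] at h4
    refine squeeze_zero' ?_ ?_ h4
    · filter_upwards [self_mem_nhdsWithin] with t ht
      exact mul_nonneg (Real.rpow_nonneg (le_of_lt ht) _) (norm_nonneg _)
    · filter_upwards [Ioc_mem_nhdsGT hT] with t ht using key t ht

theorem MemBC.smul_continuous {ν T : ℝ} {v : ℝ → E} (hT : 0 < T) {φ : ℝ → ℝ} (hφ : Continuous φ)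
    (hv : MemBC ν T v) : MemBC ν T (fun t => φ t • v t) := by
  obtain ⟨C, hC⟩ := isCompact_Icc.exists_bound_of_continuousOn (s := Icc 0 T) hφ.continuousOn
  have hC0 : 0 ≤ C := (norm_nonneg _).trans (hC 0 ⟨le_rfl, hT.le⟩)
  refine hv.of_norm_le hT (hφ.continuousOn.smul hv.1) hC0 fun t ht => ?_
  rw [norm_smul]
  exact mul_le_mul_of_nonneg_right (hC t ⟨ht.1.le, ht.2⟩) (norm_nonneg _)

end MemBC

section Trajectories

variable {E₀ E₁ : Type*} [NormedAddCommGroup E₀] [NormedSpace ℝ E₀]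
  [NormedAddCommGroup E₁] [NormedSpace ℝ E₁]

/-! ### Functions of the maximal regularity class -/

/-- `u ∈ 𝔼_{1,μ}([0,T])` has time derivative `u'` and initial value `x`. -/
structure Traj (j : E₁ →L[ℝ] E₀) (μ T : ℝ) (u : ℝ → E₁) (u' : ℝ → E₀) (x : E₀) : Prop where
  init : HasInitialValue j u x
  memU : MemBC μ T u
  memDeriv : MemBC μ T u'
  deriv : ∀ t ∈ Ioc 0 T, HasDerivWithinAt (fun s => j (u s)) (u' t) (Ioc 0 T) t

variable {j : E₁ →L[ℝ] E₀} {μ T : ℝ} {u v : ℝ → E₁} {u' v' : ℝ → E₀} {x y : E₀}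

theorem Traj.memMaxRegSpace (hT : 0 < T) (h : Traj j μ T u u' x) : MemMaxRegSpace j μ T u u' :=
  ⟨h.memU, h.memU.clm hT j, h.memDeriv, h.deriv⟩

theorem traj_of_memMaxRegSpace (h0 : HasInitialValue j u x) (h : MemMaxRegSpace j μ T u u') :
    Traj j μ T u u' x :=
  ⟨h0, h.1, h.2.2.1, h.2.2.2⟩

theorem Traj.congr (hT : 0 < T) (h : Traj j μ T u u' x) (hv : EqOn v u (Ioc 0 T))
    (hv' : EqOn v' u' (Ioc 0 T)) : Traj j μ T v v' x where
  init := by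
    refine Tendsto.congr' ?_ h.init
    filter_upwards [Ioc_mem_nhdsGT hT] with t ht
    rw [hv ht]
  memU := h.memU.congr hT hv
  memDeriv := h.memDeriv.congr hT hv'
  deriv t ht := by
    rw [hv' ht]
    exact (h.deriv t ht).congr (fun s hs => by rw [hv hs]) (by rw [hv ht])

theorem Traj.mono (h : Traj j μ T u u' x) {T' : ℝ} (hT : T' ≤ T) : Traj j μ T' u u' x where
  init := h.init
  memU := h.memU.mono hT
  memDeriv := h.memDeriv.mono hT
  deriv t ht := (h.deriv t ⟨ht.1, ht.2.trans hT⟩).mono (Ioc_subset_Ioc_right hT)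

theorem Traj.add (h : Traj j μ T u u' x) (g : Traj j μ T v v' y) :
    Traj j μ T (fun t => u t + v t) (fun t => u' t + v' t) (x + y) where
  init := by simpa [HasInitialValue] using Tendsto.add h.init g.init
  memU := h.memU.add g.memU
  memDeriv := h.memDeriv.add g.memDeriv
  deriv t ht := by
    simp only [map_add]
    exact (h.deriv t ht).add (g.deriv t ht)

theorem Traj.const_smul (hT : 0 < T) (c : ℝ) (h : Traj j μ T u u' x) :
    Traj j μ T (fun t => c • u t) (fun t => c • u' t) (c • x) where
  init := by simpa [HasInitialValue] using Tendsto.const_smul h.init c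
  memU := h.memU.const_smul hT c
  memDeriv := h.memDeriv.const_smul hT c
  deriv t ht := by
    simp only [map_smul]
    exact (h.deriv t ht).const_smul c

theorem Traj.sub (hT : 0 < T) (h : Traj j μ T u u' x) (g : Traj j μ T v v' y) :
    Traj j μ T (fun t => u t - v t) (fun t => u' t - v' t) (x - y) := by
  have := h.add (g.const_smul hT (-1))
  simpa [← sub_eq_add_neg] using this

/-- A continuous curve in `E₁` that is continuously differentiable in `E₀`. -/
theorem Traj.of_continuousOn (hμ : μ < 1) (hT : 0 < T) (hu : ContinuousOn u (Icc 0 T))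
    (hu' : ContinuousOn u' (Icc 0 T))
    (h : ∀ t ∈ Ioc 0 T, HasDerivWithinAt (fun s => j (u s)) (u' t) (Ioc 0 T) t) :
    Traj j μ T u u' (j (u 0)) where
  init := by
    have h1 : ContinuousWithinAt (fun t => j (u t)) (Icc 0 T) 0 :=
      (j.continuous.comp_continuousOn hu) 0 ⟨le_rfl, hT.le⟩
    refine h1.tendsto.mono_left ?_
    rw [← nhdsWithin_Ioc_eq_nhdsGT hT]
    exact nhdsWithin_mono _ Ioc_subset_Icc_self
  memU := MemBC.of_continuousOn hμ hT hu
  memDeriv := MemBC.of_continuousOn hμ hT hu'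
  deriv := h

theorem Traj.const (hμ : μ < 1) (hT : 0 < T) (e : E₁) :
    Traj j μ T (fun _ => e) (fun _ => 0) (j e) :=
  Traj.of_continuousOn hμ hT continuousOn_const continuousOn_const
    fun _ _ => hasDerivWithinAt_const _ _ _

theorem Traj.shift (hμ : μ < 1) (h : Traj j μ T u u' x) {a : ℝ} (ha : 0 < a) (haT : a < T) :
    Traj j μ (T - a) (fun t => u (a + t)) (fun t => u' (a + t)) (j (u a)) := by
  have hmaps : MapsTo (fun t => a + t) (Icc 0 (T - a)) (Ioc 0 T) := by
    rintro t ⟨h1, h2⟩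
    exact ⟨by linarith, by linarith⟩
  have := Traj.of_continuousOn (j := j) (u := fun t => u (a + t)) (u' := fun t => u' (a + t)) hμ
    (sub_pos.2 haT) (h.memU.1.comp (by fun_prop) hmaps) (h.memDeriv.1.comp (by fun_prop) hmaps)
    (fun t ht => by
      have h1 := HasDerivWithinAt.scomp t (h.deriv (a + t) (hmaps (Ioc_subset_Icc_self ht)))
        (((hasDerivAt_id t).const_add a).hasDerivWithinAt (s := Ioc 0 (T - a)))
        (hmaps.mono_left Ioc_subset_Icc_self)
      rw [one_smul] at h1
      exact h1)
  simpa using this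

/-- Multiplication by a smooth scalar function of time. -/
theorem Traj.smul_fun (hT : 0 < T) (h : Traj j μ T u u' x) {φ φ' : ℝ → ℝ} (hφ : Continuous φ)
    (hφ' : Continuous φ') (hd : ∀ t, HasDerivAt φ (φ' t) t) :
    Traj j μ T (fun t => φ t • u t) (fun t => φ' t • j (u t) + φ t • u' t) (φ 0 • x) where
  init := by
    have h1 : Tendsto φ (𝓝[>] 0) (𝓝 (φ 0)) := hφ.continuousAt.tendsto.mono_left nhdsWithin_le_nhds
    simpa [HasInitialValue] using Tendsto.smul h1 h.init
  memU := h.memU.smul_continuous hT hφ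
  memDeriv := ((h.memU.clm hT j).smul_continuous hT hφ').add (h.memDeriv.smul_continuous hT hφ)
  deriv t ht := by
    have h1 := (hd t).hasDerivWithinAt.smul (h.deriv t ht)
    simp only [map_smul]
    rw [add_comm]
    exact h1

theorem Traj.hasDerivAt (h : Traj j μ T u u' x) {t : ℝ} (ht : t ∈ Ioo 0 T) :
    HasDerivAt (fun s => j (u s)) (u' t) t :=
  (h.deriv t ⟨ht.1, ht.2.le⟩).hasDerivAt (Ioc_mem_nhds ht.1 ht.2)

/-- The weighted bound says |u'(r)| ≤ M r^{μ-1}, the derivative of (M/μ) r^μ. The mean value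
inequality is used on [s,t], away from the singular time 0. -/
theorem Traj.norm_sub_le_of_bound (hμ : 0 < μ) (h : Traj j μ T u u' x) {M : ℝ}
    (hM : ∀ t ∈ Ioc 0 T, t ^ (1 - μ) * ‖u' t‖ ≤ M) {s t : ℝ} (hs : 0 < s) (hst : s ≤ t)
    (ht : t ≤ T) : ‖j (u t) - j (u s)‖ ≤ M / μ * (t ^ μ - s ^ μ) := by
  have hsub : Icc s t ⊆ Ioc 0 T := fun r hr => ⟨hs.trans_le hr.1, hr.2.trans ht⟩
  refine image_norm_le_of_norm_deriv_right_le_deriv_boundary' (f := fun r => j (u r) - j (u s))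
    (f' := u') (B := fun r => M / μ * (r ^ μ - s ^ μ)) (B' := fun r => M * r ^ (μ - 1))
    (a := s) (b := t) ?_ ?_ ?_ ?_ ?_ ?_ ⟨hst, le_rfl⟩
  · exact ((j.continuous.comp_continuousOn h.memU.1).mono hsub).sub continuousOn_const
  · intro r hr
    have h1 := h.hasDerivAt (t := r) ⟨hs.trans_le hr.1, hr.2.trans_le ht⟩
    exact (h1.sub_const _).hasDerivWithinAt
  · simp
  · refine continuousOn_const.mul (ContinuousOn.sub ?_ continuousOn_const)
    exact fun r hr => (Real.continuousAt_rpow_const r μ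
      (Or.inr hμ.le)).continuousWithinAt
  · intro r hr
    have h1 := (((Real.hasDerivAt_rpow_const (x := r) (p := μ)
      (Or.inl (hs.trans_le hr.1).ne')).sub_const (s ^ μ)).const_mul (M / μ))
    refine (h1.congr_deriv ?_).hasDerivWithinAt
    field_simp
  · intro r hr
    have hr0 : 0 < r := hs.trans_le hr.1
    have h1 := hM r ⟨hr0, hr.2.le.trans ht⟩
    calc ‖u' r‖ = r ^ (μ - 1) * (r ^ (1 - μ) * ‖u' r‖) := by
          rw [← mul_assoc, ← Real.rpow_add hr0]; simp
      _ ≤ r ^ (μ - 1) * M := mul_le_mul_of_nonneg_left h1 (Real.rpow_nonneg hr0.le _)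
      _ = _ := mul_comm _ _

theorem Traj.norm_sub_init_le (hμ : 0 < μ) (h : Traj j μ T u u' x) {M : ℝ}
    (hM : ∀ t ∈ Ioc 0 T, t ^ (1 - μ) * ‖u' t‖ ≤ M) {t : ℝ} (ht : t ∈ Ioc 0 T) :
    ‖j (u t) - x‖ ≤ M / μ * t ^ μ := by
  have h1 : Tendsto (fun s => ‖j (u t) - j (u s)‖) (𝓝[>] 0) (𝓝 ‖j (u t) - x‖) :=
    (Tendsto.const_sub _ h.init).norm
  have h2 : Tendsto (fun s : ℝ => M / μ * (t ^ μ - s ^ μ)) (𝓝[>] 0) (𝓝 (M / μ * t ^ μ)) := by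
    simpa using ((tendsto_rpow_nhdsGT_zero hμ).const_sub (t ^ μ)).const_mul (M / μ)
  refine le_of_tendsto_of_tendsto h1 h2 ?_
  filter_upwards [Ioc_mem_nhdsGT ht.1] with s hs
  exact h.norm_sub_le_of_bound hμ hM hs.1 hs.2 ht.2

/-- The trace estimate: functions of the maximal regularity class are bounded in `E_μ`. -/
theorem Traj.interpNorm_le (hμ : μ ∈ Ioo (0 : ℝ) 1) (h : Traj j μ T u u' x)
    (hx : x ∈ contInterp j μ) {M : ℝ} (hM : ∀ t ∈ Ioc 0 T, t ^ (1 - μ) * ‖u t‖ ≤ M)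
    (hM' : ∀ t ∈ Ioc 0 T, t ^ (1 - μ) * ‖u' t‖ ≤ M) {t : ℝ} (ht : t ∈ Ioc 0 T) :
    interpNorm j μ (j (u t)) ≤ (1 + 1 / μ) * M + interpNorm j μ x := by
  have ht0 := ht.1
  have hM0 : 0 ≤ M := (mul_nonneg (Real.rpow_nonneg ht0.le _) (norm_nonneg _)).trans (hM t ht)
  have hμ0 := hμ.1
  have hx0 := interpNorm_nonneg j μ x
  refine interpNorm_le_of_peetreK_le j fun s hs => ?_
  have hsp : 0 < s ^ μ := Real.rpow_pos_of_pos hs _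
  -- For s ≤ t the element u(t) itself is used in the K-functional. For s ≥ t one splits u(t) =
  -- (u(t) - x) + x and the time regularity bounds the first part by a multiple of t^μ ≤ s^μ.
  rcases le_total s t with hst | hst
  · have h3 : ‖u t‖ ≤ t ^ (μ - 1) * M := by
      calc ‖u t‖ = t ^ (μ - 1) * (t ^ (1 - μ) * ‖u t‖) := by
            rw [← mul_assoc, ← Real.rpow_add ht0]; simp
        _ ≤ _ := mul_le_mul_of_nonneg_left (hM t ht) (Real.rpow_nonneg ht0.le _)
    calc peetreK j s (j (u t)) ≤ s * ‖u t‖ := by simpa using peetreK_le j hs (j (u t)) (u t)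
      _ ≤ s * (t ^ (μ - 1) * M) := mul_le_mul_of_nonneg_left h3 hs.le
      _ ≤ s * (s ^ (μ - 1) * M) := by
          refine mul_le_mul_of_nonneg_left (mul_le_mul_of_nonneg_right ?_ hM0) hs.le
          exact Real.rpow_le_rpow_of_nonpos hs hst (by linarith [hμ.2])
      _ = s ^ μ * M := by
          rw [← mul_assoc, Real.rpow_sub_one hs.ne', mul_div_cancel₀ _ hs.ne']
      _ ≤ s ^ μ * ((1 + 1 / μ) * M + interpNorm j μ x) := by
          refine mul_le_mul_of_nonneg_left ?_ hsp.le
          have : 0 ≤ 1 / μ * M := by positivity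
          linarith
  · have h1 := peetreK_add_le j hs (j (u t) - x) x
    rw [sub_add_cancel] at h1
    have h2 := (peetreK_le_norm j hs (j (u t) - x)).trans (h.norm_sub_init_le hμ0 hM' ht)
    have h3 := peetreK_le_rpow j hx hs
    have h4 : M / μ * t ^ μ ≤ M / μ * s ^ μ :=
      mul_le_mul_of_nonneg_left (Real.rpow_le_rpow ht0.le hst hμ0.le) (by positivity)
    have h5 : 0 ≤ s ^ μ * M := by positivity
    calc peetreK j s (j (u t)) ≤ M / μ * s ^ μ + s ^ μ * interpNorm j μ x + s ^ μ * M := by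
          linarith
      _ = _ := by ring

end Trajectories

section WeightedSpace

variable {E F : Type*} [NormedAddCommGroup E] [NormedSpace ℝ E] [NormedAddCommGroup F]
  [NormedSpace ℝ F]

/-! ### The weighted space as a space of continuous functions on a compact interval -/

/-- The function `t ↦ t^{ν-1} (w(t) - w(0))`, with `w` frozen after time `T`. -/
noncomputable def toBC (ν : ℝ) {T : ℝ} (hT : 0 < T) (w : C(Icc 0 T, E)) (t : ℝ) : E :=
  t ^ (ν - 1) • (w (projIcc 0 T hT.le t) - w ⟨0, le_rfl, hT.le⟩)

theorem weight_toBC (ν : ℝ) {T : ℝ} (hT : 0 < T) (w : C(Icc 0 T, E)) {t : ℝ} (ht : 0 < t) :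
    t ^ (1 - ν) * ‖toBC ν hT w t‖ = ‖w (projIcc 0 T hT.le t) - w ⟨0, le_rfl, hT.le⟩‖ := by
  rw [toBC, norm_smul, Real.norm_of_nonneg (Real.rpow_nonneg ht.le _), ← mul_assoc,
    ← Real.rpow_add ht]
  simp

theorem weight_toBC_le (ν : ℝ) {T : ℝ} (hT : 0 < T) (w : C(Icc 0 T, E)) {t : ℝ} (ht : 0 < t) :
    t ^ (1 - ν) * ‖toBC ν hT w t‖ ≤ 2 * ‖w‖ := by
  rw [weight_toBC ν hT w ht]
  have h1 := w.norm_coe_le_norm (projIcc 0 T hT.le t)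
  have h2 := w.norm_coe_le_norm ⟨0, le_rfl, hT.le⟩
  exact (norm_sub_le _ _).trans (by linarith)

theorem memBC_toBC (ν : ℝ) {T : ℝ} (hT : 0 < T) (w : C(Icc 0 T, E)) (S : ℝ) :
    MemBC ν S (toBC ν hT w) := by
  have hc : Continuous fun t => w (projIcc 0 T hT.le t) - w ⟨0, le_rfl, hT.le⟩ := by
    fun_prop
  refine ⟨?_, ⟨2 * ‖w‖, fun t ht => weight_toBC_le ν hT w ht.1⟩, ?_⟩
  · intro t ht
    exact ((Real.continuousAt_rpow_const t (ν - 1) (Or.inl ht.1.ne')).smul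
      hc.continuousAt).continuousWithinAt
  · have h := (hc.norm.tendsto 0).mono_left (nhdsWithin_le_nhds (s := Ioi (0 : ℝ)))
    rw [projIcc_left, sub_self, norm_zero] at h
    refine h.congr' ?_
    filter_upwards [self_mem_nhdsWithin] with t ht
    rw [weight_toBC ν hT w ht]

/-- The continuous function `t ↦ t^{1-ν} v(t)` on `[0,T]`. -/
noncomputable def ofBC {ν T : ℝ} (hν : ν < 1) {v : ℝ → E} (hv : MemBC ν T v) : C(Icc 0 T, E) where
  toFun t := (t : ℝ) ^ (1 - ν) • v t
  continuous_toFun := by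
    have h : ContinuousOn (fun t : ℝ => t ^ (1 - ν) • v t) (Icc 0 T) := by
      intro t ht
      rcases ht.1.eq_or_lt with rfl | h0
      · have h1 : Tendsto (fun t : ℝ => t ^ (1 - ν) • v t) (𝓝[>] 0) (𝓝 0) := by
          rw [tendsto_zero_iff_norm_tendsto_zero]
          refine hv.2.2.congr' ?_
          filter_upwards [self_mem_nhdsWithin] with t ht
          rw [norm_smul, Real.norm_of_nonneg (Real.rpow_nonneg (le_of_lt ht) _)]
        have h2 : (0 : ℝ) ^ (1 - ν) • v 0 = 0 := by
          rw [Real.zero_rpow (sub_pos.2 hν).ne', zero_smul]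
        refine ContinuousWithinAt.mono (t := Ici 0) ?_ Icc_subset_Ici_self
        rw [← Ioi_insert, continuousWithinAt_insert_self, ContinuousWithinAt, h2]
        exact h1
      · have h1 : ContinuousWithinAt (fun t : ℝ => t ^ (1 - ν) • v t) (Ioc 0 T) t :=
          (Real.continuousAt_rpow_const t (1 - ν) (Or.inl h0.ne')).continuousWithinAt.smul
            (hv.1 t ⟨h0, ht.2⟩)
        refine h1.mono_of_mem_nhdsWithin ?_
        filter_upwards [self_mem_nhdsWithin, mem_nhdsWithin_of_mem_nhds (Ioi_mem_nhds h0)] with s h2 h3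
        exact ⟨h3, h2.2⟩
    exact continuousOn_iff_continuous_domRestrict.1 h

theorem ofBC_zero {ν T : ℝ} (hν : ν < 1) {v : ℝ → E} (hv : MemBC ν T v) (hT : 0 < T) :
    ofBC hν hv ⟨0, le_rfl, hT.le⟩ = 0 := by
  change (0 : ℝ) ^ (1 - ν) • v 0 = 0
  rw [Real.zero_rpow (sub_pos.2 hν).ne', zero_smul]

theorem toBC_ofBC {ν T : ℝ} (hν : ν < 1) {v : ℝ → E} (hv : MemBC ν T v) (hT : 0 < T) :
    EqOn (toBC ν hT (ofBC hν hv)) v (Ioc 0 T) := by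
  intro t ht
  rw [toBC, ofBC_zero hν hv hT, sub_zero, projIcc_of_mem hT.le (Ioc_subset_Icc_self ht)]
  change t ^ (ν - 1) • t ^ (1 - ν) • v t = v t
  rw [smul_smul, ← Real.rpow_add ht.1]
  simp

theorem norm_ofBC_le {ν T : ℝ} (hν : ν < 1) {v : ℝ → E} (hv : MemBC ν T v) (hT : 0 < T) {M : ℝ}
    (hM : ∀ t ∈ Ioc 0 T, t ^ (1 - ν) * ‖v t‖ ≤ M) : ‖ofBC hν hv‖ ≤ M := by
  have hM0 : 0 ≤ M := (mul_nonneg (Real.rpow_nonneg hT.le _) (norm_nonneg _)).trans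
    (hM T ⟨hT, le_rfl⟩)
  refine (ContinuousMap.norm_le _ hM0).2 fun t => ?_
  rcases t.2.1.eq_or_lt with h | h
  · have : t = ⟨0, le_rfl, hT.le⟩ := Subtype.ext h.symm
    rw [this, ofBC_zero hν hv hT, norm_zero]
    exact hM0
  · change ‖(t : ℝ) ^ (1 - ν) • v t‖ ≤ M
    rw [norm_smul, Real.norm_of_nonneg (Real.rpow_nonneg h.le _)]
    exact hM t ⟨h, t.2.2⟩

/-- A function of the weighted space on `[0,T]` extends to longer intervals with the same bound. -/
theorem MemBC.exists_extension {ν T : ℝ} (hν : ν < 1) {v : ℝ → E} (hv : MemBC ν T v) (hT : 0 < T)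
    {M : ℝ} (hM : ∀ t ∈ Ioc 0 T, t ^ (1 - ν) * ‖v t‖ ≤ M) (S : ℝ) :
    ∃ w : ℝ → E, MemBC ν S w ∧ EqOn w v (Ioc 0 T) ∧ ∀ t, 0 < t → t ^ (1 - ν) * ‖w t‖ ≤ M := by
  refine ⟨toBC ν hT (ofBC hν hv), memBC_toBC ν hT _ S, toBC_ofBC hν hv hT, fun t ht => ?_⟩
  rw [weight_toBC ν hT _ ht, ofBC_zero hν hv hT, sub_zero]
  exact ((ofBC hν hv).norm_coe_le_norm _).trans (norm_ofBC_le hν hv hT hM)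

theorem MemBC.intervalIntegrable {ν T : ℝ} (hν : 0 < ν) {v : ℝ → E} (hv : MemBC ν T v) {t : ℝ}
    (ht : t ∈ Icc 0 T) : IntervalIntegrable v MeasureTheory.volume 0 t := by
  obtain ⟨C, hC⟩ := hv.2.1
  have h1 : IntervalIntegrable (fun s : ℝ => s ^ (ν - 1) * C) MeasureTheory.volume 0 t :=
    (intervalIntegral.intervalIntegrable_rpow' (by linarith)).mul_const C
  rw [intervalIntegrable_iff_integrableOn_Ioc_of_le ht.1] at h1 ⊢
  refine h1.mono' ((hv.1.mono (Ioc_subset_Ioc_right ht.2)).aestronglyMeasurable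
    measurableSet_Ioc) ?_
  refine (MeasureTheory.ae_restrict_iff' measurableSet_Ioc).2 (Eventually.of_forall fun s hs => ?_)
  have h2 := hC s ⟨hs.1, hs.2.trans ht.2⟩
  calc ‖v s‖ = s ^ (ν - 1) * (s ^ (1 - ν) * ‖v s‖) := by
        rw [← mul_assoc, ← Real.rpow_add hs.1]; simp
    _ ≤ _ := mul_le_mul_of_nonneg_left h2 (Real.rpow_nonneg hs.1.le _)

theorem MemBC.hasDerivWithinAt_integral [CompleteSpace E] {ν T : ℝ} (hν : 0 < ν) {v : ℝ → E}
    (hv : MemBC ν T v) {t : ℝ} (ht : t ∈ Ioc 0 T) :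
    HasDerivWithinAt (fun s => ∫ r in (0 : ℝ)..s, v r) (v t) (Ioc 0 T) t := by
  -- The fundamental theorem is applied on [t/2,T], which avoids the singularity at 0 and gives the
  -- one-sided derivative at T.
  have hsub : Icc (t / 2) T ⊆ Ioc 0 T := fun r hr => ⟨(half_pos ht.1).trans_le hr.1, hr.2⟩
  have hmem : t ∈ Icc (t / 2) T := ⟨by linarith [ht.1], ht.2⟩
  have : Fact (t ∈ Icc (t / 2) T) := ⟨hmem⟩
  have hc := hv.1.mono hsub
  have h := intervalIntegral.integral_hasDerivWithinAt_right (s := Icc (t / 2) T)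
    (t := Icc (t / 2) T) (hv.intervalIntegrable hν (Ioc_subset_Icc_self ht))
    (hc.stronglyMeasurableAtFilter_nhdsWithin measurableSet_Icc t) (hc t hmem)
  refine h.mono_of_mem_nhdsWithin ?_
  filter_upwards [self_mem_nhdsWithin,
    mem_nhdsWithin_of_mem_nhds (Ioi_mem_nhds (half_lt_self ht.1))] with s h2 h3
  exact ⟨le_of_lt h3, h2.2⟩

theorem MemBC.continuousOn_integral [CompleteSpace E] {ν T : ℝ} (hν : 0 < ν) {v : ℝ → E}
    (hv : MemBC ν T v) (hT : 0 < T) :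
    ContinuousOn (fun s => ∫ r in (0 : ℝ)..s, v r) (Icc 0 T) := by
  have h := intervalIntegral.continuousOn_primitive_interval'
    (hv.intervalIntegrable hν (right_mem_Icc.2 hT.le)) (left_mem_uIcc)
  rwa [uIcc_of_le hT.le] at h

/-- Evaluation of `toBC` at a time, as a continuous linear map. -/
noncomputable def toBCCLM (ν : ℝ) {T : ℝ} (hT : 0 < T) (t : ℝ) : C(Icc 0 T, E) →L[ℝ] E :=
  t ^ (ν - 1) • (ContinuousMap.evalCLM ℝ (projIcc 0 T hT.le t) -
    ContinuousMap.evalCLM ℝ ⟨0, le_rfl, hT.le⟩)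

theorem toBCCLM_apply (ν : ℝ) {T : ℝ} (hT : 0 < T) (t : ℝ) (w : C(Icc 0 T, E)) :
    toBCCLM ν hT t w = toBC ν hT w t := rfl

/-- The primitive of `toBC`, as a continuous linear map. -/
noncomputable def integralBC (ν : ℝ) (hν : 0 < ν) {T : ℝ} (hT : 0 < T) (t : ℝ) (ht : 0 < t) :
    C(Icc 0 T, E) →L[ℝ] E :=
  LinearMap.mkContinuous
    { toFun := fun w => ∫ s in (0 : ℝ)..t, toBC ν hT w s
      map_add' := fun w z => by
        rw [← intervalIntegral.integral_add
          ((memBC_toBC ν hT w t).intervalIntegrable hν ⟨ht.le, le_rfl⟩)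
          ((memBC_toBC ν hT z t).intervalIntegrable hν ⟨ht.le, le_rfl⟩)]
        simp_rw [← toBCCLM_apply, map_add]
      map_smul' := fun c w => by
        simp_rw [← toBCCLM_apply, map_smul]
        simp }
    (2 * (t ^ ν / ν)) fun w => by
      have h1 : IntervalIntegrable (fun s : ℝ => s ^ (ν - 1) * (2 * ‖w‖)) MeasureTheory.volume 0 t :=
        (intervalIntegral.intervalIntegrable_rpow' (by linarith)).mul_const _
      have h2 : ∀ s ∈ Ioc 0 t, ‖toBC ν hT w s‖ ≤ s ^ (ν - 1) * (2 * ‖w‖) := fun s hs => by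
        calc ‖toBC ν hT w s‖ = s ^ (ν - 1) * (s ^ (1 - ν) * ‖toBC ν hT w s‖) := by
              rw [← mul_assoc, ← Real.rpow_add hs.1]; simp
          _ ≤ _ := mul_le_mul_of_nonneg_left (weight_toBC_le ν hT w hs.1)
              (Real.rpow_nonneg hs.1.le _)
      have h3 := intervalIntegral.norm_integral_le_of_norm_le ht.le
        (Eventually.of_forall fun s => h2 s) h1
      refine h3.trans (le_of_eq ?_)
      rw [intervalIntegral.integral_mul_const, integral_rpow (Or.inl (by linarith))]
      simp only [sub_add_cancel, Real.zero_rpow hν.ne', sub_zero]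
      ring

end WeightedSpace

section MaximalRegularity

variable {E₀ E₁ : Type*} [NormedAddCommGroup E₀] [NormedSpace ℝ E₀] [CompleteSpace E₀]
  [NormedAddCommGroup E₁] [NormedSpace ℝ E₁] [CompleteSpace E₁]
variable {j : E₁ →L[ℝ] E₀} {μ T : ℝ} {u v : ℝ → E₁} {u' v' : ℝ → E₀} {x y : E₀}

/-! ### Maximal regularity: a priori estimates -/

theorem Traj.integral_eq (hμ : 0 < μ) (h : Traj j μ T u u' x) {t : ℝ} (ht : t ∈ Ioc 0 T) :
    ∫ s in (0 : ℝ)..t, u' s = j (u t) - x := by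
  refine intervalIntegral.integral_eq_sub_of_hasDerivAt_of_tendsto
    (f := fun s => j (u s)) ht.1
    (fun s hs => h.hasDerivAt ⟨hs.1, hs.2.trans_le ht.2⟩)
    (h.memDeriv.intervalIntegrable hμ (Ioc_subset_Icc_self ht)) h.init ?_
  have h1 : ContinuousWithinAt (fun s => j (u s)) (Ioc 0 T) t :=
    (j.continuous.comp_continuousOn h.memU.1) t ht
  refine h1.tendsto.mono_left ?_
  rw [← nhdsWithin_Ioo_eq_nhdsLT ht.1]
  exact nhdsWithin_mono _ fun s hs => ⟨hs.1, hs.2.le.trans ht.2⟩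

/-- The integrated equation consists of continuous linear conditions on u and u', so it suits
closedness arguments; here the differential form is recovered from it. -/
theorem traj_of_integral_eq (hμ : 0 < μ) (hT : 0 < T) (hu : MemBC μ T u) (hu' : MemBC μ T u')
    (h : ∀ t ∈ Ioc 0 T, j (u t) = x + ∫ s in (0 : ℝ)..t, u' s) : Traj j μ T u u' x where
  init := by
    have h1 := (hu'.continuousOn_integral hμ hT) 0 ⟨le_rfl, hT.le⟩
    have h2 : Tendsto (fun t => x + ∫ s in (0 : ℝ)..t, u' s) (𝓝[>] 0) (𝓝 x) := by
      have h3 : Tendsto (fun t => ∫ s in (0 : ℝ)..t, u' s) (𝓝[>] 0) (𝓝 0) := by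
        have := h1.tendsto
        rw [intervalIntegral.integral_same] at this
        refine this.mono_left ?_
        rw [← nhdsWithin_Ioc_eq_nhdsGT hT]
        exact nhdsWithin_mono _ Ioc_subset_Icc_self
      simpa using h3.const_add x
    refine h2.congr' ?_
    filter_upwards [Ioc_mem_nhdsGT hT] with t ht
    rw [h t ht]
  memU := hu
  memDeriv := hu'
  deriv t ht :=
    ((hu'.hasDerivWithinAt_integral hμ ht).const_add x).congr (fun s hs => h s hs) (h t ht)

/-- Estimates for the inhomogeneous linear problem `u' + B u = f`, `u(0) = x`, uniformly on all
intervals of length at most `T`. -/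
def APriori (j : E₁ →L[ℝ] E₀) (μ : ℝ) (B : E₁ →L[ℝ] E₀) (T C : ℝ) : Prop :=
  ∀ (S : ℝ) (u : ℝ → E₁) (u' : ℝ → E₀) (x : E₀) (M : ℝ), 0 < S → S ≤ T → Traj j μ S u u' x →
    x ∈ contInterp j μ → (∀ t ∈ Ioc 0 S, t ^ (1 - μ) * ‖u' t + B (u t)‖ ≤ M) →
    ∀ t ∈ Ioc 0 S, t ^ (1 - μ) * ‖u t‖ ≤ C * (M + interpNorm j μ x) ∧
      interpNorm j μ (j (u t)) ≤ C * (M + interpNorm j μ x)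

/-- Solvability of the inhomogeneous linear problem on all intervals of length at most `T`. -/
def Solvable (j : E₁ →L[ℝ] E₀) (μ : ℝ) (B : E₁ →L[ℝ] E₀) (T : ℝ) : Prop :=
  ∀ (S : ℝ) (f : ℝ → E₀) (x : E₀), 0 < S → S ≤ T → MemBC μ S f → x ∈ contInterp j μ →
    ∃ u u', Traj j μ S u u' x ∧ ∀ t ∈ Ioc 0 S, u' t + B (u t) = f t

/-- The triples (f, x, u) satisfying the integrated equation form a closed subspace of a Banach
space, and solvability says that its projection to (f, x) is onto. The open mapping theorem then
provides a solution bounded by the data; uniqueness plays no role here. -/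
theorem exists_solution_bound (hμ : μ ∈ Ioo (0 : ℝ) 1) (hT : 0 < T) {B : E₁ →L[ℝ] E₀}
    (h : ∀ f : ℝ → E₀, MemBC μ T f → ∀ x ∈ contInterp j μ, ∃ u, IsLinearSolution j μ T B f x u) :
    ∃ C : ℝ, 0 < C ∧ ∀ (f : ℝ → E₀) (M : ℝ) (x : E₀), MemBC μ T f →
      (∀ t ∈ Ioc 0 T, t ^ (1 - μ) * ‖f t‖ ≤ M) → x ∈ contInterp j μ →
      ∃ u u', Traj j μ T u u' x ∧ (∀ t ∈ Ioc 0 T, u' t + B (u t) = f t) ∧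
        ∀ t ∈ Ioc 0 T, t ^ (1 - μ) * ‖u t‖ ≤ C * (M + interpNorm j μ x) := by
  set ι : InterpSpace j μ →L[ℝ] E₀ := LinearMap.mkContinuous (incl j μ) (1 + ‖j‖) fun x =>
    norm_le_interpNorm j x.2 with hι
  let X := (C(Icc 0 T, E₀) × InterpSpace j μ) × C(Icc 0 T, E₁)
  let pw : X →L[ℝ] C(Icc 0 T, E₀) := (ContinuousLinearMap.fst ℝ _ _).comp
    (ContinuousLinearMap.fst ℝ _ _)
  let px : X →L[ℝ] InterpSpace j μ := (ContinuousLinearMap.snd ℝ _ _).comp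
    (ContinuousLinearMap.fst ℝ _ _)
  let py : X →L[ℝ] C(Icc 0 T, E₁) := ContinuousLinearMap.snd ℝ _ _
  -- Defect of u(t) = x + ∫₀ᵗ (f - Bu) at time t. It is continuous in the triple, so the common
  -- kernel over all t is closed.
  let Λ : ∀ t : Ioc 0 T, X →L[ℝ] E₀ := fun t =>
    (j.comp (toBCCLM μ hT t)).comp py - ι.comp px - (integralBC μ hμ.1 hT t t.2.1).comp pw
      + (B.comp (integralBC μ hμ.1 hT t t.2.1)).comp py
  let G : Submodule ℝ X := ⨅ t, LinearMap.ker (Λ t).toLinearMap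
  have hGmem : ∀ p : X, p ∈ G ↔ ∀ t, Λ t p = 0 := fun p => by
    simp only [G, Submodule.mem_iInf]
    rfl
  have hGc : IsClosed (G : Set X) := by
    have : (G : Set X) = ⋂ t, {p | Λ t p = 0} := by
      ext p
      simp [hGmem]
    rw [this]
    exact isClosed_iInter fun t => isClosed_eq (Λ t).continuous continuous_const
  have : CompleteSpace G := hGc.completeSpace_coe
  let π : G →L[ℝ] C(Icc 0 T, E₀) × InterpSpace j μ :=
    (ContinuousLinearMap.fst ℝ _ _).comp G.subtypeL
  have hΛ : ∀ (w : C(Icc 0 T, E₀)) (p : InterpSpace j μ) (y : C(Icc 0 T, E₁)) (t : Ioc 0 T),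
      Λ t ((w, p), y) = j (toBC μ hT y t) - incl j μ p - (∫ s in (0 : ℝ)..t, toBC μ hT w s)
        + B (∫ s in (0 : ℝ)..t, toBC μ hT y s) := fun w p y t => rfl
  have hint : ∀ (w : C(Icc 0 T, E₀)) (y : C(Icc 0 T, E₁)) (t : ℝ), 0 < t →
      (∫ s in (0 : ℝ)..t, (toBC μ hT w s - B (toBC μ hT y s))) =
        (∫ s in (0 : ℝ)..t, toBC μ hT w s) - B (∫ s in (0 : ℝ)..t, toBC μ hT y s) := by
    intro w y t ht
    have h1 := (memBC_toBC μ hT w t).intervalIntegrable hμ.1 ⟨ht.le, le_rfl⟩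
    have h2 := (memBC_toBC μ hT y t).intervalIntegrable hμ.1 ⟨ht.le, le_rfl⟩
    have h3 := ((memBC_toBC μ hT y t).clm ht B).intervalIntegrable hμ.1 ⟨ht.le, le_rfl⟩
    rw [intervalIntegral.integral_sub h1 h3, B.intervalIntegral_comp_comm h2]
  have hsurj : Function.Surjective π := by
    rintro ⟨w, p⟩
    obtain ⟨u, hu0, u', hu1, hu2⟩ := h (toBC μ hT w) (memBC_toBC μ hT w T) (incl j μ p)
      (incl_mem j μ p)
    have htr := traj_of_memMaxRegSpace hu0 hu1
    set y := ofBC hμ.2 htr.memU with hy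
    have hyu : EqOn (toBC μ hT y) u (Ioc 0 T) := toBC_ofBC hμ.2 htr.memU hT
    refine ⟨⟨((w, p), y), (hGmem _).2 fun t => ?_⟩, rfl⟩
    rw [hΛ, hyu t.2]
    have h1 := htr.integral_eq hμ.1 t.2
    have h2 : (∫ s in (0 : ℝ)..t, u' s) =
        ∫ s in (0 : ℝ)..t, (toBC μ hT w s - B (toBC μ hT y s)) := by
      refine intervalIntegral.integral_congr_ae (Eventually.of_forall fun s hs => ?_)
      rw [uIoc_of_le t.2.1.le] at hs
      have hs' : s ∈ Ioc 0 T := ⟨hs.1, hs.2.trans t.2.2⟩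
      rw [hyu hs', ← hu2 s hs', add_sub_cancel_right]
    rw [h2, hint w y t t.2.1] at h1
    have h3 : j (u t) - incl j μ p - (∫ s in (0 : ℝ)..t, toBC μ hT w s)
        + B (∫ s in (0 : ℝ)..t, toBC μ hT y s) = (j (u t) - incl j μ p) -
        ((∫ s in (0 : ℝ)..t, toBC μ hT w s) - B (∫ s in (0 : ℝ)..t, toBC μ hT y s)) := by abel
    rw [h3, h1, sub_self]
  obtain ⟨C, hC0, hC⟩ := ContinuousLinearMap.exists_preimage_norm_le (E := G) (F := C(Icc 0 T, E₀) × InterpSpace j μ) (σ' := RingHom.id ℝ) π hsurj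
  -- The factor 2 comes from `weight_toBC_le`: `toBC` subtracts the value at 0, and the continuous
  -- function supplied by the open mapping theorem need not vanish there.
  refine ⟨2 * C, by positivity, fun f M x hf hM hx => ?_⟩
  have hM0 : 0 ≤ M := (mul_nonneg (Real.rpow_nonneg hT.le _) (norm_nonneg _)).trans
    (hM T ⟨hT, le_rfl⟩)
  set w := ofBC hμ.2 hf with hw
  obtain ⟨⟨⟨⟨w', p'⟩, y⟩, hyG⟩, hy1, hy2⟩ := hC (w, toInterp j μ x hx)
  obtain ⟨rfl, rfl⟩ : w' = w ∧ p' = toInterp j μ x hx := Prod.mk.inj hy1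
  have hyn : ‖y‖ ≤ C * (M + interpNorm j μ x) := by
    have h1 : ‖y‖ ≤ ‖(((w, toInterp j μ x hx), y) : X)‖ := norm_snd_le (((w, toInterp j μ x hx), y) : X)
    have h2 : ‖((w, toInterp j μ x hx) : C(Icc 0 T, E₀) × InterpSpace j μ)‖
        ≤ M + interpNorm j μ x := by
      refine max_le ?_ ?_
      · exact (norm_ofBC_le hμ.2 hf hT hM).trans (le_add_of_nonneg_right (interpNorm_nonneg j μ x))
      · exact le_add_of_nonneg_left hM0
    exact h1.trans (hy2.trans (mul_le_mul_of_nonneg_left h2 hC0.le))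
  have hfw : EqOn (toBC μ hT w) f (Ioc 0 T) := toBC_ofBC hμ.2 hf hT
  have htr : Traj j μ T (toBC μ hT y) (fun t => toBC μ hT w t - B (toBC μ hT y t)) x := by
    refine traj_of_integral_eq hμ.1 hT (memBC_toBC μ hT y T)
      ((memBC_toBC μ hT w T).sub hT ((memBC_toBC μ hT y T).clm hT B)) fun t ht => ?_
    have h1 := (hGmem _).1 hyG ⟨t, ht⟩
    rw [hΛ, incl_toInterp] at h1
    rw [hint w y t ht.1]
    simp only at h1
    have h4 : j (toBC μ hT y t) - (x + ((∫ s in (0 : ℝ)..t, toBC μ hT w s) -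
      B (∫ s in (0 : ℝ)..t, toBC μ hT y s))) = 0 := by rw [← h1]; abel
    exact sub_eq_zero.1 h4
  refine ⟨toBC μ hT y, _, htr, fun t ht => ?_, fun t ht => ?_⟩
  · rw [sub_add_cancel, hfw ht]
  · refine (weight_toBC_le μ hT y ht.1).trans ?_
    linarith

/-- Uniqueness for the homogeneous problem passes to shorter intervals. -/
theorem eq_zero_of_homogeneous (hμ : μ ∈ Ioo (0 : ℝ) 1) (hT : 0 < T) {B : E₁ →L[ℝ] E₀}
    (h : ∀ w w', Traj j μ T w w' 0 → (∀ t ∈ Ioc 0 T, w' t + B (w t) = 0) → EqOn w 0 (Ioc 0 T))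
    {S : ℝ} (hS : 0 < S) (hST : S ≤ T) (hu : Traj j μ S u u' 0)
    (hB : ∀ t ∈ Ioc 0 S, u' t + B (u t) = 0) : EqOn u 0 (Ioc 0 S) := by
  -- A solution on [0,S] is turned into one on [0,T] by delaying it by T - S and putting 0 before.
  -- The solution u may be singular in E₁ at time 0, but its primitive U is continuous there with
  -- U(0) = 0 and solves the same equation, so the delayed primitive is again in the class.
  -- Uniqueness on [0,T] gives U = 0, and u is the derivative of U.
  set U : ℝ → E₁ := fun t => ∫ s in (0 : ℝ)..t, u s with hU
  have hU0 : U 0 = 0 := intervalIntegral.integral_same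
  have hUc : ContinuousOn U (Icc 0 S) := hu.memU.continuousOn_integral hμ.1 hS
  set a := T - S with ha
  have ha0 : 0 ≤ a := sub_nonneg.2 hST
  set W : ℝ → E₁ := fun t => U (max (t - a) 0) with hW
  have hWc : ContinuousOn W (Icc 0 T) := by
    refine hUc.comp (by fun_prop) fun t ht => ⟨le_max_right _ _, max_le ?_ hS.le⟩
    linarith [ht.2]
  have hBU : ∀ t ∈ Ioc 0 S, - B (U t) = j (u t) := by
    intro t ht
    have h1 := hu.integral_eq hμ.1 ht
    rw [sub_zero] at h1
    rw [← h1, hU]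
    simp only
    rw [← B.intervalIntegral_comp_comm (hu.memU.intervalIntegrable hμ.1 (Ioc_subset_Icc_self ht)),
      ← intervalIntegral.integral_neg]
    refine intervalIntegral.integral_congr_ae (Eventually.of_forall fun s hs => ?_)
    rw [uIoc_of_le ht.1.le] at hs
    have := hB s ⟨hs.1, hs.2.trans ht.2⟩
    exact (eq_neg_of_add_eq_zero_left this).symm
  have hBWc : ContinuousOn (fun t => -B (W t)) (Icc 0 T) :=
    (B.continuous.comp_continuousOn hWc).neg
  have hWtr : Traj j μ T W (fun t => -B (W t)) 0 := by
    refine traj_of_integral_eq hμ.1 hT (MemBC.of_continuousOn hμ.2 hT hWc)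
      (MemBC.of_continuousOn hμ.2 hT hBWc) fun t ht => ?_
    have hz : ∀ s ∈ Icc 0 a, W s = 0 := fun s hs => by
      simp only [hW]
      rw [max_eq_right (by linarith [hs.2]), hU0]
    rcases le_or_gt t a with hta | hta
    · rw [hz t ⟨ht.1.le, hta⟩, map_zero, zero_add]
      symm
      refine intervalIntegral.integral_zero_ae (Eventually.of_forall fun s hs => ?_)
      rw [uIoc_of_le ht.1.le] at hs
      rw [hz s ⟨hs.1.le, hs.2.trans hta⟩, map_zero, neg_zero]
    · have hi : IntervalIntegrable (fun t => -B (W t)) MeasureTheory.volume 0 T :=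
        (hBWc.mono (by rw [uIcc_of_le hT.le])).intervalIntegrable
      have hi1 : IntervalIntegrable (fun t => -B (W t)) MeasureTheory.volume 0 a :=
        hi.mono_set (by rw [uIcc_of_le ha0, uIcc_of_le hT.le]; exact Icc_subset_Icc_right (by linarith))
      have hi2 : IntervalIntegrable (fun t => -B (W t)) MeasureTheory.volume a t :=
        hi.mono_set (by
          rw [uIcc_of_le hta.le, uIcc_of_le hT.le]; exact Icc_subset_Icc ha0 ht.2)
      rw [← intervalIntegral.integral_add_adjacent_intervals hi1 hi2]
      have h1 : ∫ s in (0 : ℝ)..a, -B (W s) = 0 := by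
        refine intervalIntegral.integral_zero_ae (Eventually.of_forall fun s hs => ?_)
        rw [uIoc_of_le ha0] at hs
        rw [hz s ⟨hs.1.le, hs.2⟩, map_zero, neg_zero]
      have h2 : ∫ s in a..t, -B (W s) = ∫ s in (0 : ℝ)..(t - a), j (u s) := by
        have h3 := intervalIntegral.integral_comp_sub_right (a := a) (b := t)
          (fun s => -B (U (max s 0))) a
        simp only [hW]
        rw [h3, sub_self]
        refine intervalIntegral.integral_congr_ae (Eventually.of_forall fun s hs => ?_)
        rw [uIoc_of_le (sub_nonneg.2 hta.le)] at hs
        rw [max_eq_left hs.1.le]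
        exact hBU s ⟨hs.1, hs.2.trans (by linarith [ht.2])⟩
      have h4 : t - a ∈ Icc 0 S := ⟨by linarith, by linarith [ht.2]⟩
      rw [h1, h2, j.intervalIntegral_comp_comm (hu.memU.intervalIntegrable hμ.1 h4), zero_add,
        zero_add]
      simp only [hW]
      rw [max_eq_left h4.1]
  have hW0 := h W _ hWtr fun t _ => neg_add_cancel _
  intro t ht
  have hUz : ∀ s ∈ Ioc 0 S, U s = 0 := fun s hs => by
    have h1 : s + a ∈ Ioc 0 T := ⟨by linarith [hs.1], by linarith [hs.2]⟩
    have h2 := hW0 h1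
    simp only [hW] at h2
    rwa [add_sub_cancel_right, max_eq_left hs.1.le] at h2
  have h1 := hu.memU.hasDerivWithinAt_integral hμ.1 ht
  have h2 : HasDerivWithinAt (fun s => ∫ r in (0 : ℝ)..s, u r) 0 (Ioc 0 S) t :=
    (hasDerivWithinAt_const t (Ioc 0 S) (0 : E₁)).congr hUz (hUz t ht)
  exact (uniqueDiffOn_Ioc 0 S t ht).eq_deriv _ h1 h2

/-- On a shorter interval [0,S] the right-hand side is extended to [0,T] with the same weighted
bound and solved there; uniqueness on [0,S] identifies the restriction with u. Hence one constant
serves all S ≤ T. -/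
theorem exists_aPriori_of_maxReg (hμ : μ ∈ Ioo (0 : ℝ) 1) {B : E₁ →L[ℝ] E₀}
    (hB : B ∈ maxReg j μ) :
    ∃ T C : ℝ, 0 < T ∧ 0 < C ∧ APriori j μ B T C ∧ Solvable j μ B T := by
  obtain ⟨T, hT, h⟩ := hB
  obtain ⟨C, hC, hsol⟩ := exists_solution_bound hμ hT fun f hf x hx => (h f hf x hx).1
  have huniq : ∀ w w', Traj j μ T w w' 0 → (∀ t ∈ Ioc 0 T, w' t + B (w t) = 0) →
      EqOn w 0 (Ioc 0 T) := by
    intro w w' hw hw0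
    have h0 := (h (fun _ => 0) (MemBC.of_continuousOn hμ.2 hT continuousOn_const) 0
      (contInterp j μ).zero_mem).2
    refine h0 w (fun _ => 0) ⟨hw.init, w', hw.memMaxRegSpace hT, hw0⟩ ?_
    have h1 := Traj.const (j := j) hμ.2 hT (0 : E₁)
    rw [map_zero] at h1
    exact ⟨h1.init, _, h1.memMaxRegSpace hT, by simp⟩
  have hmu := hμ.1
  -- 1 + C + ‖B‖C bounds the weighted sizes of both u and u' = f - Bu, the factor 1 + 1/μ is that of
  -- the trace estimate, and the final 1 accounts for the initial value.
  refine ⟨T, (1 + 1 / μ) * (1 + C + ‖B‖ * C) + 1, hT, by positivity, ?_, ?_⟩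
  · intro S u u' x M hS hST hu hx hM t ht
    have hf : MemBC μ S fun t => u' t + B (u t) := hu.memDeriv.add (hu.memU.clm hS B)
    obtain ⟨f, hf1, hf2, hf3⟩ := hf.exists_extension hμ.2 hS hM T
    obtain ⟨v, v', hv, hv1, hv2⟩ := hsol f M x hf1 (fun t ht => hf3 t ht.1) hx
    have hd := hu.sub hS (hv.mono hST)
    rw [sub_self] at hd
    have hz := eq_zero_of_homogeneous hμ hT huniq hS hST hd fun t ht => by
      have h1 := hf2 ht
      have h2 := hv1 t ⟨ht.1, ht.2.trans hST⟩
      simp only at h1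
      rw [map_sub, ← sub_eq_zero.2 (h1.symm.trans h2.symm)]
      abel
    have hM0 : 0 ≤ M := (mul_nonneg (Real.rpow_nonneg hS.le _) (norm_nonneg _)).trans
      (hM S ⟨hS, le_rfl⟩)
    have hx0 := interpNorm_nonneg j μ x
    have hu1 : ∀ t ∈ Ioc 0 S, t ^ (1 - μ) * ‖u t‖ ≤ C * (M + interpNorm j μ x) := fun t ht => by
      rw [sub_eq_zero.1 (hz ht)]
      exact hv2 t ⟨ht.1, ht.2.trans hST⟩
    set N := M + interpNorm j μ x with hN
    have hN0 : 0 ≤ N := add_nonneg hM0 hx0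
    have hMN : M ≤ N := le_add_of_nonneg_right hx0
    have hu2 : ∀ t ∈ Ioc 0 S, t ^ (1 - μ) * ‖u' t‖ ≤ (1 + ‖B‖ * C) * N := fun t ht => by
      have hp := Real.rpow_nonneg ht.1.le (1 - μ)
      have h1 : ‖u' t‖ ≤ ‖u' t + B (u t)‖ + ‖B‖ * ‖u t‖ := by
        have := norm_sub_le (u' t + B (u t)) (B (u t))
        rw [add_sub_cancel_right] at this
        linarith [B.le_opNorm (u t)]
      calc t ^ (1 - μ) * ‖u' t‖ ≤ t ^ (1 - μ) * (‖u' t + B (u t)‖ + ‖B‖ * ‖u t‖) :=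
            mul_le_mul_of_nonneg_left h1 hp
        _ = t ^ (1 - μ) * ‖u' t + B (u t)‖ + ‖B‖ * (t ^ (1 - μ) * ‖u t‖) := by ring
        _ ≤ N + ‖B‖ * (C * N) := add_le_add ((hM t ht).trans hMN)
            (mul_le_mul_of_nonneg_left (hu1 t ht) (norm_nonneg _))
        _ = _ := by ring
    have hBC : 0 ≤ ‖B‖ * C := by positivity
    have h3 := hu.interpNorm_le hμ hx (M := (1 + C + ‖B‖ * C) * N)
      (fun t ht => (hu1 t ht).trans (mul_le_mul_of_nonneg_right (by linarith) hN0))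
      (fun t ht => (hu2 t ht).trans (mul_le_mul_of_nonneg_right (by linarith) hN0)) ht
    refine ⟨(hu1 t ht).trans (mul_le_mul_of_nonneg_right ?_ hN0), h3.trans ?_⟩
    · have h4 : 0 ≤ 1 / μ * (1 + C + ‖B‖ * C) := by positivity
      linarith
    · have : interpNorm j μ x ≤ N := le_add_of_nonneg_left hM0
      linarith
  · intro S f x hS hST hf hx
    obtain ⟨M, hM⟩ := hf.2.1
    obtain ⟨g, hg1, hg2, -⟩ := hf.exists_extension hμ.2 hS hM T
    obtain ⟨M', hM'⟩ := hg1.2.1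
    obtain ⟨v, v', hv, hv1, -⟩ := hsol g M' x hg1 hM' hx
    exact ⟨v, v', hv.mono hST, fun t ht => by rw [hv1 t ⟨ht.1, ht.2.trans hST⟩, hg2 ht]⟩

end MaximalRegularity

/-- A bound that improves itself by a factor. -/
theorem le_two_mul_of_self_improving {ι : Type*} {s : Set ι} {q : ι → ℝ} {a D₀ : ℝ}
    (hq : ∀ i ∈ s, 0 ≤ q i) (h₀ : ∀ i ∈ s, q i ≤ D₀)
    (h : ∀ D, 0 ≤ D → (∀ i ∈ s, q i ≤ D) → ∀ i ∈ s, q i ≤ a + D / 2) :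
    ∀ i ∈ s, q i ≤ 2 * a := by
  intro i hi
  have hb : BddAbove (q '' s) := ⟨D₀, by rintro _ ⟨k, hk, rfl⟩; exact h₀ k hk⟩
  have hle : ∀ k ∈ s, q k ≤ sSup (q '' s) := fun k hk => le_csSup hb (mem_image_of_mem q hk)
  have h1 : sSup (q '' s) ≤ a + sSup (q '' s) / 2 := by
    refine csSup_le ⟨_, mem_image_of_mem q hi⟩ ?_
    rintro _ ⟨k, hk, rfl⟩
    exact h _ ((hq i hi).trans (hle i hi)) hle k hk
  linarith [hle i hi]

/-- Boundedness of the weighted function is automatic: near 0 it follows from the limit, and the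
rest of (0,T] is compact. -/
theorem MemBC.of_tendsto {E : Type*} [NormedAddCommGroup E] {ν T : ℝ} {v : ℝ → E}
    (hv : ContinuousOn v (Ioc 0 T))
    (h : Tendsto (fun t => t ^ (1 - ν) * ‖v t‖) (𝓝[>] 0) (𝓝 0)) : MemBC ν T v := by
  refine ⟨hv, ?_, h⟩
  obtain ⟨s, hs, hs'⟩ : ∃ s > 0, Ioo 0 s ⊆ {t | t ^ (1 - ν) * ‖v t‖ < 1} :=
    (mem_nhdsGT_iff_exists_Ioo_subset).1 (h.eventually (gt_mem_nhds one_pos))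
  have hs : (0 : ℝ) < s := hs
  have hc : ContinuousOn (fun t => t ^ (1 - ν) * ‖v t‖) (Icc s T) := by
    refine ContinuousOn.mul (fun t ht => ?_) (hv.norm.mono fun t ht => ⟨hs.trans_le ht.1, ht.2⟩)
    exact (Real.continuousAt_rpow_const t _ (Or.inl (hs.trans_le ht.1).ne')).continuousWithinAt
  obtain ⟨C, hC⟩ := isCompact_Icc.exists_bound_of_continuousOn hc
  refine ⟨max 1 C, fun t ht => ?_⟩
  rcases lt_or_ge t s with h1 | h1
  · exact (le_of_lt (hs' ⟨ht.1, h1⟩)).trans (le_max_left _ _)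
  · exact ((le_abs_self _).trans (hC t ⟨h1, ht.2⟩)).trans (le_max_right _ _)

section Perturbation

variable {E₀ E₁ : Type*} [NormedAddCommGroup E₀] [NormedSpace ℝ E₀] [CompleteSpace E₀]
  [NormedAddCommGroup E₁] [NormedSpace ℝ E₁] [CompleteSpace E₁]
variable {j : E₁ →L[ℝ] E₀} {μ T : ℝ} {u v : ℝ → E₁} {u' v' : ℝ → E₀} {x y : E₀}

/-! ### Perturbation of the linear problem -/

theorem APriori.mono {B : E₁ →L[ℝ] E₀} {C : ℝ} (h : APriori j μ B T C) {T' : ℝ} (hT : T' ≤ T) :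
    APriori j μ B T' C :=
  fun S u u' x M hS hST => h S u u' x M hS (hST.trans hT)

theorem APriori.eqOn {B : E₁ →L[ℝ] E₀} {C : ℝ} (h : APriori j μ B T C)
    {S : ℝ} (hS : 0 < S) (hST : S ≤ T) (hu : Traj j μ S u u' x) (hv : Traj j μ S v v' x)
    (he : ∀ t ∈ Ioc 0 S, u' t + B (u t) = v' t + B (v t)) : EqOn u v (Ioc 0 S) := by
  intro t ht
  have hd := hu.sub hS hv
  have h1 := (h S _ _ _ 0 hS hST hd (by rw [sub_self]; exact (contInterp j μ).zero_mem)
    (fun s hs => by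
      have : u' s - v' s + B (u s - v s) = 0 := by
        rw [map_sub, ← sub_eq_zero.2 (he s hs)]; abel
      rw [this, norm_zero, mul_zero]) t ht).1
  rw [sub_self, interpNorm_zero, add_zero, mul_zero] at h1
  have h2 := Real.rpow_pos_of_pos ht.1 (1 - μ)
  have h3 : ‖u t - v t‖ ≤ 0 := by
    by_contra h4
    exact absurd h1 (not_le.2 (mul_pos h2 (not_le.1 h4)))
  exact sub_eq_zero.1 (norm_le_zero_iff.1 h3)

/-- A time t in (T, 2T] is reached by restarting at t - T, where the E_μ-bound on the first interval
supplies the initial value. Shifting time only decreases the weight, and t^{1-μ} ≤ 2T^{1-μ} converts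
the weight back. -/
theorem APriori.double (hμ : μ ∈ Ioo (0 : ℝ) 1) {B : E₁ →L[ℝ] E₀} {C : ℝ} (hT : 0 < T)
    (hC : 0 < C) (h : APriori j μ B T C) : APriori j μ B (2 * T) (2 * C * (1 + C)) := by
  intro S u u' x M hS hST hu hx hM t ht
  have hM0 : 0 ≤ M := (mul_nonneg (Real.rpow_nonneg hS.le _) (norm_nonneg _)).trans
    (hM S ⟨hS, le_rfl⟩)
  set N := M + interpNorm j μ x with hN
  have hx0 := interpNorm_nonneg j μ x
  have hN0 : 0 ≤ N := add_nonneg hM0 hx0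
  have hshort : ∀ s ∈ Ioc 0 S, s ≤ T → s ^ (1 - μ) * ‖u s‖ ≤ C * N ∧
      interpNorm j μ (j (u s)) ≤ C * N := fun s hs hsT =>
    h s u u' x M hs.1 hsT (hu.mono hs.2) hx (fun r hr => hM r ⟨hr.1, hr.2.trans hs.2⟩) s
      ⟨hs.1, le_rfl⟩
  have hCN : C * N ≤ 2 * C * (1 + C) * N :=
    mul_le_mul_of_nonneg_right (by nlinarith) hN0
  rcases le_or_gt t T with htT | htT
  · exact ⟨(hshort t ht htT).1.trans hCN, (hshort t ht htT).2.trans hCN⟩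
  · set a := t - T with ha
    have ha0 : 0 < a := sub_pos.2 htT
    have haT : a ≤ T := by linarith [ht.2]
    have haS : a < S := by linarith [ht.2]
    have h1 := (hshort a ⟨ha0, haS.le⟩ haT).2
    have h2 := h T _ _ _ M hT le_rfl ((hu.shift hμ.2 ha0 haS).mono (by linarith [ht.2]))
      (embed_mem j hμ _) (fun r hr => by
        have hr' : a + r ∈ Ioc 0 S := ⟨by linarith [hr.1], by linarith [hr.2, ht.2]⟩
        refine le_trans (mul_le_mul_of_nonneg_right ?_ (norm_nonneg _)) (hM _ hr')
        exact Real.rpow_le_rpow hr.1.le (by linarith) (by linarith [hμ.2])) T ⟨hT, le_rfl⟩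
    rw [show a + T = t by rw [ha]; ring] at h2
    have h3 : C * (M + interpNorm j μ (j (u a))) ≤ C * (1 + C) * N := by
      have : M + interpNorm j μ (j (u a)) ≤ (1 + C) * N := by linarith
      calc _ ≤ C * ((1 + C) * N) := mul_le_mul_of_nonneg_left this hC.le
        _ = _ := by ring
    have hCC : 0 ≤ C * (1 + C) * N := by positivity
    refine ⟨?_, h2.2.trans (h3.trans (by linarith))⟩
    have h4 : t ^ (1 - μ) ≤ 2 * T ^ (1 - μ) := by
      calc t ^ (1 - μ) ≤ (2 * T) ^ (1 - μ) :=
            Real.rpow_le_rpow ht.1.le (by linarith [ht.2]) (by linarith [hμ.2])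
        _ = 2 ^ (1 - μ) * T ^ (1 - μ) := Real.mul_rpow two_pos.le hT.le
        _ ≤ 2 * T ^ (1 - μ) := by
            refine mul_le_mul_of_nonneg_right ?_ (Real.rpow_nonneg hT.le _)
            calc (2 : ℝ) ^ (1 - μ) ≤ 2 ^ (1 : ℝ) :=
                  Real.rpow_le_rpow_of_exponent_le one_le_two (by linarith [hμ.1])
              _ = 2 := Real.rpow_one 2
    calc t ^ (1 - μ) * ‖u t‖ ≤ 2 * T ^ (1 - μ) * ‖u t‖ :=
          mul_le_mul_of_nonneg_right h4 (norm_nonneg _)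
      _ = 2 * (T ^ (1 - μ) * ‖u t‖) := by ring
      _ ≤ 2 * (C * (1 + C) * N) := by linarith [h2.1]
      _ = _ := by ring

theorem APriori.exists_long (hμ : μ ∈ Ioo (0 : ℝ) 1) {B : E₁ →L[ℝ] E₀} {C : ℝ} (hT : 0 < T)
    (hC : 0 < C) (h : APriori j μ B T C) (R : ℝ) : ∃ C', 0 < C' ∧ APriori j μ B R C' := by
  have key : ∀ n : ℕ, ∃ C', 0 < C' ∧ APriori j μ B (2 ^ n * T) C' := by
    intro n
    induction n with
    | zero => exact ⟨C, hC, by simpa using h⟩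
    | succ n ih =>
      obtain ⟨C', hC', h'⟩ := ih
      refine ⟨_, ?_, by
        rw [pow_succ', mul_assoc]; exact h'.double hμ (by positivity) hC'⟩
      positivity
  obtain ⟨n, hn⟩ := pow_unbounded_of_one_lt (R / T) one_lt_two
  obtain ⟨C', hC', h'⟩ := key n
  exact ⟨C', hC', h'.mono ((div_lt_iff₀ hT).1 hn).le⟩

/-- The linear operator `P` is of lower order with respect to the time-weighted norms. -/
def LowerOrder (j : E₁ →L[ℝ] E₀) (μ : ℝ) (P : E₁ →L[ℝ] E₀) : Prop :=
  ∀ ε : ℝ, 0 < ε → ∃ r : ℝ, 0 < r ∧ ∀ (t : ℝ) (a : E₁), 0 < t → t ≤ r →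
    t ^ (1 - μ) * ‖P a‖ ≤ ε * (interpNorm j μ (j a) + t ^ (1 - μ) * ‖a‖)

/-- The term Pu is moved to the right-hand side and absorbed on a short interval. -/
theorem APriori.add_lowerOrder {B P : E₁ →L[ℝ] E₀} {C : ℝ} (hT : 0 < T)
    (hC : 0 < C) (h : APriori j μ B T C) (hP : LowerOrder j μ P) :
    ∃ T', 0 < T' ∧ T' ≤ T ∧ APriori j μ (B + P) T' (2 * C) := by
  -- With this ε the term Pu adds at most 2D/(4C) to the data bound when both norms of u are at most
  -- D, hence D/2 after multiplication by C. The estimate for B with uncontrolled data first shows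
  -- that these norms are finite.
  obtain ⟨r, hr, hPr⟩ := hP (1 / (4 * C)) (by positivity)
  refine ⟨min T r, lt_min hT hr, min_le_left _ _, ?_⟩
  intro S u u' x M hS hST hu hx hM
  have hST1 := hST.trans (min_le_left _ _)
  have hSr := hST.trans (min_le_right _ _)
  obtain ⟨M', hM'⟩ := (hu.memDeriv.add (hu.memU.clm hS B)).2.1
  have h0 := h S u u' x M' hS hST1 hu hx hM'
  set q : ℝ → ℝ := fun t => max (t ^ (1 - μ) * ‖u t‖) (interpNorm j μ (j (u t))) with hq
  have key : ∀ t ∈ Ioc 0 S, q t ≤ 2 * (C * (M + interpNorm j μ x)) := by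
    refine le_two_mul_of_self_improving (D₀ := C * (M' + interpNorm j μ x))
      (fun t _ => (interpNorm_nonneg j μ _).trans (le_max_right _ _))
      (fun t ht => max_le (h0 t ht).1 (h0 t ht).2) fun D hD hqD t ht => ?_
    have h1 := h S u u' x (M + D / (2 * C)) hS hST1 hu hx (fun s hs => by
      have h2 := hPr s (u s) hs.1 (hs.2.trans hSr)
      have h3 := (le_max_left _ _).trans (hqD s hs)
      have h4 := (le_max_right _ _).trans (hqD s hs)
      have hp := Real.rpow_nonneg hs.1.le (1 - μ)
      have h5 : ‖u' s + B (u s)‖ ≤ ‖u' s + (B + P) (u s)‖ + ‖P (u s)‖ := by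
        have := norm_sub_le (u' s + (B + P) (u s)) (P (u s))
        rwa [add_apply, ← add_assoc, add_sub_cancel_right, add_assoc] at this
      calc s ^ (1 - μ) * ‖u' s + B (u s)‖
          ≤ s ^ (1 - μ) * ‖u' s + (B + P) (u s)‖ + s ^ (1 - μ) * ‖P (u s)‖ := by
            rw [← mul_add]; exact mul_le_mul_of_nonneg_left h5 hp
        _ ≤ M + 1 / (4 * C) * (D + D) := by
            refine add_le_add (hM s hs) (h2.trans ?_)
            exact mul_le_mul_of_nonneg_left (add_le_add h4 h3) (by positivity)
        _ = M + D / (2 * C) := by field_simp; ring) t ht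
    have h6 : C * (M + D / (2 * C) + interpNorm j μ x) = C * (M + interpNorm j μ x) + D / 2 := by
      field_simp
      ring
    rw [h6] at h1
    exact max_le h1.1 h1.2
  intro t ht
  have h1 := key t ht
  rw [← mul_assoc] at h1
  exact ⟨(le_max_left _ _).trans h1, (le_max_right _ _).trans h1⟩

/-! ### Small nonlinear perturbations: local solutions -/

/-- `Φ` is a small Lipschitz perturbation on the `r₀`-ball of `E_μ`, with respect to the
time-weighted norms. -/
def SmallPert (j : E₁ →L[ℝ] E₀) (μ : ℝ) (Φ : E₁ → E₀) (r₀ L : ℝ) : Prop :=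
  ∀ ε : ℝ, 0 < ε → ∃ r : ℝ, 0 < r ∧ ∀ (t : ℝ) (a b : E₁), 0 < t → t ≤ r →
    interpNorm j μ (j a) ≤ r₀ → interpNorm j μ (j b) ≤ r₀ →
    t ^ (1 - μ) * ‖a‖ ≤ r → t ^ (1 - μ) * ‖b‖ ≤ r →
    t ^ (1 - μ) * ‖Φ a - Φ b‖ ≤ L * interpNorm j μ (j a) * (t ^ (1 - μ) * ‖a - b‖) +
      ε * (interpNorm j μ (j (a - b)) + t ^ (1 - μ) * ‖a - b‖)

theorem LowerOrder.smallPert {P : E₁ →L[ℝ] E₀} (hP : LowerOrder j μ P) (r₀ : ℝ) :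
    SmallPert j μ (fun a => -P a) r₀ 0 := by
  intro ε hε
  obtain ⟨r, hr, h⟩ := hP ε hε
  refine ⟨r, hr, fun t a b ht htr _ _ _ _ => ?_⟩
  have h1 := h t (a - b) ht htr
  rw [zero_mul, zero_mul, zero_add]
  have h2 : -P a - -P b = -(P (a - b)) := by rw [map_sub]; abel
  rw [h2, norm_neg]
  exact h1

/-- Comparison with 0: both terms of the estimate for Φ(v) - Φ(0) become small as t → 0, the first
because t^{1-μ}|v(t)| → 0, the second because ε is arbitrary while the E_μ-norm stays bounded. -/
theorem SmallPert.memBC {Φ : E₁ → E₀} {r₀ L : ℝ} (hr₀ : 0 < r₀)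
    (hL : 0 ≤ L) (hΦ : SmallPert j μ Φ r₀ L) (hΦ0 : Φ 0 = 0)
    (hΦc : ContinuousOn Φ {a | interpNorm j μ (j a) ≤ r₀}) (hT : 0 < T) (hv : MemBC μ T v)
    (hvr : ∀ t ∈ Ioc 0 T, interpNorm j μ (j (v t)) ≤ r₀) : MemBC μ T fun t => Φ (v t) := by
  refine MemBC.of_tendsto (hΦc.comp hv.1 hvr) ?_
  rw [Metric.tendsto_nhds]
  intro ε hε
  set ε' := ε / (2 * (L * r₀ + 2 * r₀ + 1)) with hε'
  have hden : 0 < L * r₀ + 2 * r₀ + 1 := by positivity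
  have hε'0 : 0 < ε' := by positivity
  obtain ⟨r, hr, h⟩ := hΦ ε' hε'0
  filter_upwards [Ioc_mem_nhdsGT hT, Ioc_mem_nhdsGT hr,
    hv.2.2.eventually (gt_mem_nhds hr), hv.2.2.eventually (gt_mem_nhds hε'0),
    hv.2.2.eventually (gt_mem_nhds hr₀)] with t ht htr h1 h2 h3
  have h4 := h t (v t) 0 ht.1 htr.2 (hvr t ht) (by rw [map_zero, interpNorm_zero]; exact hr₀.le)
    h1.le (by simpa using hr.le)
  rw [hΦ0, sub_zero, sub_zero] at h4
  have hp := Real.rpow_nonneg ht.1.le (1 - μ)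
  rw [Real.dist_eq, sub_zero, abs_of_nonneg (mul_nonneg hp (norm_nonneg _))]
  have h5 : L * interpNorm j μ (j (v t)) * (t ^ (1 - μ) * ‖v t‖) ≤ L * r₀ * ε' :=
    mul_le_mul (mul_le_mul_of_nonneg_left (hvr t ht) hL) h2.le (by positivity) (by positivity)
  have h6 : ε' * (interpNorm j μ (j (v t)) + t ^ (1 - μ) * ‖v t‖) ≤ ε' * (r₀ + r₀) :=
    mul_le_mul_of_nonneg_left (add_le_add (hvr t ht) h3.le) hε'0.le
  have h7 : ε' * (L * r₀ + 2 * r₀ + 1) = ε / 2 := by rw [hε']; field_simp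
  nlinarith

/-- Banach's fixed point theorem is applied to the right-hand side w = t^{1-μ}Φ(u) rather than to u:
w determines a solution of the linear problem, which determines a new w. The length h and radius δ
do not depend on x, and the bounds are linear in the size of x. -/
theorem exists_local_solution (hμ : μ ∈ Ioo (0 : ℝ) 1) {B : E₁ →L[ℝ] E₀} {C : ℝ} (hT : 0 < T)
    (hC : 0 < C) (hB : APriori j μ B T C) (hS : Solvable j μ B T) {Φ : E₁ → E₀} {r₀ L : ℝ}
    (hr₀ : 0 < r₀) (hL : 0 ≤ L) (hΦ : SmallPert j μ Φ r₀ L) (hΦ0 : Φ 0 = 0)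
    (hΦc : ContinuousOn Φ {a | interpNorm j μ (j a) ≤ r₀}) :
    ∃ h δ : ℝ, 0 < h ∧ h ≤ T ∧ 0 < δ ∧ ∀ x ∈ contInterp j μ, interpNorm j μ x ≤ δ →
      ∃ u u', Traj j μ h u u' x ∧ (∀ t ∈ Ioc 0 h, u' t + B (u t) = Φ (u t)) ∧
        ∀ t ∈ Ioc 0 h, t ^ (1 - μ) * ‖u t‖ ≤ 2 * C * interpNorm j μ x ∧
          interpNorm j μ (j (u t)) ≤ 2 * C * interpNorm j μ x := by
  obtain ⟨r, hr, hΦr⟩ := hΦ (1 / (8 * C)) (by positivity)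
  set h := min T r with hh
  have h0 : 0 < h := lt_min hT hr
  -- If the norms of a - b are at most CD, the quasilinear part contributes at most Lρ·CD ≤ D/4, and
  -- the part with ε = 1/(8C) another D/4. This is the contraction factor 1/2.
  set ρ := min (min r r₀) (1 / (4 * C * (L + 1))) with hρ
  have hρ0 : 0 < ρ := lt_min (lt_min hr hr₀) (by positivity)
  refine ⟨h, ρ / (2 * C), h0, min_le_left _ _, by positivity, fun x hx hxδ => ?_⟩
  set X := interpNorm j μ x with hX
  have hX0 : 0 ≤ X := interpNorm_nonneg j μ x
  have hXρ : 2 * C * X ≤ ρ := by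
    rw [le_div_iff₀ (by positivity)] at hxδ
    linarith
  have hsol : ∀ w : C(Icc 0 h, E₀), ∃ u u', Traj j μ h u u' x ∧
      ∀ t ∈ Ioc 0 h, u' t + B (u t) = toBC μ h0 w t := fun w =>
    hS h _ x h0 (min_le_left _ _) (memBC_toBC μ h0 w h) hx
  choose V V' hV hVB using hsol
  set s : Set C(Icc 0 h, E₀) := {w | ‖w‖ ≤ X ∧ w ⟨0, le_rfl, h0.le⟩ = 0} with hs
  have hweight : ∀ w : C(Icc 0 h, E₀), w ⟨0, le_rfl, h0.le⟩ = 0 → ∀ t ∈ Ioc 0 h,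
      t ^ (1 - μ) * ‖toBC μ h0 w t‖ ≤ ‖w‖ := fun w hw t ht => by
    rw [weight_toBC μ h0 w ht.1, hw, sub_zero]
    exact w.norm_coe_le_norm _
  have hVbd : ∀ w ∈ s, ∀ t ∈ Ioc 0 h, t ^ (1 - μ) * ‖V w t‖ ≤ 2 * C * X ∧
      interpNorm j μ (j (V w t)) ≤ 2 * C * X := fun w hw t ht => by
    have h1 := hB h (V w) (V' w) x X h0 (min_le_left _ _) (hV w) hx (fun t ht => by
      rw [hVB w t ht]; exact (hweight w hw.2 t ht).trans hw.1) t ht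
    rw [show C * (X + interpNorm j μ x) = 2 * C * X by rw [← hX]; ring] at h1
    exact h1
  have hρr : ρ ≤ r := (min_le_left _ _).trans (min_le_left _ _)
  have hρr₀ : ρ ≤ r₀ := (min_le_left _ _).trans (min_le_right _ _)
  have hmem : ∀ w ∈ s, MemBC μ h fun t => Φ (V w t) := fun w hw =>
    hΦ.memBC hr₀ hL hΦ0 hΦc h0 (hV w).memU fun t ht =>
      (hVbd w hw t ht).2.trans (hXρ.trans hρr₀)
  have hLρ : L * ρ ≤ 1 / (4 * C) := by
    have h1 : ρ * (4 * C * (L + 1)) ≤ 1 := (le_div_iff₀ (by positivity)).1 (min_le_right _ _)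
    rw [le_div_iff₀ (by positivity)]
    nlinarith [mul_pos hρ0 hC]
  have hlip : ∀ (t : ℝ) (a b : E₁) (D : ℝ), t ∈ Ioc 0 h → interpNorm j μ (j a) ≤ 2 * C * X →
      interpNorm j μ (j b) ≤ 2 * C * X → t ^ (1 - μ) * ‖a‖ ≤ 2 * C * X →
      t ^ (1 - μ) * ‖b‖ ≤ 2 * C * X → t ^ (1 - μ) * ‖a - b‖ ≤ C * D →
      interpNorm j μ (j (a - b)) ≤ C * D → t ^ (1 - μ) * ‖Φ a - Φ b‖ ≤ D / 2 := by
    intro t a b D ht h1 h2 h3 h4 h5 h6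
    have h7 := hΦr t a b ht.1 (ht.2.trans (min_le_right _ _)) (h1.trans (hXρ.trans hρr₀))
      (h2.trans (hXρ.trans hρr₀)) (h3.trans (hXρ.trans hρr)) (h4.trans (hXρ.trans hρr))
    have h8 : 0 ≤ t ^ (1 - μ) * ‖a - b‖ := mul_nonneg (Real.rpow_nonneg ht.1.le _) (norm_nonneg _)
    refine h7.trans ?_
    have h9 : L * interpNorm j μ (j a) * (t ^ (1 - μ) * ‖a - b‖) ≤ 1 / (4 * C) * (C * D) :=
      mul_le_mul ((mul_le_mul_of_nonneg_left (h1.trans hXρ) hL).trans hLρ) h5 h8 (by positivity)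
    have h10 : 1 / (8 * C) * (interpNorm j μ (j (a - b)) + t ^ (1 - μ) * ‖a - b‖) ≤
        1 / (8 * C) * (C * D + C * D) :=
      mul_le_mul_of_nonneg_left (add_le_add h6 h5) (by positivity)
    refine (add_le_add h9 h10).trans (le_of_eq ?_)
    field_simp
    ring
  classical
  -- The value 0 in the second branch is a default that never occurs on the set s.
  set Θ : C(Icc 0 h, E₀) → C(Icc 0 h, E₀) := fun w =>
    if hm : MemBC μ h (fun t => Φ (V w t)) then ofBC hμ.2 hm else 0 with hΘ
  have hΘs : ∀ w (hw : w ∈ s), Θ w = ofBC hμ.2 (hmem w hw) := fun w hw => dif_pos (hmem w hw)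
  have hmaps : MapsTo Θ s s := by
    intro w hw
    rw [hΘs w hw]
    refine ⟨norm_ofBC_le hμ.2 _ h0 fun t ht => ?_, ofBC_zero hμ.2 _ h0⟩
    have h1 := hlip t (V w t) 0 (2 * X) ht (hVbd w hw t ht).2
      (by rw [map_zero, interpNorm_zero]; positivity) (hVbd w hw t ht).1
      (by rw [norm_zero, mul_zero]; positivity)
      (by rw [sub_zero]; linarith [(hVbd w hw t ht).1])
      (by rw [sub_zero]; linarith [(hVbd w hw t ht).2])
    rw [hΦ0, sub_zero] at h1
    linarith
  have hcontr : ∀ w₁ ∈ s, ∀ w₂ ∈ s, ‖Θ w₁ - Θ w₂‖ ≤ ‖w₁ - w₂‖ / 2 := by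
    intro w₁ hw₁ w₂ hw₂
    have h1 : Θ w₁ - Θ w₂ = ofBC hμ.2 ((hmem w₁ hw₁).sub h0 (hmem w₂ hw₂)) := by
      rw [hΘs w₁ hw₁, hΘs w₂ hw₂]
      ext t
      change (t : ℝ) ^ (1 - μ) • Φ (V w₁ t) - (t : ℝ) ^ (1 - μ) • Φ (V w₂ t) =
        (t : ℝ) ^ (1 - μ) • (Φ (V w₁ t) - Φ (V w₂ t))
      rw [smul_sub]
    rw [h1]
    refine norm_ofBC_le hμ.2 _ h0 fun t ht => ?_
    have hd := (hV w₁).sub h0 (hV w₂)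
    rw [sub_self] at hd
    have h2 := hB h _ _ 0 ‖w₁ - w₂‖ h0 (min_le_left _ _) hd (contInterp j μ).zero_mem
      (fun t ht => by
        have h3 : V' w₁ t - V' w₂ t + B (V w₁ t - V w₂ t) = toBC μ h0 (w₁ - w₂) t := by
          have h4 : toBC μ h0 (w₁ - w₂) t = toBC μ h0 w₁ t - toBC μ h0 w₂ t :=
            map_sub (toBCCLM μ h0 t) w₁ w₂
          rw [h4, ← hVB w₁ t ht, ← hVB w₂ t ht, map_sub]
          abel
        rw [h3]
        refine hweight _ ?_ t ht
        rw [ContinuousMap.sub_apply, hw₁.2, hw₂.2, sub_zero]) t ht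
    rw [interpNorm_zero, add_zero] at h2
    exact hlip t _ _ _ ht (hVbd w₁ hw₁ t ht).2 (hVbd w₂ hw₂ t ht).2 (hVbd w₁ hw₁ t ht).1
      (hVbd w₂ hw₂ t ht).1 h2.1 h2.2
  have hsc : IsComplete s := by
    refine IsClosed.isComplete ?_
    have h1 : s = {w | ‖w‖ ≤ X} ∩ {w | w ⟨0, le_rfl, h0.le⟩ = 0} := rfl
    rw [h1]
    exact (isClosed_le continuous_norm continuous_const).inter
      (isClosed_eq (continuous_eval_const _) continuous_const)
  have hcw : ContractingWith (1 / 2) (hmaps.restrict Θ s s) := by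
    refine ⟨by norm_num, LipschitzWith.of_dist_le_mul fun w₁ w₂ => ?_⟩
    have h1 := hcontr w₁ w₁.2 w₂ w₂.2
    rw [Subtype.dist_eq, Subtype.dist_eq, dist_eq_norm, dist_eq_norm]
    simp only [MapsTo.val_restrict_apply]
    refine h1.trans (le_of_eq ?_)
    push_cast
    ring
  obtain ⟨w, hw, hfix, -⟩ := hcw.exists_fixedPoint' hsc hmaps (x := 0)
    ⟨by simpa using hX0, rfl⟩ (edist_ne_top _ _)
  refine ⟨V w, V' w, hV w, fun t ht => ?_, hVbd w hw⟩
  have h1 : Θ w = w := hfix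
  rw [hΘs w hw] at h1
  have h2 := toBC_ofBC hμ.2 (hmem w hw) h0 ht
  rw [h1] at h2
  rw [hVB w t ht, h2]

/-- No bounds on the two solutions are assumed. Their weighted norms tend to 0 at t = 0, so on a
short interval, depending on the pair, the trace estimate keeps both in the region where Φ is a
small perturbation. The difference then satisfies a self-improving bound with no inhomogeneity,
hence vanishes. -/
theorem exists_local_uniqueness (hμ : μ ∈ Ioo (0 : ℝ) 1) {B : E₁ →L[ℝ] E₀} {C : ℝ} (hT : 0 < T)
    (hC : 0 < C) (hB : APriori j μ B T C) {Φ : E₁ → E₀} {r₀ L : ℝ}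
    (hr₀ : 0 < r₀) (hL : 0 ≤ L) (hΦ : SmallPert j μ Φ r₀ L) :
    ∃ r₁ : ℝ, 0 < r₁ ∧ ∀ (R : ℝ) (u v : ℝ → E₁) (u' v' : ℝ → E₀) (x : E₀), 0 < R →
      x ∈ contInterp j μ → interpNorm j μ x ≤ r₁ → Traj j μ R u u' x → Traj j μ R v v' x →
      (∀ t ∈ Ioc 0 R, u' t + B (u t) = Φ (u t)) → (∀ t ∈ Ioc 0 R, v' t + B (v t) = Φ (v t)) →
      ∃ S ∈ Ioc 0 R, EqOn u v (Ioc 0 S) := by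
  obtain ⟨r, hr, hΦr⟩ := hΦ (1 / (8 * C)) (by positivity)
  -- The solutions are only controlled by 2r₁ in E_μ: one r₁ from the initial value, another from
  -- the weighted norms in the trace estimate.
  set r₁ := min (r₀ / 2) (1 / (8 * C * (L + 1))) with hr₁
  have hr₁0 : 0 < r₁ := lt_min (by positivity) (by positivity)
  refine ⟨r₁, hr₁0, fun R u v u' v' x hR hx hxr hu hv hue hve => ?_⟩
  have hμ0 := hμ.1
  set η := min r (r₁ / (1 + 1 / μ)) with hη
  have hη0 : 0 < η := lt_min hr (by positivity)
  have hev : ∀ᶠ t in 𝓝[>] (0 : ℝ), t ^ (1 - μ) * ‖u t‖ < η ∧ t ^ (1 - μ) * ‖v t‖ < η ∧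
      t ^ (1 - μ) * ‖u' t‖ < η ∧ t ^ (1 - μ) * ‖v' t‖ < η :=
    (hu.memU.2.2.eventually (gt_mem_nhds hη0)).and
      ((hv.memU.2.2.eventually (gt_mem_nhds hη0)).and
      ((hu.memDeriv.2.2.eventually (gt_mem_nhds hη0)).and
      (hv.memDeriv.2.2.eventually (gt_mem_nhds hη0))))
  obtain ⟨s, hs, hs'⟩ := (mem_nhdsGT_iff_exists_Ioo_subset).1 hev
  have hs : (0 : ℝ) < s := hs
  set S := min (min (s / 2) R) (min r T) with hSdef
  have hS0 : 0 < S := lt_min (lt_min (half_pos hs) hR) (lt_min hr hT)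
  have hSs : S ≤ s / 2 := (min_le_left _ _).trans (min_le_left _ _)
  have hSR : S ≤ R := (min_le_left _ _).trans (min_le_right _ _)
  have hSr : S ≤ r := (min_le_right _ _).trans (min_le_left _ _)
  have hST : S ≤ T := (min_le_right _ _).trans (min_le_right _ _)
  have hb : ∀ t ∈ Ioc 0 S, t ^ (1 - μ) * ‖u t‖ < η ∧ t ^ (1 - μ) * ‖v t‖ < η ∧
      t ^ (1 - μ) * ‖u' t‖ < η ∧ t ^ (1 - μ) * ‖v' t‖ < η := fun t ht =>
    hs' ⟨ht.1, by linarith [ht.2]⟩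
  have hηr₁ : (1 + 1 / μ) * η ≤ r₁ := by
    have h1 : η * (1 + 1 / μ) ≤ r₁ := (le_div_iff₀ (by positivity)).1 (min_le_right _ _)
    linarith
  have hun : ∀ t ∈ Ioc 0 S, interpNorm j μ (j (u t)) ≤ 2 * r₁ := fun t ht => by
    have := (hu.mono hSR).interpNorm_le hμ hx (M := η) (fun t ht => (hb t ht).1.le)
      (fun t ht => (hb t ht).2.2.1.le) ht
    linarith
  have hvn : ∀ t ∈ Ioc 0 S, interpNorm j μ (j (v t)) ≤ 2 * r₁ := fun t ht => by
    have := (hv.mono hSR).interpNorm_le hμ hx (M := η) (fun t ht => (hb t ht).2.1.le)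
      (fun t ht => (hb t ht).2.2.2.le) ht
    linarith
  have hr₁r₀ : 2 * r₁ ≤ r₀ := by linarith [min_le_left (r₀ / 2) (1 / (8 * C * (L + 1)))]
  have hLr : L * (2 * r₁) ≤ 1 / (4 * C) := by
    have h1 : r₁ * (8 * C * (L + 1)) ≤ 1 := (le_div_iff₀ (by positivity)).1 (min_le_right _ _)
    rw [le_div_iff₀ (by positivity)]
    nlinarith [mul_pos hr₁0 hC]
  have hd := (hu.mono hSR).sub hS0 (hv.mono hSR)
  rw [sub_self] at hd
  refine ⟨S, ⟨hS0, hSR⟩, ?_⟩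
  set q : ℝ → ℝ := fun t => max (t ^ (1 - μ) * ‖u t - v t‖) (interpNorm j μ (j (u t - v t))) with hq
  have key : ∀ t ∈ Ioc 0 S, q t ≤ 2 * 0 := by
    refine le_two_mul_of_self_improving (D₀ := max (η + η) (2 * r₁ + 2 * r₁))
      (fun t _ => (interpNorm_nonneg j μ _).trans (le_max_right _ _))
      (fun t ht => max_le_max ?_ ?_) fun D hD hqD t ht => ?_
    · refine le_trans ?_ (add_le_add (hb t ht).1.le (hb t ht).2.1.le)
      rw [← mul_add]
      exact mul_le_mul_of_nonneg_left (norm_sub_le _ _) (Real.rpow_nonneg ht.1.le _)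
    · rw [map_sub]
      exact (interpNorm_sub_le j μ (embed_mem j hμ _) (embed_mem j hμ _)).trans
        (add_le_add (hun t ht) (hvn t ht))
    · have h1 := hB S _ _ 0 (D / (2 * C)) hS0 hST hd (contInterp j μ).zero_mem (fun t ht => by
        have hR' : t ∈ Ioc 0 R := ⟨ht.1, ht.2.trans hSR⟩
        have h2 : u' t - v' t + B (u t - v t) = Φ (u t) - Φ (v t) := by
          rw [← hue t hR', ← hve t hR', map_sub]; abel
        have h3 := (le_max_left _ _).trans (hqD t ht)
        have h4 := (le_max_right _ _).trans (hqD t ht)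
        have hηr : η ≤ r := min_le_left _ _
        have h5 := hΦr t (u t) (v t) ht.1 (ht.2.trans hSr) ((hun t ht).trans hr₁r₀)
          ((hvn t ht).trans hr₁r₀) ((hb t ht).1.le.trans hηr) ((hb t ht).2.1.le.trans hηr)
        rw [h2]
        have h6 : L * interpNorm j μ (j (u t)) * (t ^ (1 - μ) * ‖u t - v t‖) ≤ 1 / (4 * C) * D :=
          mul_le_mul ((mul_le_mul_of_nonneg_left (hun t ht) hL).trans hLr) h3
            (mul_nonneg (Real.rpow_nonneg ht.1.le _) (norm_nonneg _)) (by positivity)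
        have h7 : 1 / (8 * C) * (interpNorm j μ (j (u t - v t)) + t ^ (1 - μ) * ‖u t - v t‖) ≤
            1 / (8 * C) * (D + D) :=
          mul_le_mul_of_nonneg_left (add_le_add h4 h3) (by positivity)
        refine h5.trans ((add_le_add h6 h7).trans (le_of_eq ?_))
        field_simp
        ring) t ht
      rw [interpNorm_zero, add_zero] at h1
      have h8 : C * (D / (2 * C)) = 0 + D / 2 := by field_simp; ring
      rw [h8] at h1
      exact max_le h1.1 h1.2
  intro t ht
  have h1 := (le_max_left _ _).trans (key t ht)
  have h2 := Real.rpow_pos_of_pos ht.1 (1 - μ)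
  have h3 : ‖u t - v t‖ ≤ 0 := by
    by_contra h4
    have := mul_pos h2 (not_le.1 h4)
    linarith
  exact sub_eq_zero.1 (norm_le_zero_iff.1 h3)

end Perturbation

section Nonlinearity

variable {E₀ E₁ : Type*} [NormedAddCommGroup E₀] [NormedSpace ℝ E₀]
  [NormedAddCommGroup E₁] [NormedSpace ℝ E₁]
variable {j : E₁ →L[ℝ] E₀} {μ β θ : ℝ} {V : Set E₀} {A : E₀ → E₁ →L[ℝ] E₀} {F₁ F₂ : E₀ → E₀}

/-! ### The quasilinear operator -/

/-- The map `u ↦ A(u) u - F₁(u) - F₂(u)` on `E₁`. -/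
def residual (j : E₁ →L[ℝ] E₀) (A : E₀ → E₁ →L[ℝ] E₀) (F₁ F₂ : E₀ → E₀) (u : E₁) : E₀ :=
  A (j u) u - F₁ (j u) - F₂ (j u)

theorem mem_equilibria_iff {u : E₁} :
    u ∈ equilibria j V A F₁ F₂ ↔ j u ∈ V ∧ residual j A F₁ F₂ u = 0 := by
  simp only [equilibria, residual, mem_ofPred_eq, sub_sub, sub_eq_zero]

theorem isOpen_incl_preimage (hμ : 0 < μ) (hθ : μ ≤ θ) (hV : IsOpenInInterp j μ V) :
    IsOpen (incl j θ ⁻¹' V) :=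
  hV.2.preimage (inclOfLE j hμ hθ).continuous

theorem isOpen_embed_preimage (hμ : μ ∈ Ioo (0 : ℝ) 1) (hV : IsOpenInInterp j μ V) :
    IsOpen (j ⁻¹' V) :=
  hV.2.preimage (embed j μ hμ).continuous

theorem continuousOn_residual (hμ : 0 < μ) (hθμ : μ ≤ θ) (hθ1 : θ < 1)
    (hC1 : HypC1 j θ V A F₁ F₂) : ContinuousOn (residual j A F₁ F₂) (j ⁻¹' V) := by
  have hθ : θ ∈ Ioo (0 : ℝ) 1 := ⟨hμ.trans_le hθμ, hθ1⟩
  have h : ContinuousOn (fun u : E₁ => (A (j u), F₁ (j u), F₂ (j u))) (j ⁻¹' V) :=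
    hC1.continuousOn.comp (embed j θ hθ).continuous.continuousOn fun u hu => hu
  exact ((h.fst.clm_apply continuousOn_id).sub h.snd.fst).sub h.snd.snd

/-- The product rule for A(u)u, composed with the embedding of E₁ in E_θ, produces exactly the terms
of the linearization. -/
theorem hasStrictFDerivAt_residual (hμ : 0 < μ) (hθμ : μ ≤ θ) (hθ : θ ∈ Ioo (0 : ℝ) 1)
    (hV : IsOpenInInterp j μ V) (hC1 : HypC1 j θ V A F₁ F₂) {w : E₁} (hw : j w ∈ V) :
    HasStrictFDerivAt (residual j A F₁ F₂) (linearization j θ hθ A F₁ F₂ w) w := by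
  have hat : ContDiffAt ℝ 1 (fun x : InterpSpace j θ =>
      (A (incl j θ x), F₁ (incl j θ x), F₂ (incl j θ x))) (embed j θ hθ w) :=
    hC1.contDiffAt ((isOpen_incl_preimage hμ hθμ hV).mem_nhds hw)
  have hA := (hat.fst.hasStrictFDerivAt one_ne_zero).comp w (embed j θ hθ).hasStrictFDerivAt
  have hF₁ := (hat.snd.fst.hasStrictFDerivAt one_ne_zero).comp w (embed j θ hθ).hasStrictFDerivAt
  have hF₂ := (hat.snd.snd.hasStrictFDerivAt one_ne_zero).comp w (embed j θ hθ).hasStrictFDerivAt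
  have h := ((hA.clm_apply (hasStrictFDerivAt_id w)).sub hF₁).sub hF₂
  refine h.congr_fderiv ?_
  ext v
  simp [linearization, incl_embed]

/-- An operator bounded on E_θ with θ < 1 gains the factor t^{1-θ}: the weight splits as
t^{1-θ}·t^{θ-μ}, and interpolation absorbs the second factor. -/
theorem lowerOrder_of_comp_embed (hμ : μ ∈ Ioo (0 : ℝ) 1) (hθμ : μ ≤ θ) (hθ : θ ∈ Ioo (0 : ℝ) 1)
    (Q : InterpSpace j θ →L[ℝ] E₀) : LowerOrder j μ (Q.comp (embed j θ hθ)) := by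
  intro ε hε
  have h1 := ((tendsto_rpow_nhdsGT_zero (sub_pos.2 hθ.2)).const_mul ‖Q‖)
  rw [mul_zero] at h1
  obtain ⟨s, hs, hs'⟩ := (mem_nhdsGT_iff_exists_Ioo_subset).1 (h1.eventually (gt_mem_nhds hε))
  have hs : (0 : ℝ) < s := hs
  refine ⟨s / 2, half_pos hs, fun t a ht hts => ?_⟩
  set D := interpNorm j μ (j a) + t ^ (1 - μ) * ‖a‖ with hD
  have hp := Real.rpow_nonneg ht.le (1 - μ)
  have h2 := interpNorm_interpolate j hμ hθμ hθ.2 ht (D := D) (u := a)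
    (le_add_of_nonneg_right (by positivity)) (le_add_of_nonneg_left (interpNorm_nonneg j μ _))
  have hD0 : 0 ≤ D := add_nonneg (interpNorm_nonneg j μ _) (by positivity)
  have h3 : ‖Q‖ * t ^ (1 - θ) < ε := hs' ⟨ht, by linarith⟩
  have h4 : ‖Q (embed j θ hθ a)‖ ≤ ‖Q‖ * interpNorm j θ (j a) := Q.le_opNorm _
  calc t ^ (1 - μ) * ‖Q (embed j θ hθ a)‖ ≤ t ^ (1 - μ) * (‖Q‖ * interpNorm j θ (j a)) :=
        mul_le_mul_of_nonneg_left h4 hp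
    _ = ‖Q‖ * t ^ (1 - θ) * (t ^ (θ - μ) * interpNorm j θ (j a)) := by
        rw [show (1 : ℝ) - μ = (1 - θ) + (θ - μ) by ring, Real.rpow_add ht]
        ring
    _ ≤ ‖Q‖ * t ^ (1 - θ) * D := mul_le_mul_of_nonneg_left h2
        (mul_nonneg (norm_nonneg _) (Real.rpow_nonneg ht.le _))
    _ ≤ ε * D := mul_le_mul_of_nonneg_right h3.le hD0

/-- Apart from its leading part A(w), the linearization consists of Fréchet derivatives, which are
bounded on E_θ. -/
theorem lowerOrder_linearization (hμ : μ ∈ Ioo (0 : ℝ) 1) (hθμ : μ ≤ θ) (hθ : θ ∈ Ioo (0 : ℝ) 1)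
    (w : E₁) : LowerOrder j μ (linearization j θ hθ A F₁ F₂ w - A (j w)) := by
  have h : linearization j θ hθ A F₁ F₂ w - A (j w) =
      (((fderiv ℝ (fun x => A (incl j θ x)) (embed j θ hθ w)).flip w)
        - (fderiv ℝ (fun x => F₁ (incl j θ x)) (embed j θ hθ w))
        - (fderiv ℝ (fun x => F₂ (incl j θ x)) (embed j θ hθ w))).comp (embed j θ hθ) := by
    ext v
    simp only [linearization, sub_apply, add_apply, ContinuousLinearMap.comp_apply]
    abel
  rw [h]
  exact lowerOrder_of_comp_embed hμ hθμ hθ _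

/-! ### Local Lipschitz estimates in the time-weighted norms -/

theorem exists_ball_subset (hV : IsOpenInInterp j μ V) {w : E₁} (hμ : μ ∈ Ioo (0 : ℝ) 1)
    (hw : j w ∈ V) :
    ∃ r : ℝ, 0 < r ∧ ∀ x ∈ contInterp j μ, interpNorm j μ (x - j w) ≤ r → x ∈ V := by
  obtain ⟨r, hr, h⟩ := Metric.isOpen_iff.1 hV.2 (embed j μ hμ w) hw
  refine ⟨r / 2, half_pos hr, fun x hx hxr => ?_⟩
  have h1 : toInterp j μ x hx ∈ Metric.ball (embed j μ hμ w) r := by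
    rw [Metric.mem_ball, dist_eq_norm, interpSpace_norm_def, map_sub, incl_toInterp, incl_embed]
    linarith
  exact h h1

theorem exists_lipschitz_of_hypH1 (hμ : μ ∈ Ioo (0 : ℝ) 1) (hV : IsOpenInInterp j μ V)
    (hH1 : HypH1 j μ V A F₁) {w : E₁} (hw : j w ∈ V) :
    ∃ r K : ℝ, 0 < r ∧ 0 ≤ K ∧ ∀ a b : E₁, interpNorm j μ (j a) ≤ r → interpNorm j μ (j b) ≤ r →
      ‖A (j (w + a)) - A (j (w + b))‖ ≤ K * interpNorm j μ (j (a - b)) ∧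
      ‖F₁ (j (w + a)) - F₁ (j (w + b))‖ ≤ K * interpNorm j μ (j (a - b)) := by
  obtain ⟨K, s, hs, hK⟩ := hH1.2 (x := embed j μ hμ w) hw
  rw [hV.2.nhdsWithin_eq (show embed j μ hμ w ∈ incl j μ ⁻¹' V from hw)] at hs
  obtain ⟨r, hr, h⟩ := Metric.mem_nhds_iff.1 hs
  refine ⟨r / 2, K, half_pos hr, K.2, fun a b ha hb => ?_⟩
  have hmem : ∀ a : E₁, interpNorm j μ (j a) ≤ r / 2 → embed j μ hμ (w + a) ∈ s := fun a ha => by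
    refine h ?_
    rw [Metric.mem_ball, dist_eq_norm, ← map_sub, add_sub_cancel_left, interpSpace_norm_def,
      incl_embed]
    linarith
  have h1 := hK.dist_le_mul _ (hmem a ha) _ (hmem b hb)
  rw [dist_eq_norm, dist_eq_norm, ← map_sub, add_sub_add_left_eq_sub, interpSpace_norm_def,
    incl_embed] at h1
  exact ⟨(norm_fst_le _).trans h1, (norm_snd_le _).trans h1⟩

/-- The weighted growth factors of the singular nonlinearity become small. -/
theorem exists_growth_small (hμ : μ ∈ Ioo (0 : ℝ) 1) (hβ : μ < β) (hβ1 : β < 1) (w : E₁)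
    {b ρ : ℝ} (hb : b ∈ Icc μ β) (hρ : 0 ≤ ρ)
    (hcrit : (ρ * (β - μ) + (b - μ)) / (1 - μ) ≤ 1) {R ε : ℝ} (hR : 0 < R) (hε : 0 < ε) :
    ∃ r : ℝ, 0 < r ∧ ∀ (t : ℝ) (a : E₁), 0 < t → t ≤ r → interpNorm j μ (j a) ≤ R →
      t ^ (1 - μ) * ‖a‖ ≤ r → t ^ (1 - b) * interpNorm j β (j (w + a)) ^ ρ ≤ ε := by
  have hb1 : 0 < 1 - b := by linarith [hb.2]
  have hβ' : β ∈ Ioo (0 : ℝ) 1 := ⟨hμ.1.trans hβ, hβ1⟩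
  -- For ρ = 0 smallness comes from t^{1-b} alone. For ρ > 0 it comes from the ρ-th power of
  -- t^{β-μ}|w + a|_{E_β}; the exponent of t that remains is nonnegative by the growth condition and
  -- may be 0 in the critical case.
  rcases hρ.eq_or_lt with rfl | hρ0
  · obtain ⟨s, hs, hs'⟩ := (mem_nhdsGT_iff_exists_Ioo_subset).1
      ((tendsto_rpow_nhdsGT_zero hb1).eventually (gt_mem_nhds hε))
    have hs : (0 : ℝ) < s := hs
    refine ⟨s / 2, half_pos hs, fun t a ht hts _ _ => ?_⟩
    rw [Real.rpow_zero, mul_one]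
    exact le_of_lt (hs' ⟨ht, by linarith⟩)
  · set η := ε ^ (1 / ρ) / 2 with hη
    have hη0 : 0 < η := half_pos (Real.rpow_pos_of_pos hε _)
    obtain ⟨r₁, hr₁, h₁⟩ := exists_interpNorm_small j hμ hβ hβ1 hR hη0
    have h2 := (tendsto_rpow_nhdsGT_zero (sub_pos.2 hβ)).mul_const (interpNorm j β (j w))
    rw [zero_mul] at h2
    obtain ⟨s, hs, hs'⟩ := (mem_nhdsGT_iff_exists_Ioo_subset).1 (h2.eventually (gt_mem_nhds hη0))
    have hs : (0 : ℝ) < s := hs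
    refine ⟨min (min r₁ (s / 2)) 1, lt_min (lt_min hr₁ (half_pos hs)) one_pos,
      fun t a ht htr ha hta => ?_⟩
    have hts : t < s := by
      have := htr.trans ((min_le_left _ _).trans (min_le_right _ _)); linarith
    have ht1 : t ≤ 1 := htr.trans (min_le_right _ _)
    have h3 := h₁ t a ht ha (hta.trans ((min_le_left _ _).trans (min_le_left _ _)))
    have h4 : t ^ (β - μ) * interpNorm j β (j w) < η := hs' ⟨ht, hts⟩
    have h5 : interpNorm j β (j (w + a)) ≤ interpNorm j β (j w) + interpNorm j β (j a) := by
      rw [map_add]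
      exact interpNorm_add_le j β (embed_mem j hβ' w) (embed_mem j hβ' a)
    have hp := Real.rpow_nonneg ht.le (β - μ)
    have h6 : t ^ (β - μ) * interpNorm j β (j (w + a)) ≤ ε ^ (1 / ρ) := by
      have := mul_le_mul_of_nonneg_left h5 hp
      have h7 : ε ^ (1 / ρ) = 2 * η := by rw [hη]; ring
      linarith
    have hn := interpNorm_nonneg j β (j (w + a))
    have hexp : 0 ≤ 1 - b - ρ * (β - μ) := by
      rw [div_le_one (by linarith [hμ.2])] at hcrit
      linarith
    calc t ^ (1 - b) * interpNorm j β (j (w + a)) ^ ρ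
        = t ^ (1 - b - ρ * (β - μ)) * (t ^ (β - μ) * interpNorm j β (j (w + a))) ^ ρ := by
          rw [Real.mul_rpow hp hn, ← Real.rpow_mul ht.le, ← mul_assoc, ← Real.rpow_add ht]
          congr 2
          ring
      _ ≤ 1 * (ε ^ (1 / ρ)) ^ ρ := by
          refine mul_le_mul (Real.rpow_le_one ht.le ht1 hexp)
            (Real.rpow_le_rpow (mul_nonneg hp hn) h6 hρ) (Real.rpow_nonneg (mul_nonneg hp hn) _)
            zero_le_one
      _ = ε := by rw [one_mul, ← Real.rpow_mul hε.le, one_div_mul_cancel hρ0.ne', Real.rpow_one]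

/-- Each summand of (H2) carries the weight t^{1-μ} = t^{1-b}·t^{b-μ}. The first factor makes the
growth terms small, the second turns the E_b-norm of a - b into the interpolated norms. -/
theorem exists_lipschitz_of_hypH2 (hμ : μ ∈ Ioo (0 : ℝ) 1) (hβ : μ < β) (hβ1 : β < 1)
    (hV : IsOpenInInterp j μ V) (hH2 : HypH2 j μ β V F₂) {w : E₁} (hw : j w ∈ V) :
    ∃ R : ℝ, 0 < R ∧ ∀ ε : ℝ, 0 < ε → ∃ r : ℝ, 0 < r ∧ ∀ (t : ℝ) (a b : E₁), 0 < t → t ≤ r →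
      interpNorm j μ (j a) ≤ R → interpNorm j μ (j b) ≤ R →
      t ^ (1 - μ) * ‖a‖ ≤ r → t ^ (1 - μ) * ‖b‖ ≤ r →
      t ^ (1 - μ) * ‖F₂ (j (w + a)) - F₂ (j (w + b))‖ ≤
        ε * (interpNorm j μ (j (a - b)) + t ^ (1 - μ) * ‖a - b‖) := by
  obtain ⟨m, e, ρ, he, hF⟩ := hH2
  have hβ' : β ∈ Ioo (0 : ℝ) 1 := ⟨hμ.1.trans hβ, hβ1⟩
  obtain ⟨R, hR, hRV⟩ := exists_ball_subset hV hμ hw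
  obtain ⟨C, hC, hFC⟩ := hF (j w) hw R hR
  refine ⟨R, hR, fun ε hε => ?_⟩
  -- Three growth factors in each of m summands, all multiplied by C; m + 1 keeps the denominator
  -- positive when there are no summands.
  set ε' := ε / (3 * C * (m + 1)) with hε'
  have hε'0 : 0 < ε' := by positivity
  have h1 : ∀ i, ∃ r : ℝ, 0 < r ∧ (∀ (t : ℝ) (a : E₁), 0 < t → t ≤ r → interpNorm j μ (j a) ≤ R →
      t ^ (1 - μ) * ‖a‖ ≤ r → t ^ (1 - e i) * interpNorm j β (j (w + a)) ^ ρ i ≤ ε') ∧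
      ∀ t : ℝ, 0 < t → t ≤ r → t ^ (1 - e i) ≤ ε' := by
    intro i
    obtain ⟨hi1, hi2, hi3⟩ := he i
    obtain ⟨r₁, hr₁, h₁⟩ := exists_growth_small (j := j) hμ hβ hβ1 w hi1 hi2 hi3 hR hε'0
    have hb1 : 0 < 1 - e i := by linarith [hi1.2]
    obtain ⟨s, hs, hs'⟩ := (mem_nhdsGT_iff_exists_Ioo_subset).1
      ((tendsto_rpow_nhdsGT_zero hb1).eventually (gt_mem_nhds hε'0))
    have hs : (0 : ℝ) < s := hs
    refine ⟨min r₁ (s / 2), lt_min hr₁ (half_pos hs), fun t a ht htr ha hta =>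
      h₁ t a ht (htr.trans (min_le_left _ _)) ha (hta.trans (min_le_left _ _)), fun t ht htr => ?_⟩
    have := htr.trans (min_le_right _ _)
    exact le_of_lt (hs' ⟨ht, by linarith⟩)
  choose r hr hr1 hr2 using h1
  -- A common radius for all indices, obtained from a filter so that an empty index set needs no
  -- separate case.
  obtain ⟨r', hr'⟩ := (eventually_all.2 fun i => Ioc_mem_nhdsGT (hr i) :
    ∀ᶠ x in 𝓝[>] (0 : ℝ), ∀ i, x ∈ Ioc 0 (r i)).and self_mem_nhdsWithin |>.exists
  have hr'0 : 0 < r' := hr'.2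
  refine ⟨r', hr'0, fun t a b ht htr ha hb hta htb => ?_⟩
  have hmem : ∀ a : E₁, interpNorm j μ (j a) ≤ R → j (w + a) ∈ V ∩ contInterp j β := fun a ha =>
    ⟨hRV _ (embed_mem j hμ _) (by rwa [map_add, add_sub_cancel_left]), embed_mem j hβ' _⟩
  have h3 := hFC _ (hmem a ha) _ (hmem b hb) (by rwa [map_add, add_sub_cancel_left])
    (by rwa [map_add, add_sub_cancel_left])
  rw [← map_sub, add_sub_add_left_eq_sub] at h3
  set D := interpNorm j μ (j (a - b)) + t ^ (1 - μ) * ‖a - b‖ with hD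
  have hp := Real.rpow_nonneg ht.le (1 - μ)
  have hD0 : 0 ≤ D := add_nonneg (interpNorm_nonneg j μ _) (by positivity)
  have hterm : ∀ i, t ^ (1 - μ) * ((1 + interpNorm j β (j (w + a)) ^ ρ i +
      interpNorm j β (j (w + b)) ^ ρ i) * interpNorm j (e i) (j (a - b))) ≤ 3 * ε' * D := by
    intro i
    obtain ⟨hi1, hi2, hi3⟩ := he i
    have hri := (hr'.1 i).2
    have h4 := hr1 i t a ht (htr.trans hri) ha (hta.trans hri)
    have h5 := hr1 i t b ht (htr.trans hri) hb (htb.trans hri)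
    have h6 := hr2 i t ht (htr.trans hri)
    have h7 := interpNorm_interpolate j hμ hi1.1 (hi1.2.trans_lt hβ1) ht (D := D) (u := a - b)
      (le_add_of_nonneg_right (by positivity)) (le_add_of_nonneg_left (interpNorm_nonneg j μ _))
    have h8 : 0 ≤ t ^ (e i - μ) * interpNorm j (e i) (j (a - b)) :=
      mul_nonneg (Real.rpow_nonneg ht.le _) (interpNorm_nonneg j _ _)
    calc _ = (t ^ (1 - e i) + t ^ (1 - e i) * interpNorm j β (j (w + a)) ^ ρ i +
          t ^ (1 - e i) * interpNorm j β (j (w + b)) ^ ρ i) *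
          (t ^ (e i - μ) * interpNorm j (e i) (j (a - b))) := by
            rw [show (1 : ℝ) - μ = (1 - e i) + (e i - μ) by ring, Real.rpow_add ht]
            ring
      _ ≤ (ε' + ε' + ε') * D := mul_le_mul (by linarith) h7 h8 (by positivity)
      _ = 3 * ε' * D := by ring
  calc t ^ (1 - μ) * ‖F₂ (j (w + a)) - F₂ (j (w + b))‖ ≤ t ^ (1 - μ) * _ :=
        mul_le_mul_of_nonneg_left h3 hp
    _ = C * ∑ i, t ^ (1 - μ) * ((1 + interpNorm j β (j (w + a)) ^ ρ i +
      interpNorm j β (j (w + b)) ^ ρ i) * interpNorm j (e i) (j (a - b))) := by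
        rw [Finset.mul_sum, Finset.mul_sum, Finset.mul_sum]
        refine Finset.sum_congr rfl fun i _ => ?_
        ring
    _ ≤ C * ∑ _i : Fin m, 3 * ε' * D :=
        mul_le_mul_of_nonneg_left (Finset.sum_le_sum fun i _ => hterm i) hC.le
    _ = (3 * C * m * ε') * D := by
        rw [Finset.sum_const, Finset.card_univ, Fintype.card_fin, nsmul_eq_mul]
        ring
    _ ≤ ε * D := by
        refine mul_le_mul_of_nonneg_right ?_ hD0
        rw [hε', mul_div_assoc', div_le_iff₀ (by positivity)]
        have : 3 * C * m * ε + 3 * C * ε = ε * (3 * C * (m + 1)) := by ring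
        nlinarith [mul_pos hC hε]

/-- The quasilinear problem near an equilibrium is a small perturbation of the linear problem
for `A(w)`. -/
theorem exists_smallPert (hμ : μ ∈ Ioo (0 : ℝ) 1) (hβ : μ < β) (hβ1 : β < 1)
    (hV : IsOpenInInterp j μ V) (hH1 : HypH1 j μ V A F₁) (hH2 : HypH2 j μ β V F₂) {w : E₁}
    (hw : j w ∈ V) :
    ∃ r₀ L : ℝ, 0 < r₀ ∧ 0 ≤ L ∧
      (∀ x ∈ contInterp j μ, interpNorm j μ (x - j w) ≤ r₀ → x ∈ V) ∧
      SmallPert j μ (fun a => A (j w) a - residual j A F₁ F₂ (w + a)) r₀ L := by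
  obtain ⟨rV, hrV, hVr⟩ := exists_ball_subset hV hμ hw
  obtain ⟨r₁, K, hr₁, hK, h₁⟩ := exists_lipschitz_of_hypH1 hμ hV hH1 hw
  obtain ⟨r₂, hr₂, h₂⟩ := exists_lipschitz_of_hypH2 hμ hβ hβ1 hV hH2 hw
  refine ⟨min rV (min r₁ r₂), K, lt_min hrV (lt_min hr₁ hr₂), hK,
    fun x hx hxr => hVr x hx (hxr.trans (min_le_left _ _)), fun ε hε => ?_⟩
  obtain ⟨r₃, hr₃, h₃⟩ := h₂ (ε / 2) (half_pos hε)
  set η := ε / (2 * (K + 1)) / 2 with hη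
  have hη0 : 0 < η := by positivity
  have h4 := (tendsto_rpow_nhdsGT_zero (sub_pos.2 hμ.2)).mul_const (‖w‖ + 1)
  rw [zero_mul] at h4
  obtain ⟨s, hs, hs'⟩ := (mem_nhdsGT_iff_exists_Ioo_subset).1 (h4.eventually (gt_mem_nhds hη0))
  have hs : (0 : ℝ) < s := hs
  refine ⟨min (min r₃ (s / 2)) η, lt_min (lt_min hr₃ (half_pos hs)) hη0,
    fun t a b ht htr ha hb hta htb => ?_⟩
  have ht₃ : ∀ {z : ℝ}, z ≤ min (min r₃ (s / 2)) η → z ≤ r₃ := fun hz =>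
    hz.trans ((min_le_left _ _).trans (min_le_left _ _))
  have hts : t < s := by
    have := htr.trans ((min_le_left _ _).trans (min_le_right _ _)); linarith
  have ha₁ := ha.trans ((min_le_right _ _).trans (min_le_left _ _))
  have hb₁ := hb.trans ((min_le_right _ _).trans (min_le_left _ _))
  have ha₂ := ha.trans ((min_le_right _ _).trans (min_le_right _ _))
  have hb₂ := hb.trans ((min_le_right _ _).trans (min_le_right _ _))
  have h5 := h₃ t a b ht (ht₃ htr) ha₂ hb₂ (ht₃ hta) (ht₃ htb)
  have h6 := h₁ a b ha₁ hb₁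
  have h7 := (h₁ 0 a (by rw [map_zero, interpNorm_zero]; exact hr₁.le) ha₁).1
  rw [add_zero, zero_sub, map_neg, interpNorm_neg j μ (embed_mem j hμ a)] at h7
  have h8 : t ^ (1 - μ) * (‖w‖ + 1) < η := hs' ⟨ht, hts⟩
  have h9 := htb.trans (min_le_right _ _)
  set Y := interpNorm j μ (j (a - b)) with hY
  have hY0 : 0 ≤ Y := interpNorm_nonneg j μ _
  have hp := Real.rpow_nonneg ht.le (1 - μ)
  -- The first term is of top order in a - b, with a coefficient small in the E_μ-norm of a. In the
  -- second, A is only differenced in E_μ and the factor |w + b|_{E₁} becomes small under the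
  -- weight.
  have hdecomp : (A (j w) a - residual j A F₁ F₂ (w + a)) -
      (A (j w) b - residual j A F₁ F₂ (w + b)) =
      ((A (j w) - A (j (w + a))) (a - b) - (A (j (w + a)) - A (j (w + b))) (w + b)) +
        (F₁ (j (w + a)) - F₁ (j (w + b))) + (F₂ (j (w + a)) - F₂ (j (w + b))) := by
    simp only [residual, sub_apply, map_sub, map_add]
    abel
  have hn : ‖(A (j w) a - residual j A F₁ F₂ (w + a)) -
      (A (j w) b - residual j A F₁ F₂ (w + b))‖ ≤
      (K * interpNorm j μ (j a) * ‖a - b‖ + K * Y * (‖w‖ + ‖b‖)) + K * Y +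
        ‖F₂ (j (w + a)) - F₂ (j (w + b))‖ := by
    rw [hdecomp]
    refine (norm_add_le _ _).trans (add_le_add ((norm_add_le _ _).trans (add_le_add
      ((norm_sub_le _ _).trans (add_le_add ?_ ?_)) h6.2)) le_rfl)
    · exact (ContinuousLinearMap.le_opNorm _ _).trans
        (mul_le_mul_of_nonneg_right h7 (norm_nonneg _))
    · exact (ContinuousLinearMap.le_opNorm _ _).trans
        (mul_le_mul h6.1 (norm_add_le _ _) (norm_nonneg _) (mul_nonneg hK hY0))
  have hfin : K * Y * (t ^ (1 - μ) * (‖w‖ + 1) + t ^ (1 - μ) * ‖b‖) ≤ ε / 2 * Y := by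
    have h10 : t ^ (1 - μ) * (‖w‖ + 1) + t ^ (1 - μ) * ‖b‖ ≤ ε / (2 * (K + 1)) := by
      have : η + η = ε / (2 * (K + 1)) := by rw [hη]; ring
      linarith
    calc _ ≤ K * Y * (ε / (2 * (K + 1))) := mul_le_mul_of_nonneg_left h10 (mul_nonneg hK hY0)
      _ = (K / (K + 1)) * (ε / 2 * Y) := by field_simp
      _ ≤ 1 * (ε / 2 * Y) := by
          refine mul_le_mul_of_nonneg_right ?_ (by positivity)
          rw [div_le_one (by linarith)]
          linarith
      _ = _ := one_mul _
  have hZ : 0 ≤ t ^ (1 - μ) * ‖a - b‖ := mul_nonneg hp (norm_nonneg _)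
  calc t ^ (1 - μ) * ‖(A (j w) a - residual j A F₁ F₂ (w + a)) -
      (A (j w) b - residual j A F₁ F₂ (w + b))‖
      ≤ t ^ (1 - μ) * ((K * interpNorm j μ (j a) * ‖a - b‖ + K * Y * (‖w‖ + ‖b‖)) + K * Y +
        ‖F₂ (j (w + a)) - F₂ (j (w + b))‖) := mul_le_mul_of_nonneg_left hn hp
    _ = K * interpNorm j μ (j a) * (t ^ (1 - μ) * ‖a - b‖) +
        K * Y * (t ^ (1 - μ) * (‖w‖ + 1) + t ^ (1 - μ) * ‖b‖) +
        t ^ (1 - μ) * ‖F₂ (j (w + a)) - F₂ (j (w + b))‖ := by ring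
    _ ≤ K * interpNorm j μ (j a) * (t ^ (1 - μ) * ‖a - b‖) + ε / 2 * Y +
        ε / 2 * (Y + t ^ (1 - μ) * ‖a - b‖) := by linarith
    _ ≤ _ := by nlinarith

end Nonlinearity

section Autonomous

variable {E₀ E₁ : Type*} [NormedAddCommGroup E₀] [NormedSpace ℝ E₀] [CompleteSpace E₀]
  [NormedAddCommGroup E₁] [NormedSpace ℝ E₁] [CompleteSpace E₁]
variable {j : E₁ →L[ℝ] E₀} {μ T S : ℝ} {N : E₁ → E₀} {D : Set E₁} {u v : ℝ → E₁} {x y : E₀}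

/-! ### Autonomous equations -/

/-- `u ∈ 𝔼_{1,μ}([0,T])` solves `u' + N(u) = 0`, `u(0) = x`, with values in `D`. -/
def SolN (j : E₁ →L[ℝ] E₀) (μ : ℝ) (N : E₁ → E₀) (D : Set E₁) (T : ℝ) (u : ℝ → E₁) (x : E₀) :
    Prop :=
  Traj j μ T u (fun t => -N (u t)) x ∧ ∀ t ∈ Ioc 0 T, u t ∈ D

theorem SolN.mono (h : SolN j μ N D T u x) (hS : S ≤ T) : SolN j μ N D S u x :=
  ⟨h.1.mono hS, fun t ht => h.2 t ⟨ht.1, ht.2.trans hS⟩⟩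

theorem SolN.congr (hT : 0 < T) (h : SolN j μ N D T u x) (hv : EqOn v u (Ioc 0 T)) :
    SolN j μ N D T v x :=
  ⟨h.1.congr hT hv fun t ht => by simp only [hv ht], fun t ht => by rw [hv ht]; exact h.2 t ht⟩

theorem SolN.shift (hμ : μ < 1) (h : SolN j μ N D T u x) {a : ℝ} (ha : 0 < a) (haT : a < T) :
    SolN j μ N D (T - a) (fun t => u (a + t)) (j (u a)) :=
  ⟨h.1.shift hμ ha haT, fun t ht => h.2 _ ⟨by linarith [ht.1], by linarith [ht.2]⟩⟩

theorem isSolution_iff_solN {V : Set E₀} {A : E₀ → E₁ →L[ℝ] E₀} {F₁ F₂ : E₀ → E₀} (hT : 0 < T) :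
    IsSolution j μ V A F₁ F₂ x T u ↔ SolN j μ (residual j A F₁ F₂) (j ⁻¹' V) T u x := by
  constructor
  · rintro ⟨h0, u', h1, h2⟩
    refine ⟨(traj_of_memMaxRegSpace h0 h1).congr hT (fun t _ => rfl) fun t ht => ?_,
      fun t ht => (h2 t ht).1⟩
    have h3 := (h2 t ht).2
    simp only [residual]
    rw [eq_sub_of_add_eq h3]
    abel
  · rintro ⟨h1, h2⟩
    refine ⟨h1.init, _, h1.memMaxRegSpace hT, fun t ht => ⟨h2 t ht, ?_⟩⟩
    simp only [residual]
    abel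

/-- Two solutions that agree on an overlap can be glued. -/
theorem SolN.extend (hu : SolN j μ N D T u x) {a : ℝ} (ha : 0 < a) (haT : a < T) (hv : SolN j μ N D S v y)
    (heq : ∀ t ∈ Ioc 0 (T - a), u (a + t) = v t) :
    ∃ w, SolN j μ N D (a + S) w x ∧ EqOn w u (Ioc 0 T) ∧ ∀ t ∈ Ioc 0 S, w (a + t) = v t := by
  have hT : 0 < T := ha.trans haT
  -- The two formulas agree on all of (a,T], so every time has a neighbourhood, relative to (0,a+S],
  -- in which a single formula holds; no matching of derivatives at T is needed.
  set w : ℝ → E₁ := fun t => if t ≤ T then u t else v (t - a) with hw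
  have hwu : EqOn w u (Ioc 0 T) := fun t ht => if_pos ht.2
  have hwv : EqOn w (fun t => v (t - a)) (Ioc a (a + S)) := by
    intro t ht
    by_cases h : t ≤ T
    · simp only [hw, if_pos h]
      rw [← heq (t - a) ⟨sub_pos.2 ht.1, by linarith⟩, add_sub_cancel]
    · simp only [hw, if_neg h]
  have hmaps : MapsTo (fun t => t - a) (Ioc a (a + S)) (Ioc 0 S) := fun t ht =>
    ⟨sub_pos.2 ht.1, by linarith [ht.2]⟩
  have hmemu : ∀ t ∈ Ioc 0 (a + S), t < T → Ioc 0 T ∈ 𝓝[Ioc 0 (a + S)] t := fun t ht h =>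
    mem_nhdsWithin_of_mem_nhds (Ioc_mem_nhds ht.1 h)
  have hmemv : ∀ t ∈ Ioc 0 (a + S), T ≤ t → Ioc a (a + S) ∈ 𝓝[Ioc 0 (a + S)] t := fun t ht h => by
    filter_upwards [self_mem_nhdsWithin,
      mem_nhdsWithin_of_mem_nhds (Ioi_mem_nhds (haT.trans_le h))] with s h1 h2
    exact ⟨h2, h1.2⟩
  have hcont : ∀ (g : E₁ → E₀), ContinuousOn (fun t => g (u t)) (Ioc 0 T) →
      ContinuousOn (fun t => g (v t)) (Ioc 0 S) →
      ContinuousOn (fun t => g (w t)) (Ioc 0 (a + S)) := by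
    intro g h1 h2 t ht
    rcases lt_or_ge t T with h | h
    · have h3 : t ∈ Ioc 0 T := ⟨ht.1, h.le⟩
      exact ((h1 t h3).congr (fun s hs => by rw [hwu hs]) (by rw [hwu h3])).mono_of_mem_nhdsWithin
        (hmemu t ht h)
    · have h3 : t ∈ Ioc a (a + S) := ⟨haT.trans_le h, ht.2⟩
      have h4 : ContinuousOn (fun t => g (v (t - a))) (Ioc a (a + S)) :=
        h2.comp (by fun_prop) hmaps
      exact ((h4 t h3).congr (fun s hs => by rw [hwv hs]) (by rw [hwv h3])).mono_of_mem_nhdsWithin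
        (hmemv t ht h)
  have hcontw : ContinuousOn w (Ioc 0 (a + S)) := by
    intro t ht
    rcases lt_or_ge t T with h | h
    · have h3 : t ∈ Ioc 0 T := ⟨ht.1, h.le⟩
      exact ((hu.1.memU.1 t h3).congr hwu (hwu h3)).mono_of_mem_nhdsWithin (hmemu t ht h)
    · have h3 : t ∈ Ioc a (a + S) := ⟨haT.trans_le h, ht.2⟩
      have h4 : ContinuousOn (fun t => v (t - a)) (Ioc a (a + S)) :=
        hv.1.memU.1.comp (by fun_prop) hmaps
      exact ((h4 t h3).congr hwv (hwv h3)).mono_of_mem_nhdsWithin (hmemv t ht h)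
  have h0 : ∀ᶠ t in 𝓝[>] (0 : ℝ), w t = u t := by
    filter_upwards [Ioc_mem_nhdsGT hT] with t ht using hwu ht
  refine ⟨w, ⟨⟨?_, ?_, ?_, ?_⟩, ?_⟩, hwu, fun t ht => ?_⟩
  · refine Tendsto.congr' ?_ hu.1.init
    filter_upwards [h0] with t ht
    rw [ht]
  · refine MemBC.of_tendsto hcontw (hu.1.memU.2.2.congr' ?_)
    filter_upwards [h0] with t ht
    rw [ht]
  · refine MemBC.of_tendsto (hcont (fun z => -N z) hu.1.memDeriv.1 hv.1.memDeriv.1)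
      (hu.1.memDeriv.2.2.congr' ?_)
    filter_upwards [h0] with t ht
    rw [ht]
  · intro t ht
    rcases lt_or_ge t T with h | h
    · have h3 : t ∈ Ioc 0 T := ⟨ht.1, h.le⟩
      rw [hwu h3]
      exact ((hu.1.deriv t h3).congr (fun s hs => by rw [hwu hs])
        (by rw [hwu h3])).mono_of_mem_nhdsWithin (hmemu t ht h)
    · have h3 : t ∈ Ioc a (a + S) := ⟨haT.trans_le h, ht.2⟩
      have h4 := HasDerivWithinAt.scomp t (hv.1.deriv (t - a) (hmaps h3))
        (((hasDerivAt_id t).sub_const a).hasDerivWithinAt (s := Ioc a (a + S))) hmaps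
      rw [one_smul] at h4
      rw [hwv h3]
      exact (h4.congr (fun s hs => by rw [hwv hs]; rfl)
        (by rw [hwv h3]; rfl)).mono_of_mem_nhdsWithin (hmemv t ht h)
  · intro t ht
    rcases lt_or_ge t T with h | h
    · rw [hwu ⟨ht.1, h.le⟩]
      exact hu.2 t ⟨ht.1, h.le⟩
    · rw [hwv ⟨haT.trans_le h, ht.2⟩]
      exact hv.2 _ (hmaps ⟨haT.trans_le h, ht.2⟩)
  · have h3 : a + t ∈ Ioc a (a + S) := ⟨by linarith [ht.1], by linarith [ht.2]⟩
    rw [hwv h3]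
    simp only [add_sub_cancel_left]

/-- Local uniqueness along a solution implies uniqueness. -/
theorem SolN.eqOn_of_local (hμ : μ < 1) {G : Set E₀}
    (hloc : ∀ (R : ℝ) (u v : ℝ → E₁) (x : E₀), 0 < R → x ∈ G → SolN j μ N D R u x →
      SolN j μ N D R v x → ∃ S ∈ Ioc 0 R, EqOn u v (Ioc 0 S))
    (hu : SolN j μ N D T u x) (hv : SolN j μ N D T v x) (hx : x ∈ G)
    (hG : ∀ t ∈ Ioc 0 T, j (u t) ∈ G) : EqOn u v (Ioc 0 T) := by
  by_contra hne
  set B : Set ℝ := {t | t ∈ Ioc 0 T ∧ u t ≠ v t} with hB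
  have hBne : B.Nonempty := by
    simp only [EqOn, not_forall] at hne
    obtain ⟨t, ht, h⟩ := hne
    exact ⟨t, ht, h⟩
  have hBb : BddBelow B := ⟨0, fun t ht => ht.1.1.le⟩
  -- At the first time of disagreement the solutions still coincide, by continuity or by the common
  -- initial value; local uniqueness from there contradicts the choice of τ.
  set τ := sInf B with hτ
  have hτ0 : 0 ≤ τ := le_csInf hBne fun t ht => ht.1.1.le
  have hτT : τ ≤ T := by
    obtain ⟨t, ht⟩ := hBne
    exact (csInf_le hBb ht).trans ht.1.2
  have hlt : ∀ t ∈ Ioc 0 T, t < τ → u t = v t := fun t ht h => by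
    by_contra hn
    exact absurd (csInf_le hBb ⟨ht, hn⟩) (not_le.2 h)
  rcases hτ0.eq_or_lt with h0 | h0
  · obtain ⟨t, ht⟩ := hBne
    obtain ⟨S, hS, hEq⟩ := hloc T u v x (ht.1.1.trans_le ht.1.2) hx hu hv
    have : S ≤ τ := le_csInf ⟨t, ht⟩ fun s hs => by
      by_contra hn
      exact hs.2 (hEq ⟨hs.1.1, (not_le.1 hn).le⟩)
    linarith [hS.1]
  · have hτmem : τ ∈ Ioc 0 T := ⟨h0, hτT⟩
    have hsub : Ioo 0 τ ⊆ Ioc 0 T := fun t ht => ⟨ht.1, ht.2.le.trans hτT⟩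
    have huv : u τ = v τ := by
      have h1 := ((hu.1.memU.1 τ hτmem).mono hsub).tendsto
      have h2 := ((hv.1.memU.1 τ hτmem).mono hsub).tendsto
      rw [nhdsWithin_Ioo_eq_nhdsLT h0] at h1 h2
      refine tendsto_nhds_unique (h1.congr' ?_) h2
      filter_upwards [Ioo_mem_nhdsLT h0] with t ht
      exact hlt t (hsub ht) ht.2
    rcases hτT.eq_or_lt with h1 | h1
    · obtain ⟨t, ht⟩ := hBne
      have h2 : t = τ := le_antisymm (ht.1.2.trans h1.ge) (csInf_le hBb ht)
      exact ht.2 (by rw [h2]; exact huv)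
    · have hsv := hv.shift hμ h0 h1
      rw [← huv] at hsv
      obtain ⟨S, hS, hEq⟩ := hloc (T - τ) _ _ (j (u τ)) (sub_pos.2 h1) (hG τ hτmem)
        (hu.shift hμ h0 h1) hsv
      have : τ + S ≤ τ := le_csInf hBne fun s hs => by
        by_contra hn
        have h3 : τ < s := lt_of_le_of_ne (csInf_le hBb hs) fun h => hs.2 (by rw [← h]; exact huv)
        have h4 := hEq (x := s - τ) ⟨sub_pos.2 h3, by linarith [not_le.1 hn]⟩
        simp only [add_sub_cancel] at h4
        exact hs.2 h4
      linarith [hS.1]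

/-- Solutions on arbitrarily long intervals form a global solution. -/
theorem SolN.exists_global (hex : ∀ R : ℝ, ∃ T u, R ≤ T ∧ SolN j μ N D T u x)
    (huniq : ∀ (T : ℝ) (u v : ℝ → E₁), 0 < T → SolN j μ N D T u x → SolN j μ N D T v x →
      EqOn u v (Ioc 0 T)) : ∃ u, ∀ T, 0 < T → SolN j μ N D T u x := by
  choose τ U hτ hU using fun n : ℕ => hex n
  -- The value at t is read off from a solution that lives at least up to ⌈t⌉; uniqueness identifies
  -- it on (0,T] with the single solution chosen for ⌈T⌉.
  refine ⟨fun t => U ⌈t⌉₊ t, fun T hT => ?_⟩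
  have h1 : T ≤ τ ⌈T⌉₊ := (Nat.le_ceil T).trans (hτ _)
  refine ((hU ⌈T⌉₊).mono h1).congr hT fun t ht => ?_
  have h2 : t ≤ τ ⌈t⌉₊ := (Nat.le_ceil t).trans (hτ _)
  exact huniq t _ _ ht.1 ((hU _).mono h2) ((hU _).mono (ht.2.trans h1)) ⟨ht.1, le_rfl⟩

/-- `u` is a global solution of the homogeneous linear equation `u' + B u = 0`, `u(0) = x`. -/
def HomSol (j : E₁ →L[ℝ] E₀) (μ : ℝ) (B : E₁ →L[ℝ] E₀) (u : ℝ → E₁) (x : E₀) : Prop :=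
  ∀ T, 0 < T → Traj j μ T u (fun t => -B (u t)) x

/-- The local theorem is applied with Φ = -P. By linearity, rescaling removes the smallness
condition on the data, so every initial value admits a solution of the same length h, and these are
glued. -/
theorem exists_homSol (hμ : μ ∈ Ioo (0 : ℝ) 1) {B P : E₁ →L[ℝ] E₀} {C : ℝ} (hT : 0 < T)
    (hC : 0 < C) (hB : APriori j μ B T C) (hS : Solvable j μ B T) (hP : LowerOrder j μ P)
    (hx : x ∈ contInterp j μ) : ∃ u, HomSol j μ (B + P) u x := by
  obtain ⟨h, δ, hh, -, hδ, hloc⟩ := exists_local_solution hμ hT hC hB hS one_pos le_rfl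
    (hP.smallPert 1) (by simp) (by fun_prop)
  obtain ⟨T', hT', -, hBP⟩ := hB.add_lowerOrder hT hC hP
  set Q : E₁ →L[ℝ] E₀ := B + P with hQ
  have hstep : ∀ y ∈ contInterp j μ, ∃ u, SolN j μ Q univ h u y := by
    intro y hy
    have hy0 := interpNorm_nonneg j μ y
    -- Scaling into the δ-ball; the 1 avoids division by zero.
    set c := δ / (interpNorm j μ y + 1) with hc
    have hc0 : 0 < c := by positivity
    obtain ⟨u, u', hu, hue, -⟩ := hloc (c • y) ((contInterp j μ).smul_mem c hy) (by
      rw [interpNorm_smul j μ c hy, abs_of_pos hc0, hc, div_mul_eq_mul_div, div_le_iff₀ (by linarith)]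
      nlinarith)
    have h1 := hu.const_smul hh c⁻¹
    rw [inv_smul_smul₀ hc0.ne'] at h1
    refine ⟨_, h1.congr hh (fun t _ => rfl) fun t ht => ?_, fun t _ => mem_univ _⟩
    have h2 := hue t ht
    rw [map_smul, eq_sub_of_add_eq h2, hQ, add_apply, ← smul_neg]
    congr 1
    abel
  have huniq : ∀ (y : E₀) (T : ℝ) (u v : ℝ → E₁), 0 < T → SolN j μ Q univ T u y →
      SolN j μ Q univ T v y → EqOn u v (Ioc 0 T) := by
    intro y R u v hR hu hv
    obtain ⟨C', -, h'⟩ := hBP.exists_long hμ hT' (by positivity) R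
    exact h'.eqOn hR le_rfl hu.1 hv.1 fun t _ => by rw [neg_add_cancel, neg_add_cancel]
  have hex : ∀ n : ℕ, ∃ u, SolN j μ Q univ (h + n * (h / 2)) u x := by
    intro n
    induction n with
    | zero => simpa using hstep x hx
    | succ n ih =>
      obtain ⟨u, hu⟩ := ih
      have hn : (0 : ℝ) ≤ n * (h / 2) := by positivity
      have ha : 0 < h / 2 + n * (h / 2) := by positivity
      have haT : h / 2 + n * (h / 2) < h + n * (h / 2) := by linarith
      obtain ⟨v, hv⟩ := hstep _ (embed_mem j hμ (u (h / 2 + n * (h / 2))))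
      have hsh := hu.shift hμ.2 ha haT
      have hd : h + n * (h / 2) - (h / 2 + n * (h / 2)) = h / 2 := by ring
      obtain ⟨w, hw, -⟩ := hu.extend ha haT (S := h) hv
        (huniq _ _ _ _ (by linarith) hsh (hv.mono (by linarith)))
      refine ⟨w, ?_⟩
      have he : h / 2 + n * (h / 2) + h = h + (n + 1 : ℕ) * (h / 2) := by push_cast; ring
      rwa [he] at hw
  obtain ⟨u, hu⟩ := SolN.exists_global (N := Q) (D := univ) (x := x)
    (fun R => by
      obtain ⟨n, hn⟩ := exists_nat_ge (R / (h / 2))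
      obtain ⟨u, hu⟩ := hex n
      refine ⟨_, u, ?_, hu⟩
      rw [div_le_iff₀ (by positivity)] at hn
      linarith) (huniq x)
  exact ⟨u, fun T hT => (hu T hT).1⟩

end Autonomous

section CenterProjection

variable {E₀ E₁ : Type*} [NormedAddCommGroup E₀] [NormedSpace ℝ E₀] [CompleteSpace E₀]
  [NormedAddCommGroup E₁] [NormedSpace ℝ E₁] [CompleteSpace E₁]
variable {j B : E₁ →L[ℝ] E₀}

/-! ### The projection onto the kernel -/

/-- `Pr : E₀ → E₁` is the projection onto `N(B)` along `R(B)`, with values regarded in `E₁`. -/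
structure IsCenterProj (j B : E₁ →L[ℝ] E₀) (Pr : E₀ →L[ℝ] E₁) : Prop where
  map_proj : ∀ f, B (Pr f) = 0
  proj_map : ∀ v, Pr (B v) = 0
  proj_ker : ∀ k, B k = 0 → Pr (j k) = k
  exists_eq : ∀ f, ∃ v, B v + j (Pr f) = f

/-- The map (v,k) ↦ Bv + jk from E₁ × N(B) is onto E₀, and k is determined by its image because the
sum is direct and j is injective. Uniqueness makes f ↦ k linear, and the open mapping theorem makes
it bounded into E₁, without closedness of R(B) as an assumption. -/
theorem exists_isCenterProj (hj : Function.Injective j)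
    (h : IsCompl ((LinearMap.ker B.toLinearMap).map j.toLinearMap)
      (LinearMap.range B.toLinearMap)) : ∃ Pr, IsCenterProj j B Pr := by
  set K := LinearMap.ker B.toLinearMap with hK
  have hKc : IsClosed (K : Set E₁) := B.isClosed_ker
  have : CompleteSpace K := hKc.completeSpace_coe
  have huniq : ∀ (v v' k k' : E₁), B k = 0 → B k' = 0 → B v + j k = B v' + j k' → k = k' := by
    intro v v' k k' hk hk' he
    have h1 : j (k - k') ∈ K.map j.toLinearMap :=
      ⟨k - k', by rw [SetLike.mem_coe, hK, LinearMap.mem_ker]; simp [hk, hk'], rfl⟩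
    have h2 : j (k - k') ∈ LinearMap.range B.toLinearMap := by
      refine ⟨v' - v, ?_⟩
      simp only [ContinuousLinearMap.coe_coe, map_sub]
      rw [sub_eq_sub_iff_add_eq_add, add_comm (j k), he, add_comm]
    have h3 := (Submodule.disjoint_def.1 h.disjoint) _ h1 h2
    rw [← map_zero j] at h3
    exact sub_eq_zero.1 (hj h3)
  let Λ : E₁ × K →L[ℝ] E₀ :=
    B.comp (ContinuousLinearMap.fst ℝ _ _) + (j.comp K.subtypeL).comp (ContinuousLinearMap.snd ℝ _ _)
  have hΛ : ∀ p : E₁ × K, Λ p = B p.1 + j p.2 := fun p => rfl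
  have hsurj : Function.Surjective Λ := by
    intro f
    have h1 : f ∈ K.map j.toLinearMap ⊔ LinearMap.range B.toLinearMap := by
      rw [h.sup_eq_top]; trivial
    obtain ⟨a, ⟨k, hk, rfl⟩, b, ⟨v, rfl⟩, hab⟩ := Submodule.mem_sup.1 h1
    exact ⟨(v, ⟨k, hk⟩), by rw [hΛ, add_comm]; exact hab⟩
  obtain ⟨C, -, hC⟩ := ContinuousLinearMap.exists_preimage_norm_le (σ' := RingHom.id ℝ) Λ hsurj
  choose p hp hpn using hC
  have hker : ∀ k : K, B k = 0 := fun k => k.2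
  refine ⟨LinearMap.mkContinuous
    { toFun := fun f => ((p f).2 : E₁)
      map_add' := fun f g => by
        refine huniq (p (f + g)).1 ((p f).1 + (p g).1) _ _ (hker _) ?_ ?_
        · rw [map_add, hker, hker, add_zero]
        · rw [← hΛ, hp, map_add, map_add, add_add_add_comm, ← hΛ, ← hΛ, hp, hp]
      map_smul' := fun c f => by
        refine huniq (p (c • f)).1 (c • (p f).1) _ _ (hker _) ?_ ?_
        · rw [RingHom.id_apply, map_smul, hker, smul_zero]
        · rw [← hΛ, hp, RingHom.id_apply, map_smul, map_smul, ← smul_add, ← hΛ, hp] }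
    C fun f => (norm_snd_le (p f)).trans (hpn f), ?_, ?_, ?_, ?_⟩
  · exact fun f => hker _
  · intro v
    refine huniq (p (B v)).1 v _ _ (hker _) (map_zero B) ?_
    exact ((hΛ _).symm.trans (hp _)).trans (by rw [map_zero, add_zero])
  · intro k hk
    refine huniq (p (j k)).1 0 _ _ (hker _) hk ?_
    exact ((hΛ _).symm.trans (hp _)).trans (by rw [map_zero, zero_add])
  · exact fun f => ⟨(p f).1, hp f⟩

theorem IsCenterProj.idem {Pr : E₀ →L[ℝ] E₁} (h : IsCenterProj j B Pr) (f : E₀) :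
    Pr (j (Pr f)) = Pr f :=
  h.proj_ker _ (h.map_proj f)

theorem exists_bound_of_bijective {E F : Type*} [NormedAddCommGroup E] [NormedSpace ℝ E]
    [CompleteSpace E] [NormedAddCommGroup F] [NormedSpace ℝ F] [CompleteSpace F] (R : E →L[ℝ] F)
    (h : Function.Bijective R) : ∃ C, 0 < C ∧ ∀ p, ‖p‖ ≤ C * ‖R p‖ := by
  obtain ⟨C, hC0, hC⟩ := ContinuousLinearMap.exists_preimage_norm_le (σ' := RingHom.id ℝ) R h.2
  refine ⟨C, hC0, fun p => ?_⟩
  obtain ⟨p', h1, h2⟩ := hC (R p)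
  rwa [h.1 h1] at h2

/-- B + j Pr j is a bijection from E₁ to E₀, hence boundedly invertible, and it coincides with B
where the center component vanishes. -/
theorem IsCenterProj.exists_bound {Pr : E₀ →L[ℝ] E₁} (h : IsCenterProj j B Pr) :
    ∃ C, 0 < C ∧ ∀ v, Pr (j v) = 0 → ‖v‖ ≤ C * ‖B v‖ := by
  have hb : Function.Bijective (B + j.comp (Pr.comp j)) := by
    constructor
    · refine (injective_iff_map_eq_zero _).2 fun y hy => ?_
      have hy' : B y + j (Pr (j y)) = 0 := hy
      have h1 : Pr (j y) = 0 := by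
        have := congrArg Pr hy'
        rwa [map_add, h.proj_map, zero_add, h.idem, map_zero] at this
      rw [h1, map_zero, add_zero] at hy'
      rw [← h.proj_ker y hy', h1]
    · intro f
      obtain ⟨v, hv⟩ := h.exists_eq f
      refine ⟨v - Pr (j v) + Pr f, ?_⟩
      change B (v - Pr (j v) + Pr f) + j (Pr (j (v - Pr (j v) + Pr f))) = f
      rw [map_add, map_sub, h.map_proj, h.map_proj, sub_zero, add_zero, map_add, map_sub, map_add,
        map_sub, h.idem, h.idem, sub_self, zero_add]
      exact hv
  obtain ⟨C, hC0, hC⟩ := exists_bound_of_bijective _ hb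
  refine ⟨C, hC0, fun v hv => ?_⟩
  have := hC v
  rwa [show (B + j.comp (Pr.comp j)) v = B v by
    rw [add_apply, ContinuousLinearMap.comp_apply, ContinuousLinearMap.comp_apply, hv, map_zero,
      add_zero]] at this

/-- Equilibria near `w` are a graph over the kernel of the linearization. -/
theorem exists_equilibria_graph {Pr : E₀ →L[ℝ] E₁} (h : IsCenterProj j B Pr) {w : E₁} {Q : Set E₁}
    {m : ℕ} {U : Set (EuclideanSpace ℝ (Fin m))} {Ψ : EuclideanSpace ℝ (Fin m) → E₁}
    (hU : IsOpen U) (h0 : 0 ∈ U) (hΨ : ContDiffOn ℝ 1 Ψ U) (hΨ0 : Ψ 0 = w)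
    (hrank : Module.finrank ℝ (LinearMap.range (fderiv ℝ Ψ 0).toLinearMap) = m)
    (hQ : Ψ '' U ⊆ Q)
    (hker : LinearMap.range (fderiv ℝ Ψ 0).toLinearMap = LinearMap.ker B.toLinearMap) :
    ∃ ρ C : ℝ, 0 < ρ ∧ 0 < C ∧ ∀ k, B k = 0 → ‖k‖ ≤ ρ →
      ∃ e ∈ Q, Pr (j (e - w)) = k ∧ ‖e - w‖ ≤ C * ‖k‖ := by
  set K := LinearMap.ker B.toLinearMap with hK
  have hKc : IsClosed (K : Set E₁) := B.isClosed_ker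
  have : CompleteSpace K := hKc.completeSpace_coe
  have hstrict : HasStrictFDerivAt Ψ (fderiv ℝ Ψ 0) 0 :=
    (hΨ.contDiffAt (hU.mem_nhds h0)).hasStrictFDerivAt one_ne_zero
  set Ψ' := fderiv ℝ Ψ 0 with hΨ'
  let PK : E₁ →L[ℝ] K := (Pr.comp j).codRestrict K fun v => h.map_proj _
  have hPK : ∀ v, (PK v : E₁) = Pr (j v) := fun v => rfl
  have hPKk : ∀ k : K, PK k = k := fun k => Subtype.ext (h.proj_ker k k.2)
  have hΨK : ∀ ξ, Ψ' ξ ∈ K := fun ξ => by rw [← hker]; exact ⟨ξ, rfl⟩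
  let G : EuclideanSpace ℝ (Fin m) →L[ℝ] K := PK.comp Ψ'
  have hG : ∀ ξ, (G ξ : E₁) = Ψ' ξ := fun ξ => congrArg Subtype.val (hPKk ⟨Ψ' ξ, hΨK ξ⟩)
  have hinj : LinearMap.ker Ψ'.toLinearMap = ⊥ := by
    have h1 := LinearMap.finrank_range_add_finrank_ker Ψ'.toLinearMap
    rw [hrank, finrank_euclideanSpace_fin] at h1
    exact Submodule.finrank_eq_zero.1 (by omega)
  have hGinj : LinearMap.ker G.toLinearMap = ⊥ := by
    refine (Submodule.eq_bot_iff _).2 fun ξ hξ => ?_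
    have h1 : (G ξ : E₁) = 0 := congrArg Subtype.val (LinearMap.mem_ker.1 hξ)
    rw [hG] at h1
    have h2 : ξ ∈ LinearMap.ker Ψ'.toLinearMap := h1
    rwa [hinj, Submodule.mem_bot] at h2
  have hGsurj : LinearMap.range G.toLinearMap = ⊤ := by
    refine LinearMap.range_eq_top.2 fun k => ?_
    have h1 : (k : E₁) ∈ LinearMap.range Ψ'.toLinearMap := by rw [hker]; exact k.2
    obtain ⟨ξ, hξ⟩ := h1
    exact ⟨ξ, Subtype.ext ((hG ξ).trans hξ)⟩
  let Ge := ContinuousLinearEquiv.ofBijective G hGinj hGsurj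
  -- The derivative of g at 0 is Ψ'(0) viewed as an isomorphism onto the kernel, since the
  -- projection is the identity there. The inverse function theorem parametrises the equilibria by
  -- their center component, and differentiability gives the linear bound on e - w.
  let g : EuclideanSpace ℝ (Fin m) → K := fun ξ => PK (Ψ ξ - w)
  have hg : HasStrictFDerivAt g (Ge : EuclideanSpace ℝ (Fin m) →L[ℝ] K) 0 :=
    PK.hasStrictFDerivAt.comp 0 (hstrict.sub_const w)
  have hg0 : g 0 = 0 := by simp only [g, hΨ0, sub_self, map_zero]
  have hinv := hg.to_localInverse
  have hright := hg.eventually_right_inverse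
  have hcont := hg.localInverse_tendsto
  have hat : hg.localInverse g Ge 0 (g 0) = 0 := hg.localInverse_apply_image
  have hΨi : HasFDerivAt (fun k => Ψ (hg.localInverse g Ge 0 k)) _ (g 0) :=
    HasFDerivAt.comp (g 0) (by rw [hat]; exact hstrict.hasFDerivAt) hinv.hasFDerivAt
  have hO := hΨi.isBigO_sub
  rw [hg0] at hright hO hat hcont
  obtain ⟨C, hC0, hC⟩ := hO.exists_pos
  have hev : ∀ᶠ k : K in 𝓝 0, hg.localInverse g Ge 0 k ∈ U ∧
      g (hg.localInverse g Ge 0 k) = k ∧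
      ‖Ψ (hg.localInverse g Ge 0 k) - Ψ (hg.localInverse g Ge 0 0)‖ ≤ C * ‖k - 0‖ :=
    (hcont.eventually (hU.mem_nhds h0)).and (hright.and hC.bound)
  obtain ⟨ρ, hρ, hball⟩ := Metric.eventually_nhds_iff.1 hev
  refine ⟨ρ / 2, C, half_pos hρ, hC0, fun k hk hkρ => ?_⟩
  obtain ⟨h1, h2, h3⟩ := hball (y := ⟨k, hk⟩) (by
    rw [dist_zero_right]
    change ‖k‖ < ρ
    linarith)
  rw [hat, hΨ0, sub_zero] at h3
  exact ⟨_, hQ ⟨_, h1, rfl⟩, congrArg Subtype.val h2, h3⟩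

end CenterProjection

section Resolvent

variable {E₀ E₁ : Type*} [NormedAddCommGroup E₀] [NormedSpace ℝ E₀] [CompleteSpace E₀]
  [NormedAddCommGroup E₁] [NormedSpace ℝ E₁] [CompleteSpace E₁]
variable {j B : E₁ →L[ℝ] E₀} {μ T C : ℝ}

/-! ### Resolvent estimates -/

/-- The operator `λ + B`, `λ = a + i b`, on the complexification. -/
noncomputable def resolventMap (j B : E₁ →L[ℝ] E₀) (a b : ℝ) : E₁ × E₁ →L[ℝ] E₀ × E₀ :=
  ((a • j + B).comp (ContinuousLinearMap.fst ℝ E₁ E₁) -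
    b • j.comp (ContinuousLinearMap.snd ℝ E₁ E₁)).prod
  ((a • j + B).comp (ContinuousLinearMap.snd ℝ E₁ E₁) +
    b • j.comp (ContinuousLinearMap.fst ℝ E₁ E₁))

theorem resolventMap_apply (a b : ℝ) (p : E₁ × E₁) :
    resolventMap j B a b p =
      (a • j p.1 + B p.1 - b • j p.2, a • j p.2 + B p.2 + b • j p.1) := rfl

/-- The sign matters: z - (-B) is z + B. -/
theorem bijective_resolventMap {a b : ℝ} (h : (⟨a, b⟩ : ℂ) ∉ complexSpectrum j (-B)) :
    Function.Bijective (resolventMap j B a b) := by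
  have h' := not_not.1 h
  convert h' using 2 with p
  rw [resolventMap_apply]
  refine Prod.ext ?_ ?_
  · simp only [neg_apply]; abel
  · simp only [neg_apply]; abel

/-- Multiplication by the conjugate of λ recovers |λ|²(x + iy) from λ(x + iy). The factor 2 is the
cost of the maximum norms. -/
theorem norm_embed_pair_le {a b : ℝ} (x y : E₀) :
    max |a| |b| * max ‖x‖ ‖y‖ ≤ 2 * max ‖a • x - b • y‖ ‖a • y + b • x‖ := by
  set r := a • x - b • y with hr
  set s := a • y + b • x with hs
  set m := max |a| |b| with hm
  set N := max ‖r‖ ‖s‖ with hN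
  have hm0 : 0 ≤ m := (abs_nonneg a).trans (le_max_left _ _)
  have hN0 : 0 ≤ N := (norm_nonneg r).trans (le_max_left _ _)
  have hx : (a ^ 2 + b ^ 2) • x = a • r + b • s := by rw [hr, hs]; module
  have hy : (a ^ 2 + b ^ 2) • y = a • s - b • r := by rw [hr, hs]; module
  have hab : m ^ 2 ≤ a ^ 2 + b ^ 2 := by
    rcases max_choice |a| |b| with h | h <;> rw [hm, h, sq_abs] <;> nlinarith [sq_nonneg a, sq_nonneg b]
  have hmr : ∀ c : ℝ, |c| ≤ m → ∀ z : E₀, ‖z‖ ≤ N → ‖c • z‖ ≤ m * N := fun c hc z hz => by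
    rw [norm_smul, Real.norm_eq_abs]
    exact mul_le_mul hc hz (norm_nonneg _) hm0
  have ha := le_max_left |a| |b|
  have hb := le_max_right |a| |b|
  have hrN := le_max_left ‖r‖ ‖s‖
  have hsN := le_max_right ‖r‖ ‖s‖
  have key : ∀ z : E₀, ‖(a ^ 2 + b ^ 2) • z‖ ≤ 2 * (m * N) → m * ‖z‖ ≤ 2 * N := by
    intro z hz
    rw [norm_smul, Real.norm_of_nonneg (by positivity)] at hz
    rcases hm0.eq_or_lt with h0 | h0
    · rw [← h0, zero_mul]; positivity
    · have h1 : m ^ 2 * ‖z‖ ≤ 2 * (m * N) :=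
        (mul_le_mul_of_nonneg_right hab (norm_nonneg z)).trans hz
      refine le_of_mul_le_mul_left ?_ h0
      linarith
  have kx := key x (by
    rw [hx]
    have h1 := hmr a ha r hrN
    have h2 := hmr b hb s hsN
    linarith [norm_add_le (a • r) (b • s)])
  have ky := key y (by
    rw [hy]
    have h1 := hmr a ha s hsN
    have h2 := hmr b hb r hrN
    linarith [norm_sub_le (a • s) (b • r)])
  rcases max_choice ‖x‖ ‖y‖ with h | h <;> rw [h] <;> assumption

theorem max_mul_norm_le_resolventMap (a b : ℝ) (p : E₁ × E₁) :
    max |a| |b| * max ‖j p.1‖ ‖j p.2‖ ≤ 2 * (‖resolventMap j B a b p‖ + ‖B‖ * ‖p‖) := by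
  refine (norm_embed_pair_le (a := a) (b := b) _ _).trans ?_
  gcongr
  have h1 : ‖a • j p.1 + B p.1 - b • j p.2‖ ≤ ‖resolventMap j B a b p‖ := by
    rw [resolventMap_apply]; exact norm_fst_le (_, _)
  have h2 : ‖a • j p.2 + B p.2 + b • j p.1‖ ≤ ‖resolventMap j B a b p‖ := by
    rw [resolventMap_apply]; exact norm_snd_le (_, _)
  have h3 : ‖B p.1‖ ≤ ‖B‖ * ‖p‖ := B.le_opNorm_of_le (norm_fst_le p)
  have h4 : ‖B p.2‖ ≤ ‖B‖ * ‖p‖ := B.le_opNorm_of_le (norm_snd_le p)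
  refine max_le ?_ ?_
  · have : a • j p.1 - b • j p.2 = (a • j p.1 + B p.1 - b • j p.2) - B p.1 := by abel
    rw [this]
    linarith [norm_sub_le (a • j p.1 + B p.1 - b • j p.2) (B p.1)]
  · have : a • j p.2 + b • j p.1 = (a • j p.2 + B p.2 + b • j p.1) - B p.2 := by abel
    rw [this]
    linarith [norm_sub_le (a • j p.2 + B p.2 + b • j p.1) (B p.2)]

/-! ### Exponential functions e^{λt} in real form -/

theorem hasDerivAt_exp_mul_cos (a b t : ℝ) :
    HasDerivAt (fun t => Real.exp (a * t) * Real.cos (b * t))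
      (a * (Real.exp (a * t) * Real.cos (b * t)) - b * (Real.exp (a * t) * Real.sin (b * t))) t := by
  have h1 := ((hasDerivAt_id' t).const_mul a).exp
  have h2 := ((hasDerivAt_id' t).const_mul b).cos
  exact (h1.mul h2).congr_deriv (by ring)

theorem hasDerivAt_exp_mul_sin (a b t : ℝ) :
    HasDerivAt (fun t => Real.exp (a * t) * Real.sin (b * t))
      (a * (Real.exp (a * t) * Real.sin (b * t)) + b * (Real.exp (a * t) * Real.cos (b * t))) t := by
  have h1 := ((hasDerivAt_id' t).const_mul a).exp
  have h2 := ((hasDerivAt_id' t).const_mul b).sin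
  exact (h1.mul h2).congr_deriv (by ring)

theorem norm_smul_add_smul_le {E : Type*} [NormedAddCommGroup E] [NormedSpace ℝ E] {c d K N : ℝ}
    (hK : 0 ≤ K) (hc : |c| ≤ K) (hd : |d| ≤ K) {x y : E} (hx : ‖x‖ ≤ N) (hy : ‖y‖ ≤ N) :
    ‖c • x + d • y‖ ≤ 2 * (K * N) := by
  have h1 : ‖c • x‖ ≤ K * N := by
    rw [norm_smul]; exact mul_le_mul hc hx (norm_nonneg _) hK
  have h2 : ‖d • y‖ ≤ K * N := by
    rw [norm_smul]; exact mul_le_mul hd hy (norm_nonneg _) hK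
  linarith [norm_add_le (c • x) (d • y)]

theorem abs_exp_mul_cos_le (x y : ℝ) : |Real.exp x * Real.cos y| ≤ Real.exp x := by
  rw [abs_mul, Real.abs_exp]
  exact mul_le_of_le_one_right (Real.exp_pos _).le (Real.abs_cos_le_one _)

theorem abs_exp_mul_sin_le (x y : ℝ) : |Real.exp x * Real.sin y| ≤ Real.exp x := by
  rw [abs_mul, Real.abs_exp]
  exact mul_le_of_le_one_right (Real.exp_pos _).le (Real.abs_sin_le_one _)

/-- The a priori estimate, applied to the exponentials `e^{λ t} p`. -/
theorem APriori.exp_le (hμ : μ ∈ Ioo (0 : ℝ) 1) (hT : 0 < T) (hC : 0 < C) (h : APriori j μ B T C)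
    {a : ℝ} (ha : 0 ≤ a) (b : ℝ) (p : E₁ × E₁) :
    T ^ (1 - μ) * ‖p‖ ≤ 2 * (C * (T ^ (1 - μ) * (2 * ‖resolventMap j B a b p‖) +
      Real.exp (-(a * T)) * ((1 + ‖j‖) * ‖p‖))) := by
  obtain ⟨p₁, p₂⟩ := p
  set q := resolventMap j B a b (p₁, p₂) with hq
  set p : E₁ × E₁ := (p₁, p₂) with hp
  have hq1 : q.1 = a • j p₁ + B p₁ - b • j p₂ := rfl
  have hq2 : q.2 = a • j p₂ + B p₂ + b • j p₁ := rfl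
  have hTp : 0 < T ^ (1 - μ) := Real.rpow_pos_of_pos hT _
  -- c + is = e^{λt}. The two trajectories below are the real and imaginary parts of e^{λt}p, which
  -- solves the linear problem with right-hand side e^{λt}q and initial value p.
  set c : ℝ → ℝ := fun t => Real.exp (a * t) * Real.cos (b * t) with hc
  set s : ℝ → ℝ := fun t => Real.exp (a * t) * Real.sin (b * t) with hs
  have hcc : Continuous c := by fun_prop
  have hsc : Continuous s := by fun_prop
  have hdc := hasDerivAt_exp_mul_cos a b
  have hds := hasDerivAt_exp_mul_sin a b
  have hbd : ∀ t ∈ Ioc 0 T, Real.exp (a * t) ≤ Real.exp (a * T) := fun t ht =>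
    Real.exp_le_exp.2 (mul_le_mul_of_nonneg_left ht.2 ha)
  have hpow : ∀ t ∈ Ioc 0 T, t ^ (1 - μ) ≤ T ^ (1 - μ) := fun t ht =>
    Real.rpow_le_rpow ht.1.le ht.2 (by linarith [hμ.2])
  have main : ∀ (u : ℝ → E₁) (u' : ℝ → E₀) (y : E₁), Continuous u → Continuous u' →
      (∀ t, HasDerivAt (fun r => j (u r)) (u' t) t) → u 0 = y → ‖y‖ ≤ ‖p‖ →
      (∀ t ∈ Ioc 0 T, ‖u' t + B (u t)‖ ≤ 2 * (Real.exp (a * T) * ‖q‖)) →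
      T ^ (1 - μ) * ‖u T‖ ≤ C * (T ^ (1 - μ) * (2 * (Real.exp (a * T) * ‖q‖)) +
        (1 + ‖j‖) * ‖p‖) := by
    intro u u' y hu hu' hd h0 hy hf
    have htr : Traj j μ T u u' (j y) := h0 ▸ Traj.of_continuousOn hμ.2 hT hu.continuousOn
      hu'.continuousOn fun t _ => (hd t).hasDerivWithinAt
    refine (h T u u' (j y) _ hT le_rfl htr (embed_mem j hμ y) (fun t ht => mul_le_mul (hpow t ht)
      (hf t ht) (norm_nonneg _) hTp.le) T ⟨hT, le_rfl⟩).1.trans ?_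
    gcongr
    exact (interpNorm_embed_le j hμ y).trans (by gcongr)
  have f1 := main (fun t => c t • p₁ + (-s t) • p₂)
    (fun t => (a * c t - b * s t) • j p₁ + (-(a * s t + b * c t)) • j p₂) p₁
    (by fun_prop) (by fun_prop)
    (fun t => by
      simp only [map_add, map_smul]
      exact ((hdc t).smul_const (j p₁)).add ((hds t).neg.smul_const (j p₂)))
    (by simp [hc, hs]) (norm_fst_le p) fun t ht => by
      have : (a * c t - b * s t) • j p₁ + (-(a * s t + b * c t)) • j p₂ +
          B (c t • p₁ + (-s t) • p₂) = c t • q.1 + (-s t) • q.2 := by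
        rw [hq1, hq2, map_add, map_smul, map_smul]; module
      rw [this]
      refine norm_smul_add_smul_le (Real.exp_pos _).le ((abs_exp_mul_cos_le _ _).trans (hbd t ht))
        ?_ (norm_fst_le q) (norm_snd_le q)
      rw [abs_neg]
      exact (abs_exp_mul_sin_le _ _).trans (hbd t ht)
  have f2 := main (fun t => s t • p₁ + c t • p₂)
    (fun t => (a * s t + b * c t) • j p₁ + (a * c t - b * s t) • j p₂) p₂
    (by fun_prop) (by fun_prop)
    (fun t => by
      simp only [map_add, map_smul]
      exact ((hds t).smul_const (j p₁)).add ((hdc t).smul_const (j p₂)))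
    (by simp [hc, hs]) (norm_snd_le p) fun t ht => by
      have : (a * s t + b * c t) • j p₁ + (a * c t - b * s t) • j p₂ +
          B (s t • p₁ + c t • p₂) = s t • q.1 + c t • q.2 := by
        rw [hq1, hq2, map_add, map_smul, map_smul]; module
      rw [this]
      exact norm_smul_add_smul_le (Real.exp_pos _).le ((abs_exp_mul_sin_le _ _).trans (hbd t ht))
        ((abs_exp_mul_cos_le _ _).trans (hbd t ht)) (norm_fst_le q) (norm_snd_le q)
  set D := C * (T ^ (1 - μ) * (2 * (Real.exp (a * T) * ‖q‖)) + (1 + ‖j‖) * ‖p‖) with hD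
  have hD0 : 0 ≤ D := by positivity
  rw [mul_comm, ← le_div_iff₀ hTp] at f1 f2
  set e := Real.exp (-(a * T)) with he
  have he0 : 0 < e := Real.exp_pos _
  have hee : Real.exp (a * T) * e = 1 := by rw [he, ← Real.exp_add]; simp
  have hcos : |e * Real.cos (b * T)| ≤ e := abs_exp_mul_cos_le _ _
  have hsin : |e * Real.sin (b * T)| ≤ e := abs_exp_mul_sin_le _ _
  -- Multiplying by e^{-λT} recovers p from its evolution at time T; the initial value thereby
  -- acquires the factor e^{-aT}.
  have hc2 : e * Real.cos (b * T) * c T + e * Real.sin (b * T) * s T = 1 := by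
    have := Real.cos_sq_add_sin_sq (b * T)
    calc _ = (Real.exp (a * T) * e) * (Real.cos (b * T) ^ 2 + Real.sin (b * T) ^ 2) := by
          simp only [hc, hs]; ring
      _ = 1 := by rw [hee, this, one_mul]
  have hc3 : e * Real.cos (b * T) * s T - e * Real.sin (b * T) * c T = 0 := by
    simp only [hc, hs]; ring
  have g1 : ‖p₁‖ ≤ 2 * (e * (D / T ^ (1 - μ))) := by
    have : p₁ = (e * Real.cos (b * T)) • (c T • p₁ + (-s T) • p₂) +
        (e * Real.sin (b * T)) • (s T • p₁ + c T • p₂) := by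
      have : p₁ = (e * Real.cos (b * T) * c T + e * Real.sin (b * T) * s T) • p₁ -
          (e * Real.cos (b * T) * s T - e * Real.sin (b * T) * c T) • p₂ := by
        rw [hc2, hc3, one_smul, zero_smul, sub_zero]
      rw [this]
      generalize e * Real.cos (b * T) = x at *
      generalize e * Real.sin (b * T) = y at *
      rw [← this]
      nth_rewrite 1 [this]
      module
    rw [this]
    exact norm_smul_add_smul_le he0.le hcos hsin f1 f2
  have g2 : ‖p₂‖ ≤ 2 * (e * (D / T ^ (1 - μ))) := by
    have : p₂ = (-(e * Real.sin (b * T))) • (c T • p₁ + (-s T) • p₂) +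
        (e * Real.cos (b * T)) • (s T • p₁ + c T • p₂) := by
      have : p₂ = (e * Real.cos (b * T) * c T + e * Real.sin (b * T) * s T) • p₂ +
          (e * Real.cos (b * T) * s T - e * Real.sin (b * T) * c T) • p₁ := by
        rw [hc2, hc3, one_smul, zero_smul, add_zero]
      generalize e * Real.cos (b * T) = x at *
      generalize e * Real.sin (b * T) = y at *
      nth_rewrite 1 [this]
      module
    rw [this]
    exact norm_smul_add_smul_le he0.le (by rwa [abs_neg]) hcos f1 f2
  have g : ‖p‖ ≤ 2 * (e * (D / T ^ (1 - μ))) := max_le g1 g2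
  calc T ^ (1 - μ) * ‖p‖ ≤ T ^ (1 - μ) * (2 * (e * (D / T ^ (1 - μ)))) := by gcongr
    _ = 2 * (e * D) := by field_simp
    _ = 2 * (C * (T ^ (1 - μ) * (2 * ((Real.exp (a * T) * e) * ‖q‖)) +
          e * ((1 + ‖j‖) * ‖p‖))) := by rw [hD]; ring
    _ = _ := by rw [hee, one_mul]

/-- For large a the factor e^{-aT} lets the initial-value term be absorbed into the left-hand side.
-/
theorem exists_resolvent_bound_large (hμ : μ ∈ Ioo (0 : ℝ) 1) (hT : 0 < T) (hC : 0 < C)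
    (h : APriori j μ B T C) : ∃ a₀ K : ℝ, 0 < a₀ ∧ 0 < K ∧ ∀ a b, a₀ ≤ a → ∀ p,
      ‖p‖ ≤ K * ‖resolventMap j B a b p‖ := by
  have hTp : 0 < T ^ (1 - μ) := Real.rpow_pos_of_pos hT _
  have hlim : Tendsto (fun a : ℝ => 2 * (C * (Real.exp (-(a * T)) * (1 + ‖j‖)))) atTop
      (𝓝 (2 * (C * (0 * (1 + ‖j‖))))) := by
    refine Tendsto.const_mul _ (Tendsto.const_mul _ (Tendsto.mul_const _ ?_))
    exact Real.tendsto_exp_neg_atTop_nhds_zero.comp (tendsto_id.atTop_mul_const hT)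
  have hev := hlim.eventually (gt_mem_nhds (show 2 * (C * (0 * (1 + ‖j‖))) < T ^ (1 - μ) / 2 by
    simpa using hTp))
  obtain ⟨a₀, ha₀⟩ := eventually_atTop.1 hev
  refine ⟨max a₀ 1, 8 * C, by positivity, by positivity, fun a b ha p => ?_⟩
  have h1 := ha₀ a ((le_max_left _ _).trans ha)
  have h2 := h.exp_le hμ hT hC ((zero_le_one.trans (le_max_right a₀ 1)).trans ha) b p
  have h3 := mul_le_mul_of_nonneg_right h1.le (norm_nonneg p)
  refine le_of_mul_le_mul_left ?_ hTp
  linarith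

/-- The bound at λ + a₀ is used at λ, with a₀·jp as an error. By the equation |λ||jp| is at most
2(|q| + ‖B‖|p|), so for large |λ| the part of the error containing |p| is absorbed; M is chosen to
make it at most |p|/2. -/
theorem exists_resolvent_bound_outside {a₀ K : ℝ} (ha₀ : 0 < a₀) (hK : 0 < K)
    (h : ∀ a b, a₀ ≤ a → ∀ p, ‖p‖ ≤ K * ‖resolventMap j B a b p‖) :
    ∃ M K' : ℝ, 0 < M ∧ 0 < K' ∧ ∀ a b, 0 ≤ a → M ≤ max |a| |b| → ∀ p,
      ‖p‖ ≤ K' * ‖resolventMap j B a b p‖ := by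
  set M := 4 * K * a₀ * (‖B‖ + 1) with hM
  have hM0 : 0 < M := by positivity
  refine ⟨M, 2 * K * (1 + 2 * a₀ / M), hM0, by positivity, fun a b ha hab p => ?_⟩
  have h1 := h (a + a₀) b (by linarith) p
  have h2 := max_mul_norm_le_resolventMap (j := j) (B := B) a b p
  have h3 : resolventMap j B (a + a₀) b p = resolventMap j B a b p + a₀ • (j p.1, j p.2) := by
    rw [resolventMap_apply, resolventMap_apply]
    refine Prod.ext ?_ ?_ <;> simp only [Prod.fst_add, Prod.snd_add, Prod.smul_mk] <;> module
  have h4 : ‖resolventMap j B (a + a₀) b p‖ ≤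
      ‖resolventMap j B a b p‖ + a₀ * max ‖j p.1‖ ‖j p.2‖ := by
    rw [h3]
    refine (norm_add_le _ _).trans ?_
    rw [norm_smul, Real.norm_of_nonneg ha₀.le, Prod.norm_mk (j p.1)]
  set n := max ‖j p.1‖ ‖j p.2‖
  set q := ‖resolventMap j B a b p‖
  have hn : 0 ≤ n := (norm_nonneg _).trans (le_max_left _ _)
  have h5 : M * n ≤ 2 * (q + ‖B‖ * ‖p‖) := (mul_le_mul_of_nonneg_right hab hn).trans h2
  have h6 : n ≤ 2 * (q + ‖B‖ * ‖p‖) / M := by rw [le_div_iff₀ hM0]; linarith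
  have h7 : ‖p‖ ≤ K * (q + a₀ * (2 * (q + ‖B‖ * ‖p‖) / M)) := by
    refine h1.trans (mul_le_mul_of_nonneg_left (h4.trans ?_) hK.le)
    gcongr
  have h8 : K * (a₀ * (2 * (‖B‖ * ‖p‖) / M)) ≤ ‖p‖ / 2 := by
    rw [show K * (a₀ * (2 * (‖B‖ * ‖p‖) / M)) = (2 * K * a₀ * ‖B‖ * ‖p‖) / M by ring,
      div_le_iff₀ hM0, hM]
    nlinarith [mul_nonneg (mul_pos hK ha₀).le (norm_nonneg p)]
  have h9 : K * (q + a₀ * (2 * (q + ‖B‖ * ‖p‖) / M)) =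
      K * (1 + 2 * a₀ / M) * q + K * (a₀ * (2 * (‖B‖ * ‖p‖) / M)) := by ring
  linarith

theorem resolventMap_sub_le (a b a' b' : ℝ) (p : E₁ × E₁) :
    ‖resolventMap j B a b p - resolventMap j B a' b' p‖ ≤
      (|a - a'| + |b - b'|) * (‖j‖ * ‖p‖) := by
  have h1 : ‖j p.1‖ ≤ ‖j‖ * ‖p‖ := j.le_opNorm_of_le (norm_fst_le p)
  have h2 : ‖j p.2‖ ≤ ‖j‖ * ‖p‖ := j.le_opNorm_of_le (norm_snd_le p)
  have h3 : resolventMap j B a b p - resolventMap j B a' b' p =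
      ((a - a') • j p.1 - (b - b') • j p.2, (a - a') • j p.2 + (b - b') • j p.1) := by
    rw [resolventMap_apply, resolventMap_apply]
    refine Prod.ext ?_ ?_ <;> simp only [Prod.fst_sub, Prod.snd_sub] <;> module
  rw [h3, Prod.norm_mk, add_mul]
  refine max_le ((norm_sub_le _ _).trans ?_) ((norm_add_le _ _).trans ?_) <;>
  · rw [norm_smul, norm_smul, Real.norm_eq_abs, Real.norm_eq_abs]
    gcongr

/-- Uniform resolvent estimate in the closed right half-plane, on the stable subspace. -/
theorem exists_resolvent_bound (hμ : μ ∈ Ioo (0 : ℝ) 1) (hT : 0 < T) (hC : 0 < C)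
    (h : APriori j μ B T C) {Pr : E₀ →L[ℝ] E₁} (hPr : IsCenterProj j B Pr)
    (hspec : complexSpectrum j (-B) \ {0} ⊆ {z : ℂ | z.re < 0}) :
    ∃ K : ℝ, 0 < K ∧ ∀ a b, 0 ≤ a → ∀ p : E₁ × E₁, Pr (j p.1) = 0 → Pr (j p.2) = 0 →
      ‖p‖ ≤ K * ‖resolventMap j B a b p‖ := by
  obtain ⟨a₀, K₀, ha₀, hK₀, h₀⟩ := exists_resolvent_bound_large hμ hT hC h
  obtain ⟨M, K₁, hM, hK₁, h₁⟩ := exists_resolvent_bound_outside ha₀ hK₀ h₀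
  have hloc : ∀ z : ℝ × ℝ, 0 ≤ z.1 → ∃ K : ℝ, 0 < K ∧ ∀ p : E₁ × E₁, Pr (j p.1) = 0 →
      Pr (j p.2) = 0 → ‖p‖ ≤ K * ‖resolventMap j B z.1 z.2 p‖ := by
    rintro ⟨a, b⟩ ha
    by_cases hz : (⟨a, b⟩ : ℂ) = 0
    · obtain ⟨K, hK, hb⟩ := hPr.exists_bound
      have ha0 : a = 0 := congrArg Complex.re hz
      have hb0 : b = 0 := congrArg Complex.im hz
      refine ⟨K, hK, fun p h1 h2 => ?_⟩
      have h3 : resolventMap j B a b p = (B p.1, B p.2) := by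
        rw [resolventMap_apply, ha0, hb0]; simp
      rw [h3]
      exact max_le ((hb _ h1).trans (by gcongr; exact norm_fst_le (B p.1, B p.2)))
        ((hb _ h2).trans (by gcongr; exact norm_snd_le (B p.1, B p.2)))
    · obtain ⟨K, hK, hb⟩ := exists_bound_of_bijective (resolventMap j B a b)
        (bijective_resolventMap fun hmem => absurd (hspec ⟨hmem, hz⟩) (not_lt.2 ha))
      exact ⟨K, hK, fun p _ _ => hb p⟩
  -- Outside this rectangle the shifted bound holds. Inside, local bounds are stable under small
  -- changes of λ and compactness makes them uniform; only the point 0 uses that p has no center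
  -- component.
  have hcpt : IsCompact (Icc (0 : ℝ) M ×ˢ Icc (-M) M) := isCompact_Icc.prod isCompact_Icc
  have hind : ∃ K : ℝ, 0 < K ∧ ∀ z ∈ Icc (0 : ℝ) M ×ˢ Icc (-M) M, ∀ p : E₁ × E₁,
      Pr (j p.1) = 0 → Pr (j p.2) = 0 → ‖p‖ ≤ K * ‖resolventMap j B z.1 z.2 p‖ := by
    refine hcpt.induction_on (p := fun S => ∃ K : ℝ, 0 < K ∧ ∀ z ∈ S, ∀ p : E₁ × E₁,
      Pr (j p.1) = 0 → Pr (j p.2) = 0 → ‖p‖ ≤ K * ‖resolventMap j B z.1 z.2 p‖)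
      ⟨1, one_pos, fun z hz => absurd hz (notMem_empty z)⟩ ?_ ?_ ?_
    · rintro S S' hSS' ⟨K, hK, hb⟩
      exact ⟨K, hK, fun z hz => hb z (hSS' hz)⟩
    · rintro S S' ⟨K, hK, hb⟩ ⟨K', hK', hb'⟩
      refine ⟨max K K', lt_max_of_lt_left hK, ?_⟩
      rintro z (hz | hz) p h1 h2
      · exact (hb z hz p h1 h2).trans (by gcongr; exact le_max_left _ _)
      · exact (hb' z hz p h1 h2).trans (by gcongr; exact le_max_right _ _)
    · rintro z hz
      obtain ⟨K, hK, hb⟩ := hloc z hz.1.1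
      have hd : 0 < 1 / (4 * K * (‖j‖ + 1)) := by positivity
      refine ⟨_, mem_nhdsWithin_of_mem_nhds (Metric.ball_mem_nhds z hd), 2 * K, by positivity, ?_⟩
      intro z' hz' p h1 h2
      have h3 := hb p h1 h2
      have h4 := resolventMap_sub_le (j := j) (B := B) z.1 z.2 z'.1 z'.2 p
      have h5 : |z.1 - z'.1| ≤ 1 / (4 * K * (‖j‖ + 1)) := by
        rw [← Real.dist_eq, dist_comm]
        exact (le_max_left _ _).trans (Metric.mem_ball.1 hz').le
      have h6 : |z.2 - z'.2| ≤ 1 / (4 * K * (‖j‖ + 1)) := by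
        rw [← Real.dist_eq, dist_comm]
        exact (le_max_right _ _).trans (Metric.mem_ball.1 hz').le
      have h7 : ‖resolventMap j B z.1 z.2 p‖ ≤ ‖resolventMap j B z'.1 z'.2 p‖ +
          (1 / (4 * K * (‖j‖ + 1)) + 1 / (4 * K * (‖j‖ + 1))) * ((‖j‖ + 1) * ‖p‖) := by
        have h8 : (|z.1 - z'.1| + |z.2 - z'.2|) * (‖j‖ * ‖p‖) ≤
            (1 / (4 * K * (‖j‖ + 1)) + 1 / (4 * K * (‖j‖ + 1))) * ((‖j‖ + 1) * ‖p‖) := by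
          gcongr
          linarith
        linarith [norm_sub_norm_le (resolventMap j B z.1 z.2 p) (resolventMap j B z'.1 z'.2 p)]
      have h9 : K * ((1 / (4 * K * (‖j‖ + 1)) + 1 / (4 * K * (‖j‖ + 1))) * ((‖j‖ + 1) * ‖p‖)) =
          ‖p‖ / 2 := by
        have : (0 : ℝ) < ‖j‖ + 1 := by positivity
        field_simp
        ring
      have h10 := mul_le_mul_of_nonneg_left h7 hK.le
      linarith
  obtain ⟨K₂, hK₂, h₂⟩ := hind
  refine ⟨max K₁ K₂, lt_max_of_lt_left hK₁, fun a b ha p hp1 hp2 => ?_⟩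
  rcases le_total M (max |a| |b|) with hm | hm
  · exact (h₁ a b ha hm p).trans (by gcongr; exact le_max_left _ _)
  · refine (h₂ (a, b) ⟨⟨ha, ?_⟩, ?_⟩ p hp1 hp2).trans (by gcongr; exact le_max_right _ _)
    · exact (le_abs_self a).trans ((le_max_left _ _).trans hm)
    · exact abs_le.1 ((le_max_right _ _).trans hm)

/-- Since λjp = q - Bp and |p| is already bounded by |q|, the E₀-norm of the resolvent decays like
1/|λ|. -/
theorem exists_resolvent_decay (hμ : μ ∈ Ioo (0 : ℝ) 1) (hT : 0 < T) (hC : 0 < C)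
    (h : APriori j μ B T C) {Pr : E₀ →L[ℝ] E₁} (hPr : IsCenterProj j B Pr)
    (hspec : complexSpectrum j (-B) \ {0} ⊆ {z : ℂ | z.re < 0}) :
    ∃ K : ℝ, 0 < K ∧ ∀ a b, 0 ≤ a → ∀ p : E₁ × E₁, Pr (j p.1) = 0 → Pr (j p.2) = 0 →
      (1 + |b|) * max ‖j p.1‖ ‖j p.2‖ ≤ K * ‖resolventMap j B a b p‖ := by
  obtain ⟨K, hK, hb⟩ := exists_resolvent_bound hμ hT hC h hPr hspec
  refine ⟨‖j‖ * K + 2 * (1 + ‖B‖ * K), by positivity, fun a b ha p h1 h2 => ?_⟩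
  have h3 := hb a b ha p h1 h2
  have h4 := max_mul_norm_le_resolventMap (j := j) (B := B) a b p
  have h5 : max ‖j p.1‖ ‖j p.2‖ ≤ ‖j‖ * ‖p‖ :=
    max_le (j.le_opNorm_of_le (norm_fst_le p)) (j.le_opNorm_of_le (norm_snd_le p))
  have h6 : |b| * max ‖j p.1‖ ‖j p.2‖ ≤ max |a| |b| * max ‖j p.1‖ ‖j p.2‖ :=
    mul_le_mul_of_nonneg_right (le_max_right _ _) ((norm_nonneg _).trans (le_max_left _ _))
  have h7 := mul_le_mul_of_nonneg_left h3 (norm_nonneg j)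
  have h8 := mul_le_mul_of_nonneg_left h3 (norm_nonneg B)
  linarith

end Resolvent

section Fourier

open MeasureTheory

/-! ### A pointwise bound from the decay of trigonometric integrals -/

/-- The two integrals are, up to sign, the real and imaginary parts of the Fourier transform, which
is therefore dominated by 2K/(1 + s²). Fourier inversion and ∫ ds/(1 + s²) = π give the bound. -/
theorem abs_le_of_trigIntegral_le {f : ℝ → ℝ} (hf : Continuous f) (hi : Integrable f) {K : ℝ}
    (hc : ∀ s : ℝ, |∫ t, Real.cos (2 * Real.pi * s * t) * f t| ≤ K * (1 + s ^ 2)⁻¹)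
    (hs : ∀ s : ℝ, |∫ t, Real.sin (2 * Real.pi * s * t) * f t| ≤ K * (1 + s ^ 2)⁻¹) (t : ℝ) :
    |f t| ≤ 2 * K * Real.pi := by
  set g : ℝ → ℂ := fun t => (f t : ℂ) with hg
  have hgi : Integrable g := hi.ofReal
  have hgc : Continuous g := Complex.continuous_ofReal.comp hf
  have hci : ∀ s : ℝ, Integrable fun t => Real.cos (2 * Real.pi * s * t) * f t := fun s =>
    hi.bdd_mul (c := 1) (by fun_prop) (Eventually.of_forall fun t => by
      rw [Real.norm_eq_abs]; exact Real.abs_cos_le_one _)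
  have hsi : ∀ s : ℝ, Integrable fun t => Real.sin (2 * Real.pi * s * t) * f t := fun s =>
    hi.bdd_mul (c := 1) (by fun_prop) (Eventually.of_forall fun t => by
      rw [Real.norm_eq_abs]; exact Real.abs_sin_le_one _)
  have hval : ∀ s : ℝ, FourierTransform.fourier g s =
      ((∫ t, Real.cos (2 * Real.pi * s * t) * f t : ℝ) : ℂ) -
        ((∫ t, Real.sin (2 * Real.pi * s * t) * f t : ℝ) : ℂ) * Complex.I := by
    intro s
    rw [Real.fourier_real_eq_integral_exp_smul, ← integral_complex_ofReal,
      ← integral_complex_ofReal, ← integral_mul_const, ← integral_sub (hci s).ofReal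
        ((hsi s).ofReal.mul_const _)]
    congr 1
    ext t
    rw [smul_eq_mul, Complex.exp_mul_I, ← Complex.ofReal_cos, ← Complex.ofReal_sin,
      show -2 * Real.pi * t * s = -(2 * Real.pi * s * t) by ring, Real.cos_neg, Real.sin_neg, hg]
    push_cast
    ring
  have hbd : ∀ s, ‖FourierTransform.fourier g s‖ ≤ 2 * K * (1 + s ^ 2)⁻¹ := by
    intro s
    rw [hval]
    refine (norm_sub_le _ _).trans ?_
    rw [norm_mul, Complex.norm_I, mul_one, Complex.norm_real, Complex.norm_real, Real.norm_eq_abs,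
      Real.norm_eq_abs]
    linarith [hc s, hs s]
  have hFc : Continuous (FourierTransform.fourier g) := 
    VectorFourier.fourierIntegral_continuous Real.continuous_fourierChar continuous_inner hgi
  have hFi : Integrable (FourierTransform.fourier g) :=
    (integrable_inv_one_add_sq.const_mul (2 * K)).mono' hFc.aestronglyMeasurable
      (Eventually.of_forall hbd)
  have hinv := congrFun (hgc.fourierInv_fourier_eq hgi hFi) t
  have h1 : ‖g t‖ ≤ ∫ s, ‖FourierTransform.fourier g s‖ := by
    rw [← hinv, Real.fourierInv_eq']
    refine (norm_integral_le_integral_norm _).trans (le_of_eq ?_)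
    congr 1
    ext s
    rw [norm_smul, Complex.norm_exp_ofReal_mul_I, one_mul]
  have h2 : ∫ s, ‖FourierTransform.fourier g s‖ ≤ ∫ s : ℝ, 2 * K * (1 + s ^ 2)⁻¹ :=
    integral_mono hFi.norm (integrable_inv_one_add_sq.const_mul (2 * K)) hbd
  rw [integral_const_mul, integral_univ_inv_one_add_sq] at h2
  have h3 : ‖g t‖ = |f t| := by rw [hg, Complex.norm_real, Real.norm_eq_abs]
  linarith

variable {E F : Type*} [NormedAddCommGroup E] [NormedSpace ℝ E] [CompleteSpace E]
  [NormedAddCommGroup F] [NormedSpace ℝ F] [CompleteSpace F]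

theorem one_add_mul_exp_le {κ : ℝ} (hκ : 0 < κ) {t : ℝ} (ht : 0 ≤ t) :
    (1 + t) * Real.exp (-(κ * t)) ≤ (1 + 2 / κ) * Real.exp (-(κ / 2 * t)) := by
  have h1 : κ / 2 * t ≤ Real.exp (κ / 2 * t) := by linarith [Real.add_one_le_exp (κ / 2 * t)]
  have h2 : 1 ≤ Real.exp (κ / 2 * t) := Real.one_le_exp (by positivity)
  have h3 : 1 + t ≤ (1 + 2 / κ) * Real.exp (κ / 2 * t) := by
    have : t ≤ 2 / κ * Real.exp (κ / 2 * t) := by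
      calc t = 2 / κ * (κ / 2 * t) := by field_simp
        _ ≤ _ := by gcongr
    linarith
  calc (1 + t) * Real.exp (-(κ * t))
      ≤ (1 + 2 / κ) * Real.exp (κ / 2 * t) * Real.exp (-(κ * t)) := by gcongr
    _ = _ := by rw [mul_assoc, ← Real.exp_add]; ring_nf

theorem integrableOn_of_exp_bound {f : ℝ → E} (hf : ContinuousOn f (Ici 0)) {M κ : ℝ} (hκ : 0 < κ)
    (h : ∀ t, 0 ≤ t → ‖f t‖ ≤ M * Real.exp (-(κ * t))) : IntegrableOn f (Ioi 0) := by
  refine Integrable.mono' ((exp_neg_integrableOn_Ioi 0 hκ).const_mul M)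
    ((hf.mono Ioi_subset_Ici_self).aestronglyMeasurable measurableSet_Ioi) ?_
  filter_upwards [ae_restrict_mem measurableSet_Ioi] with t ht
  rw [neg_mul]
  exact h t (le_of_lt ht)

theorem tendsto_zero_of_exp_bound {f : ℝ → E} {M κ : ℝ} (hκ : 0 < κ)
    (h : ∀ t, 0 ≤ t → ‖f t‖ ≤ M * Real.exp (-(κ * t))) : Tendsto f atTop (𝓝 0) := by
  have h1 : Tendsto (fun t : ℝ => M * Real.exp (-(κ * t))) atTop (𝓝 0) := by
    simpa using (Real.tendsto_exp_neg_atTop_nhds_zero.comp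
      (tendsto_id.const_mul_atTop hκ)).const_mul M
  exact squeeze_zero_norm' (by filter_upwards [eventually_ge_atTop 0] with t ht using h t ht) h1

end Fourier

section Decay

open MeasureTheory

variable {E₀ E₁ : Type*} [NormedAddCommGroup E₀] [NormedSpace ℝ E₀] [CompleteSpace E₀]
  [NormedAddCommGroup E₁] [NormedSpace ℝ E₁] [CompleteSpace E₁]
variable {j B : E₁ →L[ℝ] E₀} {μ T C : ℝ}

/-! ### Exponential decay on the stable subspace -/

/-- With Pr ∘ j in the role of the embedding, estimates for trajectories apply to the center
component, measured in E₁. -/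
theorem Traj.comp_clm {u : ℝ → E₁} {u' : ℝ → E₀} {x : E₀} (hT : 0 < T) (h : Traj j μ T u u' x)
    (Pr : E₀ →L[ℝ] E₁) : Traj (Pr.comp j) μ T u (fun t => Pr (u' t)) (Pr x) where
  init := (Pr.continuous.tendsto x).comp h.init
  memU := h.memU
  memDeriv := h.memDeriv.clm hT Pr
  deriv t ht := Pr.hasFDerivAt.comp_hasDerivWithinAt t (h.deriv t ht)

theorem Traj.map_eq_of_deriv_zero (hμ : 0 < μ) {u : ℝ → E₁} {u' : ℝ → E₀} {x : E₀}
    (h : Traj j μ T u u' x) (Pr : E₀ →L[ℝ] E₁) (h0 : ∀ t ∈ Ioc 0 T, Pr (u' t) = 0) {t : ℝ}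
    (ht : t ∈ Ioc 0 T) : Pr (j (u t)) = Pr x := by
  have h1 := (h.comp_clm (ht.1.trans_le ht.2) Pr).norm_sub_init_le hμ (M := 0)
    (fun s hs => by rw [h0 s hs, norm_zero, mul_zero]) ht
  rw [zero_div, zero_mul] at h1
  exact sub_eq_zero.1 (norm_le_zero_iff.1 h1)

/-- A solution of `u' + B u = 0` on `[0,∞)` that is continuous in `E₁` up to `t = 0`. -/
structure RegSol (j B : E₁ →L[ℝ] E₀) (u : ℝ → E₁) : Prop where
  cont : ContinuousOn u (Ici 0)
  deriv : ∀ t, 0 < t → HasDerivAt (fun s => j (u s)) (-B (u t)) t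

theorem HomSol.regSol {u : ℝ → E₁} {x : E₀} (h : HomSol j μ B u x) {a : ℝ} (ha : 0 < a) :
    RegSol j B (fun t => u (a + t)) where
  cont := by
    have h1 : ContinuousOn u (Ioi 0) := fun t ht =>
      (((h (t + 1) (by linarith [mem_Ioi.1 ht])).memU.1.continuousAt
        (Ioc_mem_nhds ht (by linarith)))).continuousWithinAt
    refine h1.comp (by fun_prop) fun t ht => ?_
    exact add_pos_of_pos_of_nonneg ha ht
  deriv t ht := by
    have h1 := (h (a + t + 1) (by linarith)).hasDerivAt (t := a + t) ⟨by linarith, by linarith⟩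
    exact h1.comp_const_add a t

theorem RegSol.traj (hμ : μ < 1) {u : ℝ → E₁} (h : RegSol j B u) (hT : 0 < T) :
    Traj j μ T u (fun t => -B (u t)) (j (u 0)) := by
  have hc : ContinuousOn u (Icc 0 T) := h.cont.mono Icc_subset_Ici_self
  exact Traj.of_continuousOn hμ hT hc (B.continuous.comp_continuousOn hc).neg
    fun t ht => (h.deriv t ht.1).hasDerivWithinAt

theorem RegSol.shift {u : ℝ → E₁} (h : RegSol j B u) {a : ℝ} (ha : 0 ≤ a) :
    RegSol j B (fun t => u (a + t)) where
  cont := h.cont.comp (by fun_prop) fun _ ht => add_nonneg ha ht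
  deriv t ht := (h.deriv (a + t) (by linarith)).comp_const_add a t

theorem RegSol.stable (hμ : μ ∈ Ioo (0 : ℝ) 1) {Pr : E₀ →L[ℝ] E₁} (hPr : IsCenterProj j B Pr)
    {u : ℝ → E₁} (h : RegSol j B u) (h0 : Pr (j (u 0)) = 0) {t : ℝ} (ht : 0 ≤ t) :
    Pr (j (u t)) = 0 := by
  rcases ht.eq_or_lt with rfl | ht
  · exact h0
  · rw [← h0]
    exact (h.traj hμ.2 ht).map_eq_of_deriv_zero hμ.1 Pr
      (fun s _ => by rw [map_neg, hPr.proj_map, neg_zero]) ⟨ht, le_rfl⟩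

/-- The restriction t ≥ 1 serves to drop the weight t^{1-μ}, which degenerates at 0. -/
theorem RegSol.norm_le (hμ : μ ∈ Ioo (0 : ℝ) 1) (hC : 0 < C) (hA : APriori j μ B T C)
    {u : ℝ → E₁} (h : RegSol j B u) {t : ℝ} (ht : 1 ≤ t) (htT : t ≤ T) :
    ‖u t‖ ≤ C * (1 + ‖j‖) * ‖u 0‖ := by
  have ht0 : 0 < t := by linarith
  have h1 := (hA t _ _ _ 0 ht0 htT (h.traj hμ.2 ht0) (embed_mem j hμ _)
    (fun s _ => by rw [neg_add_cancel, norm_zero, mul_zero]) t ⟨ht0, le_rfl⟩).1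
  have h2 : 1 ≤ t ^ (1 - μ) := Real.one_le_rpow ht (by linarith [hμ.2])
  have h3 := interpNorm_embed_le j hμ (u 0)
  calc ‖u t‖ ≤ t ^ (1 - μ) * ‖u t‖ := le_mul_of_one_le_left (norm_nonneg _) h2
    _ ≤ C * (0 + interpNorm j μ (j (u 0))) := h1
    _ ≤ C * ((1 + ‖j‖) * ‖u 0‖) := by rw [zero_add]; gcongr
    _ = _ := by ring

/-- Solutions starting in the kernel of `Pr` grow at most like `e^{σ t}`. -/
def Growth (j B : E₁ →L[ℝ] E₀) (Pr : E₀ →L[ℝ] E₁) (σ : ℝ) : Prop :=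
  ∃ M, 0 < M ∧ ∀ u, RegSol j B u → Pr (j (u 0)) = 0 → ∀ t, 1 ≤ t →
    ‖u t‖ ≤ M * Real.exp (σ * t) * ‖u 0‖

theorem Growth.mono {Pr : E₀ →L[ℝ] E₁} {σ τ : ℝ} (h : Growth j B Pr σ) (hστ : σ ≤ τ) :
    Growth j B Pr τ := by
  obtain ⟨M, hM, h⟩ := h
  refine ⟨M, hM, fun u hu h0 t ht => (h u hu h0 t ht).trans ?_⟩
  gcongr

/-- The one-step bound is iterated, which is possible because the stable subspace is invariant. The
remaining time is controlled by the a priori estimate. -/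
theorem growth_of_step (hμ : μ ∈ Ioo (0 : ℝ) 1) (hT : 0 < T) (hC : 0 < C)
    (hA : APriori j μ B T C) {Pr : E₀ →L[ℝ] E₁} (hPr : IsCenterProj j B Pr) {N τ : ℝ} (hN : 1 ≤ N)
    (hstep : ∀ u, RegSol j B u → Pr (j (u 0)) = 0 → ‖u N‖ ≤ Real.exp (τ * N) * ‖u 0‖) :
    Growth j B Pr τ := by
  obtain ⟨C', hC', hA'⟩ := hA.exists_long hμ hT hC (N + 1)
  refine ⟨C' * (1 + ‖j‖) * Real.exp (|τ| * (N + 1)), by positivity, fun u hu h0 t ht => ?_⟩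
  have hiter : ∀ k : ℕ, ‖u (k * N)‖ ≤ Real.exp (τ * (k * N)) * ‖u 0‖ := by
    intro k
    induction k with
    | zero => simp
    | succ k ih =>
      have hk : 0 ≤ k * N := by positivity
      have h1 := hstep _ (hu.shift hk) (by simpa using hu.stable hμ hPr h0 hk)
      simp only [add_zero] at h1
      have h2 : ((k + 1 : ℕ) : ℝ) * N = k * N + N := by push_cast; ring
      rw [h2, mul_add, Real.exp_add, mul_comm (Real.exp _), mul_assoc]
      exact h1.trans (by gcongr)
  have hN0 : 0 < N := by linarith
  -- Using t - 1 instead of t leaves a remainder r = t - kN in [1, N + 1], since `RegSol.norm_le`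
  -- needs times at least 1.
  set k := ⌊(t - 1) / N⌋₊ with hk
  have hk1 : k * N ≤ t - 1 := by
    rw [← le_div_iff₀ hN0]; exact Nat.floor_le (div_nonneg (by linarith) hN0.le)
  have hk2 : t - 1 < (k + 1) * N := by
    rw [← div_lt_iff₀ hN0]; exact Nat.lt_floor_add_one _
  have hk0 : 0 ≤ k * N := by positivity
  set r := t - k * N with hr
  have h1 := (hu.shift hk0).norm_le hμ hC' hA' (t := r) (by linarith) (by linarith)
  simp only [add_zero] at h1
  rw [show k * N + r = t by ring] at h1
  have h2 : τ * (k * N) ≤ |τ| * (N + 1) + τ * t := by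
    have h3 : τ * (k * N) = τ * t - τ * r := by rw [hr]; ring
    have h4 : -(τ * r) ≤ |τ| * (N + 1) := by
      rw [← neg_mul]
      exact mul_le_mul (neg_le_abs τ) (by linarith) (by linarith) (abs_nonneg τ)
    linarith
  calc ‖u t‖ ≤ C' * (1 + ‖j‖) * ‖u (k * N)‖ := h1
    _ ≤ C' * (1 + ‖j‖) * (Real.exp (τ * (k * N)) * ‖u 0‖) := by gcongr; exact hiter k
    _ ≤ C' * (1 + ‖j‖) * (Real.exp (|τ| * (N + 1) + τ * t) * ‖u 0‖) := by gcongr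
    _ = _ := by rw [Real.exp_add]; ring

theorem exists_growth (hμ : μ ∈ Ioo (0 : ℝ) 1) (hT : 0 < T) (hC : 0 < C)
    (hA : APriori j μ B T C) {Pr : E₀ →L[ℝ] E₁} (hPr : IsCenterProj j B Pr) :
    ∃ σ, Growth j B Pr σ := by
  obtain ⟨C', hC', hA'⟩ := hA.exists_long hμ hT hC 1
  refine ⟨Real.log (C' * (1 + ‖j‖)), growth_of_step hμ hT hC hA hPr le_rfl fun u hu _ => ?_⟩
  rw [mul_one, Real.exp_log (by positivity)]
  exact hu.norm_le hμ hC' hA' le_rfl le_rfl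

/-! ### Laplace transforms of solutions -/

theorem integral_smul_add_smul {f g : ℝ → E₁} (hf : IntegrableOn f (Ioi 0))
    (hg : IntegrableOn g (Ioi 0)) (c d : ℝ) :
    ∫ t in Ioi 0, (c • f t + d • g t) = c • (∫ t in Ioi 0, f t) + d • ∫ t in Ioi 0, g t := by
  rw [integral_add (f := fun t => c • f t) (g := fun t => d • g t) (hf.smul c) (hg.smul d),
    integral_smul, integral_smul]

theorem integral_add_smul_add_smul {k f g : ℝ → E₁} (hk : IntegrableOn k (Ioi 0))
    (hf : IntegrableOn f (Ioi 0)) (hg : IntegrableOn g (Ioi 0)) (c d : ℝ) :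
    ∫ t in Ioi 0, (k t + (c • f t + d • g t)) =
      (∫ t in Ioi 0, k t) + (c • (∫ t in Ioi 0, f t) + d • ∫ t in Ioi 0, g t) := by
  rw [integral_add (f := k) (g := fun t => c • f t + d • g t) hk ((hf.smul c).add (hg.smul d)),
    integral_smul_add_smul hf hg]

/-- The integral identity behind the Laplace transform of a solution. -/
theorem RegSol.integral_eq {u : ℝ → E₁} (hu : RegSol j B u) {φ φ' : ℝ → ℝ} (hφ : Continuous φ)
    (hφ' : Continuous φ') (hd : ∀ t, HasDerivAt φ (φ' t) t) {M κ : ℝ} (hκ : 0 < κ)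
    (hb : ∀ t, 0 ≤ t → ‖φ t • u t‖ ≤ M * Real.exp (-(κ * t)))
    (hb' : ∀ t, 0 ≤ t → ‖φ' t • u t‖ ≤ M * Real.exp (-(κ * t))) :
    B (∫ t in Ioi 0, φ t • u t) = φ 0 • j (u 0) + j (∫ t in Ioi 0, φ' t • u t) := by
  have hi : IntegrableOn (fun t => φ t • u t) (Ioi 0) :=
    integrableOn_of_exp_bound (hφ.continuousOn.smul hu.cont) hκ hb
  have hi' : IntegrableOn (fun t => φ' t • u t) (Ioi 0) :=
    integrableOn_of_exp_bound (hφ'.continuousOn.smul hu.cont) hκ hb'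
  have h1 := MeasureTheory.integral_Ioi_of_hasDerivAt_of_tendsto (a := 0)
    (f := fun t => j (φ t • u t)) (f' := fun t => j (φ' t • u t) - B (φ t • u t)) (m := 0)
    ((j.continuous.comp_continuousOn (hφ.continuousOn.smul hu.cont)) 0 self_mem_Ici)
    (fun t ht => by
      have h2 := (hd t).smul (hu.deriv t ht)
      have h3 : j (φ' t • u t) - B (φ t • u t) = φ t • -B (u t) + φ' t • j (u t) := by
        rw [map_smul, map_smul, smul_neg]; abel
      rw [h3]
      simp only [map_smul]
      exact h2)
    ((j.integrable_comp hi').sub (B.integrable_comp hi))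
    (by
      have := (j.continuous.tendsto 0).comp (tendsto_zero_of_exp_bound hκ hb)
      rwa [map_zero] at this)
  rw [integral_sub (f := fun t => j (φ' t • u t)) (g := fun t => B (φ t • u t))
    (j.integrable_comp hi') (B.integrable_comp hi), j.integral_comp_comm hi',
    B.integral_comp_comm hi, zero_sub, map_smul, sub_eq_iff_eq_add] at h1
  rw [h1]; abel

/-- If the growth is at most `e^{σ' t}` for every `σ' > σ ≥ 0`, then the resolvent estimate
improves it to `e^{σ t} / t`. -/
theorem exists_norm_le_exp_div (hμ : μ ∈ Ioo (0 : ℝ) 1) {Pr : E₀ →L[ℝ] E₁}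
    (hPr : IsCenterProj j B Pr) {K : ℝ} (hK : 0 < K)
    (hres : ∀ a b, 0 ≤ a → ∀ p : E₁ × E₁, Pr (j p.1) = 0 → Pr (j p.2) = 0 →
      (1 + |b|) * max ‖j p.1‖ ‖j p.2‖ ≤ K * ‖resolventMap j B a b p‖) {σ : ℝ} (hσ : 0 ≤ σ)
    (hgr : ∀ σ', σ < σ' → Growth j B Pr σ') {u : ℝ → E₁} (hu : RegSol j B u)
    (h0 : Pr (j (u 0)) = 0) {t : ℝ} (ht : 0 ≤ t) :
    t * ‖j (u t)‖ ≤ 2 * K ^ 2 * Real.pi * ‖j (u 0)‖ * Real.exp (σ * t) := by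
  have key : ∀ a, σ < a → t * ‖j (u t)‖ ≤ 2 * K ^ 2 * Real.pi * ‖j (u 0)‖ * Real.exp (a * t) := by
    intro a ha
    have ha0 : 0 ≤ a := hσ.trans ha.le
    obtain ⟨M, hM, hg⟩ := hgr ((σ + a) / 2) (by linarith)
    -- The growth bound is used at a rate strictly between σ and a. Half of the gap a - σ₁ absorbs
    -- the factor 1 + s, the other half κ keeps the integrals convergent.
    set σ₁ := (σ + a) / 2 with hσ₁
    obtain ⟨M₀, hM₀⟩ := isCompact_Icc.exists_bound_of_continuousOn
      (hu.cont.mono (Icc_subset_Ici_self : Icc (0 : ℝ) 1 ⊆ Ici 0))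
    set M₁ := max M₀ (M * ‖u 0‖) with hM₁
    have hσ₁0 : 0 ≤ σ₁ := by rw [hσ₁]; linarith
    have hM₁0 : 0 ≤ M₁ := le_max_of_le_right (by positivity)
    have hub : ∀ s, 0 ≤ s → ‖u s‖ ≤ M₁ * Real.exp (σ₁ * s) := by
      intro s hs
      rcases le_total s 1 with h1 | h1
      · calc ‖u s‖ ≤ M₁ := (hM₀ s ⟨hs, h1⟩).trans (le_max_left _ _)
          _ ≤ M₁ * Real.exp (σ₁ * s) :=
            le_mul_of_one_le_right hM₁0 (Real.one_le_exp (by positivity))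
      · calc ‖u s‖ ≤ M * ‖u 0‖ * Real.exp (σ₁ * s) := (hg u hu h0 s h1).trans (le_of_eq (by ring))
          _ ≤ _ := by gcongr; exact le_max_right _ _
    set κ := (a - σ₁) / 2 with hκ
    have hκ0 : 0 < κ := by rw [hκ, hσ₁]; linarith
    set D := M₁ * (1 + 2 / (a - σ₁)) with hD
    have hwb : ∀ (c : ℝ) (φ : ℝ → ℝ), 0 ≤ c →
        (∀ s, 0 ≤ s → |φ s| ≤ c * ((1 + s) * Real.exp (-(a * s)))) →
        ∀ s, 0 ≤ s → ‖φ s • u s‖ ≤ c * D * Real.exp (-(κ * s)) := by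
      intro c φ hc hφ s hs
      have h1 := one_add_mul_exp_le (κ := a - σ₁) (by linarith) hs
      rw [norm_smul, Real.norm_eq_abs]
      calc |φ s| * ‖u s‖ ≤ c * ((1 + s) * Real.exp (-(a * s))) * (M₁ * Real.exp (σ₁ * s)) :=
            mul_le_mul (hφ s hs) (hub s hs) (norm_nonneg _) (by positivity)
        _ = c * M₁ * ((1 + s) * Real.exp (-((a - σ₁) * s))) := by
            rw [show -((a - σ₁) * s) = -(a * s) + σ₁ * s by ring, Real.exp_add]; ring
        _ ≤ c * M₁ * ((1 + 2 / (a - σ₁)) * Real.exp (-((a - σ₁) / 2 * s))) := by gcongr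
        _ = _ := by rw [hD, hκ]; ring
    set φ₁ : ℝ → ℝ → ℝ := fun b s => Real.exp (-a * s) * Real.cos (-b * s) with hφ₁
    set φ₂ : ℝ → ℝ → ℝ := fun b s => Real.exp (-a * s) * Real.sin (-b * s) with hφ₂
    have hφ₁c : ∀ b, Continuous (φ₁ b) := fun b => by fun_prop
    have hφ₂c : ∀ b, Continuous (φ₂ b) := fun b => by fun_prop
    have hφ₁d : ∀ b s, HasDerivAt (φ₁ b) (-a * φ₁ b s + b * φ₂ b s) s := fun b s =>
      (hasDerivAt_exp_mul_cos (-a) (-b) s).congr_deriv (by simp only [hφ₁, hφ₂]; ring)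
    have hφ₂d : ∀ b s, HasDerivAt (φ₂ b) (-a * φ₂ b s - b * φ₁ b s) s := fun b s =>
      (hasDerivAt_exp_mul_sin (-a) (-b) s).congr_deriv (by simp only [hφ₁, hφ₂]; ring)
    have hφ₁b : ∀ b s, |φ₁ b s| ≤ Real.exp (-(a * s)) := fun b s => by
      rw [← neg_mul]; exact abs_exp_mul_cos_le _ _
    have hφ₂b : ∀ b s, |φ₂ b s| ≤ Real.exp (-(a * s)) := fun b s => by
      rw [← neg_mul]; exact abs_exp_mul_sin_le _ _
    have hcomb : ∀ (b : ℝ) (x y z : ℝ) s, 0 ≤ s → |x| ≤ Real.exp (-(a * s)) →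
        |y| ≤ Real.exp (-(a * s)) → |z| ≤ Real.exp (-(a * s)) →
        |x + s * (-a * y + b * z)| ≤ (1 + a + |b|) * ((1 + s) * Real.exp (-(a * s))) := by
      intro b x y z s hs hx hy hz
      have e0 := Real.exp_pos (-(a * s))
      have h1 : |s * (-a * y + b * z)| ≤ s * (a * Real.exp (-(a * s)) + |b| * Real.exp (-(a * s))) := by
        rw [abs_mul, abs_of_nonneg hs]
        refine mul_le_mul_of_nonneg_left ((abs_add_le _ _).trans ?_) hs
        rw [abs_mul, abs_mul, abs_neg, abs_of_nonneg ha0]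
        gcongr
      have h2 := abs_add_le x (s * (-a * y + b * z))
      nlinarith [mul_nonneg hs e0.le, mul_nonneg ha0 e0.le, mul_nonneg (abs_nonneg b) e0.le]
    have hc0 : ∀ b, 0 ≤ 1 + a + |b| := fun b => by positivity
    have hle1 : ∀ b s, 0 ≤ s → Real.exp (-(a * s)) ≤
        (1 + a + |b|) * ((1 + s) * Real.exp (-(a * s))) := by
      intro b s hs
      have e0 := Real.exp_pos (-(a * s))
      nlinarith [mul_nonneg hs e0.le, mul_nonneg ha0 e0.le, mul_nonneg (abs_nonneg b) e0.le,
        mul_nonneg (mul_nonneg ha0 hs) e0.le, mul_nonneg (mul_nonneg (abs_nonneg b) hs) e0.le]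
    have hles : ∀ b s, 0 ≤ s → s * Real.exp (-(a * s)) ≤
        (1 + a + |b|) * ((1 + s) * Real.exp (-(a * s))) := by
      intro b s hs
      have e0 := Real.exp_pos (-(a * s))
      nlinarith [mul_nonneg hs e0.le, mul_nonneg ha0 e0.le, mul_nonneg (abs_nonneg b) e0.le,
        mul_nonneg (mul_nonneg ha0 hs) e0.le, mul_nonneg (mul_nonneg (abs_nonneg b) hs) e0.le]
    have hles' : ∀ b s x, 0 ≤ s → |x| ≤ Real.exp (-(a * s)) → |s * x| ≤
        (1 + a + |b|) * ((1 + s) * Real.exp (-(a * s))) := fun b s x hs hx => by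
      rw [abs_mul, abs_of_nonneg hs]
      exact (mul_le_mul_of_nonneg_left hx hs).trans (hles b s hs)
    have hcomb0 : ∀ (b : ℝ) (y z : ℝ) s, 0 ≤ s → |y| ≤ Real.exp (-(a * s)) →
        |z| ≤ Real.exp (-(a * s)) →
        |-a * y + b * z| ≤ (1 + a + |b|) * ((1 + s) * Real.exp (-(a * s))) := by
      intro b y z s hs hy hz
      have e0 := Real.exp_pos (-(a * s))
      have h1 : |-a * y + b * z| ≤ a * Real.exp (-(a * s)) + |b| * Real.exp (-(a * s)) := by
        refine (abs_add_le _ _).trans ?_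
        rw [abs_mul, abs_mul, abs_neg, abs_of_nonneg ha0]
        gcongr
      nlinarith [mul_nonneg hs e0.le, mul_nonneg ha0 e0.le, mul_nonneg (abs_nonneg b) e0.le,
        mul_nonneg (mul_nonneg ha0 hs) e0.le, mul_nonneg (mul_nonneg (abs_nonneg b) hs) e0.le]
    -- P₁ + iP₂ is the Laplace transform of u at λ = a + ib and P₃ + iP₄ that of s·u(s). The
    -- identities e1 to e4 say that these are (λ + B)⁻¹ and (λ + B)⁻² applied to u(0).
    set P₁ : ℝ → E₁ := fun b => ∫ s in Ioi 0, φ₁ b s • u s with hP₁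
    set P₂ : ℝ → E₁ := fun b => ∫ s in Ioi 0, φ₂ b s • u s with hP₂
    set P₃ : ℝ → E₁ := fun b => ∫ s in Ioi 0, (s * φ₁ b s) • u s with hP₃
    set P₄ : ℝ → E₁ := fun b => ∫ s in Ioi 0, (s * φ₂ b s) • u s with hP₄
    have b1 : ∀ b, ∀ s, 0 ≤ s → ‖φ₁ b s • u s‖ ≤ (1 + a + |b|) * D * Real.exp (-(κ * s)) := fun b =>
      hwb _ _ (hc0 b) fun s hs => (hφ₁b b s).trans (hle1 b s hs)
    have b2 : ∀ b, ∀ s, 0 ≤ s → ‖φ₂ b s • u s‖ ≤ (1 + a + |b|) * D * Real.exp (-(κ * s)) := fun b =>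
      hwb _ _ (hc0 b) fun s hs => (hφ₂b b s).trans (hle1 b s hs)
    have b3 : ∀ b, ∀ s, 0 ≤ s → ‖(s * φ₁ b s) • u s‖ ≤ (1 + a + |b|) * D * Real.exp (-(κ * s)) :=
      fun b => hwb _ (fun s => s * φ₁ b s) (hc0 b) fun s hs => hles' b s _ hs (hφ₁b b s)
    have b4 : ∀ b, ∀ s, 0 ≤ s → ‖(s * φ₂ b s) • u s‖ ≤ (1 + a + |b|) * D * Real.exp (-(κ * s)) :=
      fun b => hwb _ (fun s => s * φ₂ b s) (hc0 b) fun s hs => hles' b s _ hs (hφ₂b b s)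
    have i1 : ∀ b, IntegrableOn (fun s => φ₁ b s • u s) (Ioi 0) := fun b =>
      integrableOn_of_exp_bound ((hφ₁c b).continuousOn.smul hu.cont) hκ0 (b1 b)
    have i2 : ∀ b, IntegrableOn (fun s => φ₂ b s • u s) (Ioi 0) := fun b =>
      integrableOn_of_exp_bound ((hφ₂c b).continuousOn.smul hu.cont) hκ0 (b2 b)
    have i3 : ∀ b, IntegrableOn (fun s => (s * φ₁ b s) • u s) (Ioi 0) := fun b =>
      integrableOn_of_exp_bound ((continuous_id.mul (hφ₁c b)).continuousOn.smul hu.cont) hκ0 (b3 b)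
    have i4 : ∀ b, IntegrableOn (fun s => (s * φ₂ b s) • u s) (Ioi 0) := fun b =>
      integrableOn_of_exp_bound ((continuous_id.mul (hφ₂c b)).continuousOn.smul hu.cont) hκ0 (b4 b)
    have e1 : ∀ b, B (P₁ b) = j (u 0) + j (-a • P₁ b + b • P₂ b) := by
      intro b
      have h := hu.integral_eq (hφ₁c b) (by fun_prop) (hφ₁d b) hκ0 (b1 b)
        (hwb _ _ (hc0 b) fun s hs => hcomb0 b _ _ s hs (hφ₁b b s) (hφ₂b b s))
      have h2 : ∫ s in Ioi 0, (-a * φ₁ b s + b * φ₂ b s) • u s = -a • P₁ b + b • P₂ b := by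
        simp only [hP₁, hP₂]
        rw [← integral_smul_add_smul (i1 b) (i2 b)]
        congr 1; ext s; module
      rw [h2, show φ₁ b 0 = 1 by simp [hφ₁], one_smul] at h
      exact h
    have e2 : ∀ b, B (P₂ b) = j (-a • P₂ b + (-b) • P₁ b) := by
      intro b
      have h := hu.integral_eq (hφ₂c b) (φ' := fun s => -a * φ₂ b s + -b * φ₁ b s) (by fun_prop)
        (fun s => (hφ₂d b s).congr_deriv (by ring)) hκ0 (b2 b)
        (hwb _ _ (hc0 b) fun s hs => by
          have := hcomb0 (-b) _ _ s hs (hφ₂b b s) (hφ₁b b s)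
          rwa [abs_neg] at this)
      have h2 : ∫ s in Ioi 0, (-a * φ₂ b s + -b * φ₁ b s) • u s = -a • P₂ b + (-b) • P₁ b := by
        simp only [hP₁, hP₂]
        rw [← integral_smul_add_smul (i2 b) (i1 b)]
        congr 1; ext s; module
      rw [h2, show φ₂ b 0 = 0 by simp [hφ₂], zero_smul, zero_add] at h
      exact h
    have e3 : ∀ b, B (P₃ b) = j (P₁ b + (-a • P₃ b + b • P₄ b)) := by
      intro b
      have h := hu.integral_eq (φ := fun s => s * φ₁ b s)
        (φ' := fun s => φ₁ b s + s * (-a * φ₁ b s + b * φ₂ b s)) (by fun_prop) (by fun_prop)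
        (fun s => ((hasDerivAt_id' s).mul (hφ₁d b s)).congr_deriv (by ring)) hκ0 (b3 b)
        (hwb _ _ (hc0 b) fun s hs => hcomb b _ _ _ s hs (hφ₁b b s) (hφ₁b b s) (hφ₂b b s))
      have h2 : ∫ s in Ioi 0, (φ₁ b s + s * (-a * φ₁ b s + b * φ₂ b s)) • u s =
          P₁ b + (-a • P₃ b + b • P₄ b) := by
        simp only [hP₁, hP₃, hP₄]
        rw [← integral_add_smul_add_smul (i1 b) (i3 b) (i4 b)]
        congr 1; ext s; module
      rw [h2, zero_mul, zero_smul, zero_add] at h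
      exact h
    have e4 : ∀ b, B (P₄ b) = j (P₂ b + (-a • P₄ b + (-b) • P₃ b)) := by
      intro b
      have h := hu.integral_eq (φ := fun s => s * φ₂ b s)
        (φ' := fun s => φ₂ b s + s * (-a * φ₂ b s + -b * φ₁ b s)) (by fun_prop) (by fun_prop)
        (fun s => ((hasDerivAt_id' s).mul (hφ₂d b s)).congr_deriv (by ring)) hκ0 (b4 b)
        (hwb _ _ (hc0 b) fun s hs => by
          have := hcomb (-b) _ _ _ s hs (hφ₂b b s) (hφ₂b b s) (hφ₁b b s)
          rwa [abs_neg] at this)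
      have h2 : ∫ s in Ioi 0, (φ₂ b s + s * (-a * φ₂ b s + -b * φ₁ b s)) • u s =
          P₂ b + (-a • P₄ b + (-b) • P₃ b) := by
        simp only [hP₂, hP₃, hP₄]
        rw [← integral_add_smul_add_smul (i2 b) (i4 b) (i3 b)]
        congr 1; ext s; module
      rw [h2, zero_mul, zero_smul, zero_add] at h
      exact h
    have hstab : ∀ φ : ℝ → ℝ, IntegrableOn (fun s => φ s • u s) (Ioi 0) →
        Pr (j (∫ s in Ioi 0, φ s • u s)) = 0 := by
      intro φ hi
      rw [← j.integral_comp_comm hi, ← Pr.integral_comp_comm (j.integrable_comp hi)]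
      refine setIntegral_eq_zero_of_forall_eq_zero fun s hs => ?_
      rw [map_smul, map_smul, hu.stable hμ hPr h0 (le_of_lt hs), smul_zero]
    have r1 : ∀ b, (1 + |b|) * max ‖j (P₁ b)‖ ‖j (P₂ b)‖ ≤ K * ‖j (u 0)‖ := by
      intro b
      have h := hres a b ha0 (P₁ b, P₂ b) (hstab _ (i1 b)) (hstab _ (i2 b))
      have h2 : resolventMap j B a b (P₁ b, P₂ b) = (j (u 0), 0) := by
        rw [resolventMap_apply, e1, e2]
        refine Prod.ext ?_ ?_ <;> simp only [map_add, map_smul] <;> module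
      rwa [h2, Prod.norm_mk, norm_zero, max_eq_left (norm_nonneg _)] at h
    have r2 : ∀ b, (1 + |b|) * max ‖j (P₃ b)‖ ‖j (P₄ b)‖ ≤ K * max ‖j (P₁ b)‖ ‖j (P₂ b)‖ := by
      intro b
      have h := hres a b ha0 (P₃ b, P₄ b) (hstab _ (i3 b)) (hstab _ (i4 b))
      have h2 : resolventMap j B a b (P₃ b, P₄ b) = (j (P₁ b), j (P₂ b)) := by
        rw [resolventMap_apply, e3, e4]
        refine Prod.ext ?_ ?_ <;> simp only [map_add, map_smul] <;> module
      rwa [h2, Prod.norm_mk] at h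
    -- One resolvent decays like 1/(1 + |b|), which is not integrable; the square is. This is the
    -- reason for the factor t in the estimate. The substitution b = 2πs fits the normalisation of
    -- the Fourier transform.
    have r3 : ∀ s : ℝ, max ‖j (P₃ (2 * Real.pi * s))‖ ‖j (P₄ (2 * Real.pi * s))‖ ≤
        K ^ 2 * ‖j (u 0)‖ * (1 + s ^ 2)⁻¹ := by
      intro s
      set b := 2 * Real.pi * s with hb
      have h1 := r1 b
      have h2 := r2 b
      have h3 : 1 + s ^ 2 ≤ (1 + |b|) ^ 2 := by
        have : |s| ≤ |b| := by
          rw [hb, abs_mul]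
          refine le_mul_of_one_le_left (abs_nonneg s) ?_
          rw [abs_of_pos (by positivity)]
          linarith [Real.pi_gt_three]
        nlinarith [abs_nonneg s, sq_abs s]
      have hm : 0 ≤ max ‖j (P₃ b)‖ ‖j (P₄ b)‖ := (norm_nonneg _).trans (le_max_left _ _)
      rw [← div_eq_mul_inv, le_div_iff₀ (by positivity)]
      calc max ‖j (P₃ b)‖ ‖j (P₄ b)‖ * (1 + s ^ 2)
          ≤ max ‖j (P₃ b)‖ ‖j (P₄ b)‖ * (1 + |b|) ^ 2 := by gcongr
        _ = (1 + |b|) * ((1 + |b|) * max ‖j (P₃ b)‖ ‖j (P₄ b)‖) := by ring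
        _ ≤ (1 + |b|) * (K * max ‖j (P₁ b)‖ ‖j (P₂ b)‖) := by gcongr
        _ = K * ((1 + |b|) * max ‖j (P₁ b)‖ ‖j (P₂ b)‖) := by ring
        _ ≤ K * (K * ‖j (u 0)‖) := by gcongr
        _ = _ := by ring
    -- Scalar Fourier inversion is applied to ℓ(s e^{-as}u(s)), extended by 0 to negative s; the
    -- factor s makes the extension continuous. The norm is then recovered from the functionals.
    have hdual : ∀ ℓ : StrongDual ℝ E₀, ‖ℓ (t • Real.exp (-a * t) • j (u t))‖ ≤
        2 * K ^ 2 * Real.pi * ‖j (u 0)‖ * ‖ℓ‖ := by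
      intro ℓ
      set f : ℝ → ℝ := fun s => max s 0 * (Real.exp (-a * max s 0) * ℓ (j (u (max s 0)))) with hf
      have hucont : Continuous fun s : ℝ => u (max s 0) :=
        hu.cont.comp_continuous (by fun_prop) fun s => le_max_right s 0
      have hfc : Continuous f := by
        have h1 : Continuous fun s : ℝ => ℓ (j (u (max s 0))) :=
          ℓ.continuous.comp (j.continuous.comp hucont)
        have h2 : Continuous fun s : ℝ => Real.exp (-a * max s 0) := by fun_prop
        exact (continuous_id.max continuous_const).mul (h2.mul h1)
      have hfpos : ∀ s ∈ Ioi (0 : ℝ), f s = ℓ (j ((s * Real.exp (-a * s)) • u s)) := fun s hs => by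
        rw [hf]
        simp only [max_eq_left (le_of_lt (mem_Ioi.1 hs)), map_smul, smul_eq_mul]
        ring
      have hfneg : ∀ s ∉ Ioi (0 : ℝ), f s = 0 := fun s hs => by
        rw [hf]
        simp only [max_eq_right (not_lt.1 (fun h => hs (mem_Ioi.2 h)) : s ≤ 0), zero_mul]
      have i0 : IntegrableOn (fun s => (s * Real.exp (-a * s)) • u s) (Ioi 0) := by
        have := i3 0
        simpa only [hφ₁, neg_zero, zero_mul, Real.cos_zero, mul_one] using this
      have hfi : Integrable f := by
        have h1 : IntegrableOn f (Ioi 0) := by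
          refine (integrableOn_congr_fun hfpos measurableSet_Ioi).2 ?_
          exact ℓ.integrable_comp (j.integrable_comp i0)
        exact (integrableOn_iff_integrable_of_support_subset
          (Function.support_subset_iff'.2 hfneg)).1 h1
      have hcos : ∀ s : ℝ, ∫ r, Real.cos (2 * Real.pi * s * r) * f r =
          ℓ (j (P₃ (2 * Real.pi * s))) := by
        intro s
        rw [← j.integral_comp_comm (i3 _), ← ℓ.integral_comp_comm (j.integrable_comp (i3 _)),
          ← setIntegral_eq_integral_of_forall_compl_eq_zero (s := Ioi 0)
            (fun r hr => by rw [hfneg r hr, mul_zero])]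
        refine setIntegral_congr_fun measurableSet_Ioi fun r hr => ?_
        rw [hfpos r hr]
        simp only [hφ₁, map_smul, smul_eq_mul, neg_mul, Real.cos_neg]
        ring
      have hsin : ∀ s : ℝ, ∫ r, Real.sin (2 * Real.pi * s * r) * f r =
          -ℓ (j (P₄ (2 * Real.pi * s))) := by
        intro s
        rw [← j.integral_comp_comm (i4 _), ← ℓ.integral_comp_comm (j.integrable_comp (i4 _)),
          ← setIntegral_eq_integral_of_forall_compl_eq_zero (s := Ioi 0)
            (fun r hr => by rw [hfneg r hr, mul_zero]), ← integral_neg]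
        refine setIntegral_congr_fun measurableSet_Ioi fun r hr => ?_
        rw [hfpos r hr]
        simp only [hφ₂, map_smul, smul_eq_mul, neg_mul, Real.sin_neg]
        ring
      have hℓ : ∀ (x : E₀) (s : ℝ), ‖x‖ ≤ K ^ 2 * ‖j (u 0)‖ * (1 + s ^ 2)⁻¹ →
          |ℓ x| ≤ ‖ℓ‖ * (K ^ 2 * ‖j (u 0)‖) * (1 + s ^ 2)⁻¹ := fun x s hx => by
        rw [← Real.norm_eq_abs, mul_assoc]
        exact ℓ.le_opNorm_of_le hx
      have h := abs_le_of_trigIntegral_le hfc hfi (K := ‖ℓ‖ * (K ^ 2 * ‖j (u 0)‖))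
        (fun s => by rw [hcos]; exact hℓ _ s ((le_max_left _ _).trans (r3 s)))
        (fun s => by rw [hsin, abs_neg]; exact hℓ _ s ((le_max_right _ _).trans (r3 s))) t
      have hft : f t = ℓ (t • Real.exp (-a * t) • j (u t)) := by
        rw [hf]
        simp only [max_eq_left ht, map_smul, smul_eq_mul]
      rw [← hft, Real.norm_eq_abs]
      exact h.trans (le_of_eq (by ring))
    have h := NormedSpace.norm_le_dual_bound ℝ (t • Real.exp (-a * t) • j (u t))
      (by positivity) hdual
    rw [norm_smul, norm_smul, Real.norm_of_nonneg ht, Real.norm_of_nonneg (Real.exp_pos _).le] at h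
    calc t * ‖j (u t)‖ = t * (Real.exp (-a * t) * ‖j (u t)‖) * Real.exp (a * t) := by
          rw [show t * (Real.exp (-a * t) * ‖j (u t)‖) * Real.exp (a * t) =
            t * ‖j (u t)‖ * (Real.exp (-a * t) * Real.exp (a * t)) by ring, ← Real.exp_add]
          simp
      _ ≤ _ := by gcongr
  have hlim : Tendsto (fun a => 2 * K ^ 2 * Real.pi * ‖j (u 0)‖ * Real.exp (a * t)) (𝓝[>] σ)
      (𝓝 (2 * K ^ 2 * Real.pi * ‖j (u 0)‖ * Real.exp (σ * t))) := by
    refine Tendsto.mono_left (Continuous.tendsto ?_ σ) nhdsWithin_le_nhds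
    fun_prop
  refine ge_of_tendsto hlim ?_
  filter_upwards [self_mem_nhdsWithin] with a ha using key a ha

/-- The E₀-bound with its factor 1/t is turned into an E₁-bound one time unit later by parabolic
smoothing. For t large this beats e^{σN} by a factor 1/2 at N = t + 1, which is a rate lower by log
2/N. -/
theorem exists_growth_lt (hμ : μ ∈ Ioo (0 : ℝ) 1) (hT : 0 < T) (hC : 0 < C)
    (hA : APriori j μ B T C) {Pr : E₀ →L[ℝ] E₁} (hPr : IsCenterProj j B Pr)
    (hspec : complexSpectrum j (-B) \ {0} ⊆ {z : ℂ | z.re < 0}) {σ : ℝ} (hσ : 0 ≤ σ)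
    (hgr : ∀ σ', σ < σ' → Growth j B Pr σ') : ∃ τ < σ, Growth j B Pr τ := by
  obtain ⟨K, hK, hres⟩ := exists_resolvent_decay hμ hT hC hA hPr hspec
  obtain ⟨C', hC', hA'⟩ := hA.exists_long hμ hT hC 1
  set D := 2 * K ^ 2 * Real.pi * ‖j‖ with hD
  have hD0 : 0 ≤ D := by positivity
  set t := 1 + 2 * C' * D with ht
  have ht1 : 1 ≤ t := by rw [ht]; linarith [mul_nonneg hC'.le hD0]
  have ht0 : 0 < t := by linarith
  have hCD : C' * D / t ≤ 1 / 2 := by rw [div_le_div_iff₀ ht0 two_pos]; linarith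
  set N := t + 1 with hN
  have hN0 : 0 < N := by linarith
  refine ⟨σ - Real.log 2 / N, by linarith [div_pos (Real.log_pos one_lt_two) hN0],
    growth_of_step hμ hT hC hA hPr (N := N) (by linarith) fun u hu h0 => ?_⟩
  have hexp : Real.exp ((σ - Real.log 2 / N) * N) = Real.exp (σ * N) / 2 := by
    rw [sub_mul, div_mul_cancel₀ _ hN0.ne', Real.exp_sub, Real.exp_log two_pos]
  -- The function s·u(t + s) starts at 0 and has u(t + s) as inhomogeneity, so the a priori estimate
  -- at s = 1 bounds u(t + 1) in E₁ by the E₀-norms in between.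
  have hv := ((hu.shift ht0.le).traj hμ.2 one_pos).smul_fun one_pos continuous_id continuous_const
    hasDerivAt_id
  have h1 := (hA' 1 _ _ _ (D * Real.exp (σ * N) * ‖u 0‖ / t) one_pos le_rfl hv
    (by rw [id, zero_smul]; exact (contInterp j μ).zero_mem) (fun s hs => by
      have e : (1 : ℝ) • j (u (t + s)) + id s • -B (u (t + s)) + B (id s • u (t + s)) =
          j (u (t + s)) := by rw [map_smul, one_smul, smul_neg]; abel
      rw [e]
      have h2 := exists_norm_le_exp_div hμ hPr hK hres hσ hgr hu h0 (t := t + s)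
        (by linarith [hs.1])
      have h3 : s ^ (1 - μ) ≤ 1 := Real.rpow_le_one hs.1.le hs.2 (by linarith [hμ.2])
      have h4 : ‖j (u (t + s))‖ ≤ D * Real.exp (σ * N) * ‖u 0‖ / t := by
        rw [le_div_iff₀ ht0]
        calc ‖j (u (t + s))‖ * t ≤ (t + s) * ‖j (u (t + s))‖ := by
              rw [mul_comm]; gcongr; linarith [hs.1]
          _ ≤ 2 * K ^ 2 * Real.pi * ‖j (u 0)‖ * Real.exp (σ * (t + s)) := h2
          _ ≤ 2 * K ^ 2 * Real.pi * (‖j‖ * ‖u 0‖) * Real.exp (σ * N) := by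
              gcongr
              · exact j.le_opNorm _
              · linarith [hs.2]
          _ = _ := by rw [hD]; ring
      exact (mul_le_of_le_one_left (norm_nonneg _) h3).trans h4) 1 ⟨one_pos, le_rfl⟩).1
  rw [id, id, zero_smul, one_smul, interpNorm_zero, add_zero, Real.one_rpow, one_mul] at h1
  rw [hexp]
  calc ‖u N‖ ≤ C' * (D * Real.exp (σ * N) * ‖u 0‖ / t) := h1
    _ = C' * D / t * (Real.exp (σ * N) * ‖u 0‖) := by ring
    _ ≤ 1 / 2 * (Real.exp (σ * N) * ‖u 0‖) := by gcongr
    _ = _ := by ring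

/-- If no negative rate were admissible, the infimum of the rates would be nonnegative, and all
rates above it admissible. The previous lemma would then produce an admissible rate below the
infimum. -/
theorem exists_growth_neg (hμ : μ ∈ Ioo (0 : ℝ) 1) (hT : 0 < T) (hC : 0 < C)
    (hA : APriori j μ B T C) {Pr : E₀ →L[ℝ] E₁} (hPr : IsCenterProj j B Pr)
    (hspec : complexSpectrum j (-B) \ {0} ⊆ {z : ℂ | z.re < 0}) : ∃ σ < 0, Growth j B Pr σ := by
  by_contra! hcon
  obtain ⟨σ₀, hσ₀⟩ := exists_growth hμ hT hC hA hPr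
  have hbdd : BddBelow {σ | Growth j B Pr σ} :=
    ⟨0, fun σ hσ => not_lt.1 fun h => hcon σ h hσ⟩
  have hinf : 0 ≤ sInf {σ | Growth j B Pr σ} :=
    le_csInf ⟨σ₀, hσ₀⟩ fun σ hσ => not_lt.1 fun h => hcon σ h hσ
  obtain ⟨τ, hτ, hg⟩ := exists_growth_lt hμ hT hC hA hPr hspec hinf fun σ' h => by
    obtain ⟨σ, hσ, hlt⟩ := exists_lt_of_csInf_lt ⟨σ₀, hσ₀⟩ h
    exact Growth.mono hσ hlt.le
  exact absurd (csInf_le hbdd hg) (not_le.2 hτ)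

/-- Solutions of the linear equation with data in the stable subspace contract eventually. -/
theorem exists_contraction (hμ : μ ∈ Ioo (0 : ℝ) 1) (hT : 0 < T) (hC : 0 < C)
    (hA : APriori j μ B T C) {Pr : E₀ →L[ℝ] E₁} (hPr : IsCenterProj j B Pr)
    (hspec : complexSpectrum j (-B) \ {0} ⊆ {z : ℂ | z.re < 0}) {κ : ℝ} (hκ : 0 < κ) :
    ∃ H, 0 < H ∧ ∀ u y, HomSol j μ B u (j y) → Pr (j y) = 0 → ‖u H‖ ≤ κ * ‖y‖ := by
  obtain ⟨σ, hσ, M, hM, hg⟩ := exists_growth_neg hμ hT hC hA hPr hspec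
  obtain ⟨C', hC', hA'⟩ := hA.exists_long hμ hT hC 1
  have hlim : Tendsto (fun t : ℝ => M * Real.exp (σ * t) * (C' * (1 + ‖j‖))) atTop (𝓝 0) := by
    have h1 : Tendsto (fun t : ℝ => Real.exp (σ * t)) atTop (𝓝 0) :=
      Real.tendsto_exp_atBot.comp (tendsto_id.const_mul_atTop_of_neg hσ)
    simpa using (h1.const_mul M).mul_const (C' * (1 + ‖j‖))
  obtain ⟨t, ht, ht1⟩ := ((hlim.eventually (gt_mem_nhds hκ)).and (eventually_ge_atTop 1)).exists
  -- The first time unit makes the solution continuous in E₁, as the growth bound requires; the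
  -- decay acts during the remaining time t.
  refine ⟨1 + t, by linarith, fun u y hu hy => ?_⟩
  have htr := hu 1 one_pos
  have h1 : ‖u 1‖ ≤ C' * (1 + ‖j‖) * ‖y‖ := by
    have h2 := (hA' 1 _ _ _ 0 one_pos le_rfl htr (embed_mem j hμ y)
      (fun s _ => by rw [neg_add_cancel, norm_zero, mul_zero]) 1 ⟨one_pos, le_rfl⟩).1
    rw [Real.one_rpow, one_mul, zero_add] at h2
    calc ‖u 1‖ ≤ C' * ((1 + ‖j‖) * ‖y‖) := h2.trans (by gcongr; exact interpNorm_embed_le j hμ y)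
      _ = _ := by ring
  have h3 : Pr (j (u 1)) = 0 := by
    rw [← hy]
    exact htr.map_eq_of_deriv_zero hμ.1 Pr
      (fun s _ => by rw [map_neg, hPr.proj_map, neg_zero]) ⟨one_pos, le_rfl⟩
  have h4 := hg _ (hu.regSol one_pos) (by simpa using h3) t ht1
  simp only [add_zero] at h4
  calc ‖u (1 + t)‖ ≤ M * Real.exp (σ * t) * ‖u 1‖ := h4
    _ ≤ M * Real.exp (σ * t) * (C' * (1 + ‖j‖) * ‖y‖) := by gcongr
    _ = M * Real.exp (σ * t) * (C' * (1 + ‖j‖)) * ‖y‖ := by ring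
    _ ≤ κ * ‖y‖ := by gcongr

end Decay

section Stability

variable {E₀ E₁ : Type*} [NormedAddCommGroup E₀] [NormedSpace ℝ E₀] [CompleteSpace E₀]
  [NormedAddCommGroup E₁] [NormedSpace ℝ E₁] [CompleteSpace E₁]
variable {j B : E₁ →L[ℝ] E₀} {μ T C : ℝ}

/-! ### Decay towards an equilibrium -/

/-- Decompose z = (z - u - k) + u + k, with k the stationary center part of y and u the homogeneous
solution starting at y - k. The first part has zero initial value and the full inhomogeneity, the
second contracts. -/
theorem exists_contraction_inhomogeneous (hμ : μ ∈ Ioo (0 : ℝ) 1) (hT : 0 < T) (hC : 0 < C)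
    (hA : APriori j μ B T C) {Pr : E₀ →L[ℝ] E₁} (hPr : IsCenterProj j B Pr)
    (hspec : complexSpectrum j (-B) \ {0} ⊆ {z : ℂ | z.re < 0})
    (hex : ∀ y, ∃ u, HomSol j μ B u (j y)) :
    ∃ H K, 0 < H ∧ 0 < K ∧ ∀ z z' y M, Traj j μ H z z' (j y) →
      (∀ t ∈ Ioc 0 H, t ^ (1 - μ) * ‖z' t + B (z t)‖ ≤ M) →
      ‖z H‖ ≤ 1 / 8 * ‖y‖ + 2 * ‖Pr (j y)‖ + K * M := by
  obtain ⟨H, hH, hcontr⟩ := exists_contraction hμ hT hC hA hPr hspec (κ := 1 / 8) (by norm_num)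
  obtain ⟨C', hC', hA'⟩ := hA.exists_long hμ hT hC H
  have hHp : 0 < H ^ (1 - μ) := Real.rpow_pos_of_pos hH _
  refine ⟨H, C' / H ^ (1 - μ), hH, by positivity, fun z z' y M hz hM => ?_⟩
  set k := Pr (j y) with hk
  obtain ⟨u, hu⟩ := hex (y - k)
  have h1 := hcontr u (y - k) hu (by rw [map_sub, map_sub, hk, hPr.idem, sub_self])
  have htr := (hz.sub hH (hu H hH)).sub hH (Traj.const hμ.2 hH k)
  have hinit : j y - j (y - k) - j k = 0 := by rw [map_sub]; abel
  rw [hinit] at htr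
  have h2 := (hA' H _ _ _ M hH le_rfl htr (contInterp j μ).zero_mem (fun t ht => by
    have : z' t - -B (u t) - 0 + B (z t - u t - k) = z' t + B (z t) := by
      rw [map_sub, map_sub, hk, hPr.map_proj]; abel
    rw [this]
    exact hM t ht) H ⟨hH, le_rfl⟩).1
  rw [interpNorm_zero, add_zero] at h2
  have h3 : ‖z H - u H - k‖ ≤ C' / H ^ (1 - μ) * M := by
    rw [div_mul_eq_mul_div, le_div_iff₀ hHp, mul_comm]; exact h2
  have h4 : ‖z H‖ ≤ ‖z H - u H - k‖ + ‖u H‖ + ‖k‖ := by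
    have : z H = (z H - u H - k) + u H + k := by abel
    calc ‖z H‖ = ‖(z H - u H - k) + u H + k‖ := by rw [← this]
      _ ≤ _ := norm_add₃_le
  linarith [norm_sub_le y k, norm_nonneg k]

/-- Integrating the center component backwards from a time at which it vanishes. -/
theorem norm_proj_le_of_exp_bound {v : ℝ → E₁} {v' : ℝ → E₀} {Pr : E₀ →L[ℝ] E₁} {ω D a b : ℝ}
    (hω : 0 < ω) (hab : a ≤ b) (hc : ContinuousOn (fun t => j (v t)) (Icc a b))
    (hd : ∀ t ∈ Ico a b, HasDerivAt (fun s => j (v s)) (v' t) t)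
    (hb : ∀ t ∈ Ico a b, ‖Pr (v' t)‖ ≤ D * Real.exp (-(ω * t))) (h0 : Pr (j (v b)) = 0)
    (hD : 0 ≤ D) : ‖Pr (j (v a))‖ ≤ D / ω * Real.exp (-(ω * a)) := by
  have h1 : ‖Pr (j (v b)) - Pr (j (v a))‖ ≤
      D / ω * (Real.exp (-(ω * a)) - Real.exp (-(ω * b))) := by
    refine image_norm_le_of_norm_deriv_right_le_deriv_boundary'
      (f := fun r => Pr (j (v r)) - Pr (j (v a))) (f' := fun r => Pr (v' r))
      (B := fun r => D / ω * (Real.exp (-(ω * a)) - Real.exp (-(ω * r))))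
      (B' := fun r => D * Real.exp (-(ω * r))) (a := a) (b := b) ?_ ?_ ?_ ?_ ?_ ?_ ⟨hab, le_rfl⟩
    · exact (Pr.continuous.comp_continuousOn hc).sub continuousOn_const
    · exact fun r hr => ((Pr.hasFDerivAt.comp_hasDerivAt r (hd r hr)).sub_const _).hasDerivWithinAt
    · simp
    · fun_prop
    · intro r _
      have h2 := (((hasDerivAt_id' r).const_mul ω).neg.exp.const_sub (Real.exp (-(ω * a)))).const_mul
        (D / ω)
      exact (h2.congr_deriv (by simp only [Pi.neg_apply]; field_simp)).hasDerivWithinAt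
    · exact fun r hr => hb r hr
  rw [h0, zero_sub, norm_neg] at h1
  refine h1.trans ?_
  gcongr
  linarith [Real.exp_pos (-(ω * b))]

set_option maxHeartbeats 1600000 in
/-- Solutions that stay near `w` decay exponentially towards an equilibrium, with a rate and with
constants that do not depend on the length of the interval. -/
theorem exists_decay_estimate (hμ : μ ∈ Ioo (0 : ℝ) 1) (hT : 0 < T) (hC : 0 < C)
    (hA : APriori j μ B T C) {Pr : E₀ →L[ℝ] E₁} (hPr : IsCenterProj j B Pr)
    (hspec : complexSpectrum j (-B) \ {0} ⊆ {z : ℂ | z.re < 0})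
    (hex : ∀ y, ∃ u, HomSol j μ B u (j y)) {N : E₁ → E₀} {w : E₁}
    (hN : HasStrictFDerivAt N B w) {Q : Set E₁} (hQ : ∀ e ∈ Q, N e = 0) {ρ C₁ : ℝ} (hρ : 0 < ρ)
    (hC₁ : 0 < C₁) (hgraph : ∀ k, B k = 0 → ‖k‖ ≤ ρ →
      ∃ e ∈ Q, Pr (j (e - w)) = k ∧ ‖e - w‖ ≤ C₁ * ‖k‖) :
    ∃ H ω : ℝ, 0 < H ∧ 0 < ω ∧ ∀ c, 0 < c → 2 * c ≤ H → ∃ r K : ℝ, 0 < r ∧ 0 < K ∧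
      ∀ (R a : ℝ) (u : ℝ → E₁) (x : E₀), 2 * c ≤ R → Traj j μ R u (fun t => -N (u t)) x →
        (∀ t ∈ Icc c (2 * c), ‖u t - w‖ ≤ a) → (∀ t ∈ Icc c R, ‖u t - w‖ ≤ r) →
        ∃ e ∈ Q, ‖e - w‖ ≤ K * a ∧ ∀ t ∈ Icc c R, ‖u t - e‖ ≤ K * a * Real.exp (-(ω * t)) := by
  obtain ⟨H, K₁, hH, hK₁, hcontr⟩ := exists_contraction_inhomogeneous hμ hT hC hA hPr hspec hex
  obtain ⟨C₂, hC₂, hA₂⟩ := hA.exists_long hμ hT hC H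
  -- With e^{ωH} = 2 the contraction factor 1/8 over one step becomes 1/4 in the weighted norm,
  -- which leaves room for the errors.
  set ω := Real.log 2 / H with hω
  have hω0 : 0 < ω := div_pos (Real.log_pos one_lt_two) hH
  have hωH : Real.exp (ω * H) = 2 := by
    rw [hω, div_mul_cancel₀ _ hH.ne', Real.exp_log two_pos]
  refine ⟨H, ω, hH, hω0, fun c hc hcH => ?_⟩
  set J := 1 + ‖j‖ with hJ
  have hJ1 : 1 ≤ J := by rw [hJ]; linarith [norm_nonneg j]
  set p := 1 + ‖Pr‖ with hp
  have hp1 : 1 ≤ p := by rw [hp]; linarith [norm_nonneg Pr]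
  have hPj : ∀ y : E₁, ‖Pr (j y)‖ ≤ p * J * ‖y‖ := fun y => by
    calc ‖Pr (j y)‖ ≤ ‖Pr‖ * (‖j‖ * ‖y‖) := Pr.le_opNorm_of_le (j.le_opNorm y)
      _ ≤ p * (J * ‖y‖) := by gcongr <;> linarith
      _ = _ := by ring
  set Hp := H ^ (1 - μ) with hHp
  have hHp0 : 0 < Hp := Real.rpow_pos_of_pos hH _
  set cp := c ^ (1 - μ) with hcp
  have hcp0 : 0 < cp := Real.rpow_pos_of_pos hc _
  set G := 2 + 4 * C₂ * J / cp with hG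
  have hG0 : 0 < G := by positivity
  -- m collects all coefficients of the errors of size ηD that occur below; η is chosen so that
  -- together they amount to D/4.
  set m := G * C₁ * (p / ω) + 4 * C₂ * Hp / cp + 4 * (p / ω) + 2 * K₁ * Hp with hm
  have hm0 : 0 < m := by positivity
  set η := 1 / (4 * m) with hη
  have hη0 : 0 < η := by positivity
  have hηm : η * m = 1 / 4 := by rw [hη]; field_simp
  obtain ⟨s, hs, hlip⟩ : ∃ s > 0, ∀ x y, ‖x - w‖ ≤ s → ‖y - w‖ ≤ s →
      ‖N x - N y - B (x - y)‖ ≤ η * ‖x - y‖ := by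
    have h1 := hN.isLittleO.bound hη0
    obtain ⟨s, hs, h2⟩ := Metric.eventually_nhds_iff.1 h1
    refine ⟨s / 2, half_pos hs, fun x y hx hy => h2 (y := (x, y)) ?_⟩
    rw [Prod.dist_eq, dist_eq_norm, dist_eq_norm]
    exact max_lt (by linarith) (by linarith)
  set r := min (min s (s / (C₁ * (p * J)))) (ρ / (p * J)) with hr
  have hr0 : 0 < r := by positivity
  set K₂ := 2 * (G * (1 + C₁ * (p * J))) with hK₂
  refine ⟨r, K₂ + (C₁ * (p * J) + C₁ * (p / ω) * η * K₂), hr0, by positivity,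
    fun R a u x hcR hu hua hur => ?_⟩
  have hpJ : 0 < p * J := by positivity
  have hrs : r ≤ s := (min_le_left _ _).trans (min_le_left _ _)
  have hrs' : C₁ * (p * J * r) ≤ s := by
    have h1 : r ≤ s / (C₁ * (p * J)) := (min_le_left _ _).trans (min_le_right _ _)
    rw [le_div_iff₀ (by positivity)] at h1
    linarith
  have hrρ : p * J * r ≤ ρ := by
    have h1 : r ≤ ρ / (p * J) := min_le_right _ _
    rw [le_div_iff₀ hpJ] at h1
    linarith
  have ha0 : 0 ≤ a := (norm_nonneg _).trans (hua c ⟨le_rfl, by linarith⟩)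
  have hR0 : 0 < R := by linarith
  have hcRle : c ≤ R := by linarith
  have hkR : ‖Pr (j (u R - w))‖ ≤ p * J * r :=
    (hPj _).trans (mul_le_mul_of_nonneg_left (hur R ⟨hcRle, le_rfl⟩) hpJ.le)
  -- The reference equilibrium has the center component of the solution at the final time R, so the
  -- center component of v = u - e vanishes at R and can be integrated backwards.
  obtain ⟨e, heQ, hek, hew⟩ := hgraph _ (hPr.map_proj (j (u R - w))) (hkR.trans hrρ)
  have hes : ‖e - w‖ ≤ s := (hew.trans (by gcongr)).trans hrs'
  set v : ℝ → E₁ := fun t => u t - e with hv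
  have hvtr : Traj j μ R v (fun t => -N (u t) - 0) (x - j e) :=
    hu.sub hR0 (Traj.const hμ.2 hR0 e)
  set f : ℝ → E₀ := fun t => -N (u t) - 0 + B (v t) with hf
  have hfb : ∀ t ∈ Icc c R, ‖f t‖ ≤ η * ‖v t‖ := by
    intro t ht
    have h1 := hlip (u t) e ((hur t ht).trans hrs) hes
    rw [hQ e heQ, ← norm_neg] at h1
    have h2 : f t = -(N (u t) - 0 - B (u t - e)) := by simp only [hf, hv]; abel
    rw [h2]
    exact h1
  have hvR : Pr (j (v R)) = 0 := by
    have : v R = (u R - w) - (e - w) := by simp only [hv]; abel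
    rw [this, map_sub, map_sub, hek, sub_self]
  have hPv' : ∀ t, Pr (-N (u t) - 0) = Pr (f t) := fun t => by
    rw [hf]; simp only [map_add, hPr.proj_map, add_zero]
  set q : ℝ → ℝ := fun t => Real.exp (ω * t) * ‖v t‖ with hq
  have hvq : ∀ t, ‖v t‖ = q t * Real.exp (-(ω * t)) := fun t => by
    rw [hq]; simp only
    rw [mul_comm (Real.exp _), mul_assoc, ← Real.exp_add]; simp
  -- Pr annihilates Bv, so the center component is driven by f alone, and f inherits the decay of v
  -- with the small factor η. The bound does not involve R.
  have hcenter : ∀ D, 0 ≤ D → (∀ t ∈ Icc c R, q t ≤ D) → ∀ t ∈ Icc c R,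
      ‖Pr (j (v t))‖ ≤ p / ω * η * D * Real.exp (-(ω * t)) := by
    intro D hD hqD t ht
    have h1 := norm_proj_le_of_exp_bound (j := j) (v := v) (v' := fun t => -N (u t) - 0) (Pr := Pr)
      (ω := ω) (D := p * (η * D)) (a := t) (b := R) hω0 ht.2
      ((j.continuous.comp_continuousOn hvtr.memU.1).mono fun y hy =>
        ⟨hc.trans_le (ht.1.trans hy.1), hy.2⟩)
      (fun y hy => hvtr.hasDerivAt ⟨hc.trans_le (ht.1.trans hy.1), hy.2⟩)
      (fun y hy => by
        have hy' : y ∈ Icc c R := ⟨ht.1.trans hy.1, hy.2.le⟩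
        rw [hPv']
        calc ‖Pr (f y)‖ ≤ ‖Pr‖ * (η * ‖v y‖) := Pr.le_opNorm_of_le (hfb y hy')
          _ ≤ p * (η * (D * Real.exp (-(ω * y)))) := by
              rw [hvq]
              gcongr
              · linarith
              · exact hqD y hy'
          _ = _ := by ring)
      hvR (by positivity)
    exact h1.trans (le_of_eq (by ring))
  have hexp1 : ∀ t, c ≤ t → Real.exp (-(ω * t)) ≤ 1 := fun t ht =>
    Real.exp_le_one_iff.2 (by nlinarith)
  have hedist : ∀ D, 0 ≤ D → (∀ t ∈ Icc c R, q t ≤ D) →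
      ‖e - w‖ ≤ C₁ * (p * J) * a + C₁ * (p / ω) * η * D := by
    intro D hD hqD
    have h1 := hcenter D hD hqD c ⟨le_rfl, hcRle⟩
    have h2 : Pr (j (e - w)) = Pr (j (u c - w)) - Pr (j (v c)) := by
      rw [← map_sub, ← map_sub]; congr 2; simp only [hv]; abel
    have h3 : ‖Pr (j (u c - w))‖ ≤ p * J * a :=
      (hPj _).trans (mul_le_mul_of_nonneg_left (hua c ⟨le_rfl, by linarith⟩) hpJ.le)
    have h4 : ‖Pr (j (v c))‖ ≤ p / ω * η * D :=
      h1.trans (mul_le_of_le_one_right (by positivity) (hexp1 c le_rfl))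
    calc ‖e - w‖ ≤ C₁ * ‖Pr (j (e - w))‖ := by rw [hek]; exact hew
      _ ≤ C₁ * (p * J * a + p / ω * η * D) := by
          rw [h2]; gcongr; exact (norm_sub_le _ _).trans (add_le_add h3 h4)
      _ = _ := by ring
  have hqb : ∃ M, ∀ t ∈ Icc c R, q t ≤ M := by
    have hcont : ContinuousOn q (Icc c R) := by
      have h1 : ContinuousOn v (Icc c R) :=
        hvtr.memU.1.mono fun y hy => ⟨hc.trans_le hy.1, hy.2⟩
      exact (by fun_prop : Continuous fun t => Real.exp (ω * t)).continuousOn.mul h1.norm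
    obtain ⟨M, hM⟩ := isCompact_Icc.exists_bound_of_continuousOn hcont
    exact ⟨M, fun t ht => (le_abs_self _).trans (hM t ht)⟩
  obtain ⟨M, hM⟩ := hqb
  have hexp2 : ∀ t, t ≤ H → Real.exp (ω * t) ≤ 2 := fun t ht => by
    rw [← hωH]; exact Real.exp_le_exp.2 (mul_le_mul_of_nonneg_left ht hω0.le)
  have hself : ∀ D, 0 ≤ D → (∀ t ∈ Icc c R, q t ≤ D) →
      ∀ t ∈ Icc c R, q t ≤ G * (1 + C₁ * (p * J)) * a + D / 2 := by
    intro D hD hqD t ht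
    have hed := hedist D hD hqD
    set ε := ‖e - w‖ with hε
    have hε0 : 0 ≤ ε := norm_nonneg _
    have hηD : 0 ≤ η * D := by positivity
    have hfD : ∀ y ∈ Icc c R, ‖f y‖ ≤ η * D * Real.exp (-(ω * y)) := fun y hy => by
      have h1 : ‖v y‖ ≤ D * Real.exp (-(ω * y)) := by
        rw [hvq y]
        exact mul_le_mul_of_nonneg_right (hqD y hy) (Real.exp_pos _).le
      exact (hfb y hy).trans ((mul_le_mul_of_nonneg_left h1 hη0.le).trans (le_of_eq (by ring)))
    have hvε : ∀ y ∈ Icc c (2 * c), ‖v y‖ ≤ a + ε := fun y hy => by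
      have h1 : v y = (u y - w) - (e - w) := by simp only [hv]; abel
      rw [h1]
      exact (norm_sub_le _ _).trans (add_le_add (hua y hy) le_rfl)
    have hGε : G * (a + ε) ≤ G * (1 + C₁ * (p * J)) * a + G * C₁ * (p / ω) * (η * D) := by
      have := mul_le_mul_of_nonneg_left hed hG0.le
      linarith
    have hmD : m * (η * D) = D / 4 := by
      rw [← mul_assoc, mul_comm m, hηm]; ring
    have hm' : m * (η * D) = G * C₁ * (p / ω) * (η * D) + 4 * C₂ * Hp / cp * (η * D) +
        4 * (p / ω) * (η * D) + 2 * K₁ * Hp * (η * D) := by rw [hm]; ring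
    have t1 : 0 ≤ G * C₁ * (p / ω) * (η * D) := by positivity
    have t2 : 0 ≤ 4 * C₂ * Hp / cp * (η * D) := by positivity
    have t3 : 0 ≤ 4 * (p / ω) * (η * D) := by positivity
    have t4 : 0 ≤ 2 * K₁ * Hp * (η * D) := by positivity
    have t5 : 0 ≤ G * (1 + C₁ * (p * J)) * a := by positivity
    -- Three ranges: on [c,2c] the assumed bound applies, up to c + H the a priori estimate started
    -- at c, and beyond that the contraction over a step of length H.
    rcases le_total t (2 * c) with h2c | h2c
    · have h1 : q t ≤ 2 * (a + ε) :=
        mul_le_mul (hexp2 t (h2c.trans hcH)) (hvε t ⟨ht.1, h2c⟩) (norm_nonneg _) two_pos.le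
      have h2 : 2 * (a + ε) ≤ G * (a + ε) := by
        have : (2 : ℝ) ≤ G := by rw [hG]; linarith [show 0 ≤ 4 * C₂ * J / cp by positivity]
        gcongr
      linarith
    rcases le_total t (c + H) with hcHt | hcHt
    · have hct : c < t := by linarith
      have hcR' : c < R := hct.trans_le ht.2
      have htr := hvtr.shift hμ.2 hc hcR'
      have htc : t - c ∈ Ioc 0 (t - c) := ⟨by linarith, le_rfl⟩
      have h1 := (hA₂ (t - c) _ _ _ (Hp * (η * D)) (by linarith) (by linarith)
        (htr.mono (by linarith [ht.2])) (embed_mem j hμ _) (fun y hy => by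
          refine mul_le_mul (Real.rpow_le_rpow hy.1.le (by linarith [hy.2]) (by linarith [hμ.2])) ?_
            (norm_nonneg _) hHp0.le
          have hy' : c + y ∈ Icc c R := ⟨by linarith [hy.1], by linarith [hy.2, ht.2]⟩
          exact (hfD _ hy').trans (mul_le_of_le_one_right hηD (hexp1 _ hy'.1))) (t - c) htc).1
      rw [add_sub_cancel] at h1
      have h2 : interpNorm j μ (j (v c)) ≤ J * (a + ε) :=
        (interpNorm_embed_le j hμ _).trans
          (by rw [← hJ]; gcongr; exact hvε c ⟨le_rfl, by linarith⟩)
      have h3 : cp ≤ (t - c) ^ (1 - μ) :=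
        Real.rpow_le_rpow hc.le (by linarith) (by linarith [hμ.2])
      have h4 : ‖v t‖ ≤ C₂ * (Hp * (η * D) + J * (a + ε)) / cp := by
        rw [le_div_iff₀ hcp0, mul_comm]
        exact ((mul_le_mul_of_nonneg_right h3 (norm_nonneg _)).trans h1).trans (by gcongr)
      have h5 : Real.exp (ω * t) ≤ 4 := by
        calc Real.exp (ω * t) ≤ Real.exp (ω * (H + H)) := by
              gcongr; linarith
          _ = 4 := by rw [mul_add, Real.exp_add, hωH]; norm_num
      have h6 : q t ≤ 4 * (C₂ * (Hp * (η * D) + J * (a + ε)) / cp) :=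
        mul_le_mul h5 h4 (norm_nonneg _) (by norm_num)
      have h7 : 4 * (C₂ * (Hp * (η * D) + J * (a + ε)) / cp) =
          4 * C₂ * Hp / cp * (η * D) + 4 * C₂ * J / cp * (a + ε) := by ring
      have h8 : 4 * C₂ * J / cp * (a + ε) ≤ G * (a + ε) := by
        gcongr
        rw [hG]; linarith
      linarith
    · set b := t - H with hb
      have hb0 : 0 < b := by linarith
      have hbc : b ∈ Icc c R := ⟨by linarith, by linarith [ht.2]⟩
      have hbR : b < R := by linarith [ht.2]
      have htr : Traj j μ H _ _ _ := (hvtr.shift hμ.2 hb0 hbR).mono (by linarith [ht.2])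
      have hexpb : Real.exp (-(ω * b)) = 2 * Real.exp (-(ω * t)) := by
        rw [← hωH, ← Real.exp_add, hb]; ring_nf
      have h1 := hcontr _ _ _ (Hp * (η * D * Real.exp (-(ω * b)))) htr (fun y hy => by
        refine mul_le_mul (Real.rpow_le_rpow hy.1.le hy.2 (by linarith [hμ.2])) ?_
          (norm_nonneg _) hHp0.le
        have hy' : b + y ∈ Icc c R := ⟨by linarith [hy.1, hbc.1], by linarith [hy.2, ht.2]⟩
        refine (hfD _ hy').trans ?_
        gcongr
        linarith [hy.1])
      rw [show b + H = t by ring] at h1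
      have h2 := hcenter D hD hqD b hbc
      have h3 : ‖v b‖ ≤ D * Real.exp (-(ω * b)) := by
        rw [hvq]; gcongr; exact hqD b hbc
      have h4 : ‖v t‖ ≤ (D / 4 + 4 * (p / ω) * (η * D) + 2 * K₁ * Hp * (η * D)) *
          Real.exp (-(ω * t)) := by
        rw [hexpb] at h1 h2 h3
        linarith
      have h5 : q t ≤ D / 4 + 4 * (p / ω) * (η * D) + 2 * K₁ * Hp * (η * D) := by
        have h6 := mul_le_mul_of_nonneg_left h4 (Real.exp_pos (ω * t)).le
        rw [mul_left_comm, ← Real.exp_add, add_neg_cancel, Real.exp_zero, mul_one] at h6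
        exact h6
      linarith
  have hfin := le_two_mul_of_self_improving (s := Icc c R) (q := q)
    (a := G * (1 + C₁ * (p * J)) * a) (fun t _ => mul_nonneg (Real.exp_pos _).le (norm_nonneg _))
    hM hself
  have hqK : ∀ t ∈ Icc c R, q t ≤ K₂ * a := fun t ht => (hfin t ht).trans (le_of_eq (by ring))
  refine ⟨e, heQ, ?_, fun t ht => ?_⟩
  · have h1 := hedist (K₂ * a) (by positivity) hqK
    have h2 : 0 ≤ K₂ * a := by positivity
    linarith
  · have h1 : ‖v t‖ ≤ K₂ * a * Real.exp (-(ω * t)) := by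
      rw [hvq]; gcongr; exact hqK t ht
    refine h1.trans ?_
    gcongr
    linarith [show 0 ≤ C₁ * (p * J) + C₁ * (p / ω) * η * K₂ by positivity]

end Stability

section Global

variable {E₀ E₁ : Type*} [NormedAddCommGroup E₀] [NormedSpace ℝ E₀] [CompleteSpace E₀]
  [NormedAddCommGroup E₁] [NormedSpace ℝ E₁] [CompleteSpace E₁]
variable {j B : E₁ →L[ℝ] E₀} {μ T C : ℝ} {N : E₁ → E₀} {D : Set E₁} {w : E₁}

/-! ### Local and global solutions near an equilibrium -/

theorem sub_embed_mem (hμ : μ ∈ Ioo (0 : ℝ) 1) {x : E₀} (hx : x ∈ contInterp j μ) (w : E₁) :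
    x - j w ∈ contInterp j μ :=
  (contInterp j μ).sub_mem hx (embed_mem j hμ w)

/-- Local solvability near a zero `w` of `N`, on intervals of uniform length. -/
theorem exists_solN_near (hμ : μ ∈ Ioo (0 : ℝ) 1) (hT : 0 < T) (hC : 0 < C)
    (hB : APriori j μ B T C) (hS : Solvable j μ B T) {r₀ L : ℝ} (hr₀ : 0 < r₀) (hL : 0 ≤ L)
    (hΦ : SmallPert j μ (fun a => B a - N (w + a)) r₀ L) (hw : N w = 0)
    (hD : ∀ a, interpNorm j μ (j a) ≤ r₀ → w + a ∈ D) (hN : ContinuousOn N D) :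
    ∃ h δ K : ℝ, 0 < h ∧ 0 < δ ∧ 0 < K ∧ ∀ x ∈ contInterp j μ, interpNorm j μ (x - j w) ≤ δ →
      ∃ u, SolN j μ N D h u x ∧ ∀ t ∈ Ioc 0 h,
        t ^ (1 - μ) * ‖u t - w‖ ≤ K * interpNorm j μ (x - j w) ∧
        interpNorm j μ (j (u t) - j w) ≤ K * interpNorm j μ (x - j w) := by
  obtain ⟨h, δ, hh, -, hδ, hloc⟩ := exists_local_solution hμ hT hC hB hS hr₀ hL hΦ
    (by simp [hw]) (by
      refine B.continuous.continuousOn.sub (hN.comp (by fun_prop) fun a ha => hD a ha))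
  refine ⟨h, min δ (r₀ / (2 * C)), 2 * C, hh, by positivity, by positivity, fun x hx hxδ => ?_⟩
  obtain ⟨u, u', hu, he, hb⟩ := hloc (x - j w) (sub_embed_mem hμ hx w)
    (hxδ.trans (min_le_left _ _))
  have hr : 2 * C * interpNorm j μ (x - j w) ≤ r₀ := by
    have h1 := hxδ.trans (min_le_right _ _)
    rw [le_div_iff₀ (by positivity)] at h1
    linarith
  have htr := (Traj.const (j := j) hμ.2 hh w).add hu
  rw [add_sub_cancel] at htr
  refine ⟨fun t => w + u t, ⟨htr.congr hh (fun t _ => rfl) fun t ht => ?_, fun t ht =>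
    hD _ ((hb t ht).2.trans hr)⟩, fun t ht => ?_⟩
  · have h1 : u' t + B (u t) = -N (w + u t) + B (u t) := (he t ht).trans (by abel)
    rw [zero_add]
    exact (add_right_cancel h1).symm
  · rw [add_sub_cancel_left, map_add, add_sub_cancel_left]
    exact hb t ht

/-- A solution that stays `E_μ`-close to `w` is the only one with its initial value. -/
theorem exists_unique_near (hμ : μ ∈ Ioo (0 : ℝ) 1) (hT : 0 < T) (hC : 0 < C)
    (hB : APriori j μ B T C) {r₀ L : ℝ} (hr₀ : 0 < r₀) (hL : 0 ≤ L)
    (hΦ : SmallPert j μ (fun a => B a - N (w + a)) r₀ L) :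
    ∃ r₁ : ℝ, 0 < r₁ ∧ ∀ (R : ℝ) (u v : ℝ → E₁) (x : E₀), x ∈ contInterp j μ →
      interpNorm j μ (x - j w) ≤ r₁ → SolN j μ N D R u x → SolN j μ N D R v x →
      (∀ t ∈ Ioc 0 R, interpNorm j μ (j (u t) - j w) ≤ r₁) → EqOn u v (Ioc 0 R) := by
  obtain ⟨r₁, hr₁, huniq⟩ := exists_local_uniqueness hμ hT hC hB hr₀ hL hΦ
  refine ⟨r₁, hr₁, fun R u v x hx hxr hu hv hur => SolN.eqOn_of_local hμ.2
    (G := {y | y ∈ contInterp j μ ∧ interpNorm j μ (y - j w) ≤ r₁}) ?_ hu hv ⟨hx, hxr⟩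
    fun t ht => ⟨embed_mem j hμ _, hur t ht⟩⟩
  intro R u v x hR hx hu hv
  have hsub : ∀ {u}, SolN j μ N D R u x → Traj j μ R (fun t => u t - w) (fun t => -N (u t) - 0)
      (x - j w) := fun hu => hu.1.sub hR (Traj.const hμ.2 hR w)
  have heq : ∀ u : ℝ → E₁, ∀ t ∈ Ioc 0 R, -N (u t) - 0 + B (u t - w) =
      B (u t - w) - N (w + (u t - w)) := fun u t _ => by rw [add_sub_cancel]; abel
  obtain ⟨S, hS, h⟩ := huniq R _ _ _ _ _ hR (sub_embed_mem hμ hx.1 w) hx.2 (hsub hu) (hsub hv)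
    (heq u) (heq v)
  exact ⟨S, hS, fun t ht => sub_left_injective (h ht)⟩

/-- Local solvability and uniqueness near `w`, and decay estimates for solutions that stay near `w`,
give global existence, stability, and convergence to a zero of `N`. -/
theorem exists_global_near (hμ : μ ∈ Ioo (0 : ℝ) 1) {h δ K : ℝ} (hh : 0 < h) (hδ : 0 < δ)
    (hK : 0 < K)
    (hloc : ∀ x ∈ contInterp j μ, interpNorm j μ (x - j w) ≤ δ →
      ∃ u, SolN j μ N D h u x ∧ ∀ t ∈ Ioc 0 h,
        t ^ (1 - μ) * ‖u t - w‖ ≤ K * interpNorm j μ (x - j w) ∧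
        interpNorm j μ (j (u t) - j w) ≤ K * interpNorm j μ (x - j w))
    {r₁ : ℝ} (hr₁ : 0 < r₁)
    (huniq : ∀ (R : ℝ) (u v : ℝ → E₁) (x : E₀), x ∈ contInterp j μ →
      interpNorm j μ (x - j w) ≤ r₁ → SolN j μ N D R u x → SolN j μ N D R v x →
      (∀ t ∈ Ioc 0 R, interpNorm j μ (j (u t) - j w) ≤ r₁) → EqOn u v (Ioc 0 R))
    {H ω : ℝ} (hH : 0 < H) (hω : 0 < ω)
    (hdec : ∀ c, 0 < c → 2 * c ≤ H → ∃ r K : ℝ, 0 < r ∧ 0 < K ∧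
      ∀ (R a : ℝ) (u : ℝ → E₁) (x : E₀), 2 * c ≤ R → Traj j μ R u (fun t => -N (u t)) x →
        (∀ t ∈ Icc c (2 * c), ‖u t - w‖ ≤ a) → (∀ t ∈ Icc c R, ‖u t - w‖ ≤ r) →
        ∃ e ∈ {e | e ∈ D ∧ N e = 0}, ‖e - w‖ ≤ K * a ∧
          ∀ t ∈ Icc c R, ‖u t - e‖ ≤ K * a * Real.exp (-(ω * t)))
    (hD : IsOpen D) (hwD : w ∈ D) (hN : ContinuousOn N D) :
    ∃ δ₀ M : ℝ, 0 < δ₀ ∧ 0 < M ∧ ∀ x ∈ contInterp j μ, interpNorm j μ (x - j w) ≤ δ₀ →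
      ∃ u, (∀ T, 0 < T → SolN j μ N D T u x) ∧
        (∀ T v, SolN j μ N D T v x → EqOn v u (Ioc 0 T)) ∧
        (∀ t, 0 < t → interpNorm j μ (j (u t) - j w) ≤ M * interpNorm j μ (x - j w)) ∧
        ∃ e, (e ∈ D ∧ N e = 0) ∧ ∀ t, 1 ≤ t → ‖u t - e‖ ≤ M * Real.exp (-(ω * t)) := by
  -- Local solutions of length 2c are used with overlaps of length c, so each new piece is only
  -- needed on [c,2c] of its own time, where it is controlled in E₁. The bound c ≤ 1 gives decay
  -- from t = 1 on.
  set c := min (h / 2) (min (H / 2) 1) with hc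
  have hc0 : 0 < c := by positivity
  have hch : 2 * c ≤ h := by linarith [min_le_left (h / 2) (min (H / 2) 1)]
  have hcH : 2 * c ≤ H := by
    linarith [(min_le_right (h / 2) (min (H / 2) 1)).trans (min_le_left (H / 2) 1)]
  have hc1 : c ≤ 1 := (min_le_right (h / 2) (min (H / 2) 1)).trans (min_le_right (H / 2) 1)
  obtain ⟨r, K₂, hr, hK₂, hdec⟩ := hdec c hc0 hcH
  obtain ⟨rD, hrD, hballD⟩ := Metric.isOpen_iff.1 hD w hwD
  set cp := c ^ (1 - μ) with hcp
  have hcp0 : 0 < cp := Real.rpow_pos_of_pos hc0 _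
  set J := 1 + ‖j‖ with hJ
  have hJ0 : 0 < J := by positivity
  set K₁ := K / cp with hK₁
  have hK₁0 : 0 < K₁ := by positivity
  -- `E₁`-bound for the local solutions away from `t = 0`
  have hloc₁ : ∀ x ∈ contInterp j μ, interpNorm j μ (x - j w) ≤ δ →
      ∃ u, SolN j μ N D (2 * c) u x ∧
        (∀ t ∈ Icc c (2 * c), ‖u t - w‖ ≤ K₁ * interpNorm j μ (x - j w)) ∧
        ∀ t ∈ Ioc 0 (2 * c), interpNorm j μ (j (u t) - j w) ≤ K * interpNorm j μ (x - j w) := by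
    intro x hx hxδ
    obtain ⟨u, hu, hb⟩ := hloc x hx hxδ
    refine ⟨u, hu.mono hch, fun t ht => ?_, fun t ht => (hb t ⟨ht.1, ht.2.trans hch⟩).2⟩
    have h1 := (hb t ⟨hc0.trans_le ht.1, ht.2.trans hch⟩).1
    have h2 : cp ≤ t ^ (1 - μ) := Real.rpow_le_rpow hc0.le ht.1 (by linarith [hμ.2])
    rw [hK₁, div_mul_eq_mul_div, le_div_iff₀ hcp0, mul_comm]
    exact (mul_le_mul_of_nonneg_right h2 (norm_nonneg _)).trans h1
  set K₃ := J * (2 * K₂ * K₁) with hK₃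
  have hK₃0 : 0 < K₃ := by positivity
  set M := K + K₃ + K₂ * K₁ with hM
  have hM0 : 0 < M := by positivity
  -- The conditions ensure solvability at time 0 and at restarts, closeness for uniqueness,
  -- smallness r in E₁ on the first window and on each new one, and that the limit equilibrium lies
  -- in D.
  set δ₀ := min (min (min δ 1) (min (δ / K₃) (r₁ / (K₃ * K + 1))))
    (min (min (r / K₁) (r / (K₁ * K₃))) (min (r₁ / M) (min r₁ (rD / (2 * (K₂ * K₁)))))) with hδ₀
  have hδ₀0 : 0 < δ₀ := by positivity
  refine ⟨δ₀, M, hδ₀0, hM0, fun x hx hxδ₀ => ?_⟩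
  set α := interpNorm j μ (x - j w) with hα
  have hα0 : 0 ≤ α := interpNorm_nonneg j μ _
  have hdiv : ∀ {p q : ℝ}, 0 < q → δ₀ ≤ p / q → q * α ≤ p := fun {p q} hq hle => by
    have h1 := hxδ₀.trans hle
    rw [le_div_iff₀ hq] at h1
    linarith
  have hαδ : α ≤ δ := hxδ₀.trans ((min_le_left _ _).trans ((min_le_left _ _).trans (min_le_left _ _)))
  have hα1 : α ≤ 1 := hxδ₀.trans ((min_le_left _ _).trans ((min_le_left _ _).trans (min_le_right _ _)))
  have hα3 : K₃ * α ≤ δ := hdiv hK₃0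
    ((min_le_left _ _).trans ((min_le_right _ _).trans (min_le_left _ _)))
  have hα4 : (K₃ * K + 1) * α ≤ r₁ := hdiv (by positivity)
    ((min_le_left _ _).trans ((min_le_right _ _).trans (min_le_right _ _)))
  have hα5 : K₁ * α ≤ r := hdiv hK₁0
    ((min_le_right _ _).trans ((min_le_left _ _).trans (min_le_left _ _)))
  have hα6 : K₁ * K₃ * α ≤ r := hdiv (by positivity)
    ((min_le_right _ _).trans ((min_le_left _ _).trans (min_le_right _ _)))
  have hα7 : M * α ≤ r₁ := hdiv hM0
    ((min_le_right _ _).trans ((min_le_right _ _).trans (min_le_left _ _)))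
  have hα8 : α ≤ r₁ := hxδ₀.trans
    ((min_le_right _ _).trans ((min_le_right _ _).trans ((min_le_right _ _).trans (min_le_left _ _))))
  have hα9 : 2 * (K₂ * K₁) * α ≤ rD := hdiv (by positivity)
    ((min_le_right _ _).trans ((min_le_right _ _).trans ((min_le_right _ _).trans (min_le_right _ _))))
  have hexp1 : ∀ t, c ≤ t → Real.exp (-(ω * t)) ≤ 1 := fun t ht =>
    Real.exp_le_one_iff.2 (by nlinarith)
  -- the properties that are propagated in time
  have good : ∀ R u, 2 * c ≤ R → SolN j μ N D R u x →
      (∀ t ∈ Icc c (2 * c), ‖u t - w‖ ≤ K₁ * α) → (∀ t ∈ Icc c R, ‖u t - w‖ ≤ r) →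
      (∃ e, (e ∈ D ∧ N e = 0) ∧ ‖e - w‖ ≤ K₂ * K₁ * α ∧
        ∀ t ∈ Icc c R, ‖u t - e‖ ≤ K₂ * K₁ * α * Real.exp (-(ω * t))) ∧
      ∀ t ∈ Icc c R, interpNorm j μ (j (u t) - j w) ≤ K₃ * α := by
    intro R u hR hu h1 h2
    obtain ⟨e, he, hew, heu⟩ := hdec R (K₁ * α) u x hR hu.1 h1 h2
    rw [← mul_assoc] at hew heu
    refine ⟨⟨e, he, hew, heu⟩, fun t ht => ?_⟩
    have h3 : ‖u t - e‖ ≤ K₂ * K₁ * α :=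
      (heu t ht).trans (mul_le_of_le_one_right (by positivity) (hexp1 t ht.1))
    have h4 : ‖u t - w‖ ≤ 2 * K₂ * K₁ * α := by
      have := norm_sub_le_norm_sub_add_norm_sub (u t) e w
      linarith
    rw [← map_sub]
    refine (interpNorm_embed_le j hμ _).trans ?_
    rw [hK₃, mul_assoc J]
    gcongr
  have hstep : ∀ n : ℕ, ∃ u, SolN j μ N D ((n + 2) * c) u x ∧
      (∀ t ∈ Icc c (2 * c), ‖u t - w‖ ≤ K₁ * α) ∧
      (∀ t ∈ Icc c ((n + 2) * c), ‖u t - w‖ ≤ r) ∧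
      ∀ t ∈ Ioc 0 (2 * c), interpNorm j μ (j (u t) - j w) ≤ K * α := by
    intro n
    induction n with
    | zero =>
      obtain ⟨u, hu, h1, h2⟩ := hloc₁ x hx hαδ
      rw [Nat.cast_zero, zero_add]
      exact ⟨u, hu, h1, fun t ht => (h1 t ht).trans hα5, h2⟩
    | succ n ih =>
      obtain ⟨u, hu, h1, h2, h3⟩ := ih
      set R := ((n : ℝ) + 2) * c with hR
      have hR2 : 2 * c ≤ R := by rw [hR]; gcongr; linarith [n.cast_nonneg (α := ℝ)]
      have hg := (good R u hR2 hu h1 h2).2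
      set b := R - c with hb
      have hbc : c ≤ b := by rw [hb]; linarith
      have hb0 : 0 < b := hc0.trans_le hbc
      have hbR : b < R := by rw [hb]; linarith
      have hbα := hg b ⟨hbc, hbR.le⟩
      obtain ⟨v, hv, hv1, hv2⟩ := hloc₁ _ (embed_mem j hμ (u b)) (hbα.trans hα3)
      have hshift := hu.shift hμ.2 hb0 hbR
      have hRb : R - b = c := by rw [hb]; ring
      rw [hRb] at hshift
      have hKα : K * (K₃ * α) ≤ r₁ := by linarith
      -- The new local solution v is the one known to remain E_μ-close to w, so it is placed first
      -- in the uniqueness statement.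
      have heq := huniq c v _ _ (embed_mem j hμ (u b)) (hbα.trans (by
        have : K₃ * α ≤ M * α := by
          gcongr
          rw [hM]
          linarith [mul_pos hK₂ hK₁0]
        linarith)) (hv.mono (by linarith)) hshift fun t ht =>
          (hv2 t ⟨ht.1, by linarith [ht.2]⟩).trans
            ((mul_le_mul_of_nonneg_left hbα hK.le).trans hKα)
      obtain ⟨z, hz, hzu, hzv⟩ := hu.extend hb0 hbR hv fun t ht => by
        rw [hRb] at ht; exact (heq ht).symm
      have hbR' : b + 2 * c = ((n + 1 : ℕ) + 2) * c := by rw [hb, hR]; push_cast; ring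
      rw [hbR'] at hz
      refine ⟨z, hz, fun t ht => ?_, fun t ht => ?_, fun t ht => ?_⟩
      · rw [hzu ⟨hc0.trans_le ht.1, ht.2.trans hR2⟩]; exact h1 t ht
      · rcases le_total t R with htR | htR
        · rw [hzu ⟨hc0.trans_le ht.1, htR⟩]; exact h2 t ⟨ht.1, htR⟩
        · rw [← hbR'] at ht
          have h4 : t - b ∈ Icc c (2 * c) := ⟨by linarith, by linarith [ht.2]⟩
          have h5 := hzv (t - b) ⟨hc0.trans_le h4.1, h4.2⟩
          rw [add_sub_cancel] at h5
          rw [h5]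
          refine (hv1 _ h4).trans ((mul_le_mul_of_nonneg_left hbα hK₁0.le).trans ?_)
          linarith
      · rw [hzu ⟨ht.1, ht.2.trans hR2⟩]; exact h3 t ht
  have hbd : ∀ n : ℕ, ∀ u, SolN j μ N D ((n + 2) * c) u x →
      (∀ t ∈ Icc c (2 * c), ‖u t - w‖ ≤ K₁ * α) → (∀ t ∈ Icc c ((n + 2) * c), ‖u t - w‖ ≤ r) →
      (∀ t ∈ Ioc 0 (2 * c), interpNorm j μ (j (u t) - j w) ≤ K * α) →
      ∀ t ∈ Ioc 0 ((n + 2) * c), interpNorm j μ (j (u t) - j w) ≤ M * α := by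
    intro n u hu h1 h2 h3 t ht
    have hR2 : 2 * c ≤ ((n : ℝ) + 2) * c := by gcongr; linarith [n.cast_nonneg (α := ℝ)]
    have hMK : K * α ≤ M * α := by
      gcongr; rw [hM]; linarith [mul_pos hK₂ hK₁0]
    have hMK₃ : K₃ * α ≤ M * α := by
      gcongr; rw [hM]; linarith [mul_pos hK₂ hK₁0]
    rcases le_total t c with htc | htc
    · exact (h3 t ⟨ht.1, by linarith⟩).trans hMK
    · exact ((good _ u hR2 hu h1 h2).2 t ⟨htc, ht.2⟩).trans hMK₃
  choose U hU h1U h2U h3U using hstep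
  have hlen : ∀ R : ℝ, ∃ n : ℕ, R ≤ (n + 2) * c := fun R => by
    obtain ⟨n, hn⟩ := exists_nat_ge (R / c)
    refine ⟨n, ?_⟩
    rw [div_le_iff₀ hc0] at hn
    linarith
  have hUu : ∀ (n : ℕ) (R : ℝ) v, R ≤ (n + 2) * c → SolN j μ N D R v x →
      EqOn (U n) v (Ioc 0 R) := fun n R v hR hv =>
    huniq R (U n) v x hx hα8 ((hU n).mono hR) hv fun t ht =>
      (hbd n (U n) (hU n) (h1U n) (h2U n) (h3U n) t ⟨ht.1, ht.2.trans hR⟩).trans hα7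
  obtain ⟨u, hu⟩ := SolN.exists_global (j := j) (μ := μ) (N := N) (D := D) (x := x)
    (fun R => by
      obtain ⟨n, hn⟩ := hlen R
      exact ⟨_, U n, hn, hU n⟩)
    (fun R v v' _ hv hv' => by
      obtain ⟨n, hn⟩ := hlen R
      exact (hUu n R v hn hv).symm.trans (hUu n R v' hn hv'))
  have hpos : ∀ n : ℕ, 0 < ((n : ℝ) + 2) * c := fun n => by positivity
  have hUn : ∀ n : ℕ, EqOn u (U n) (Ioc 0 ((n + 2) * c)) := fun n =>
    (hUu n _ u le_rfl (hu _ (hpos n))).symm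
  have h2n : ∀ n : ℕ, 2 * c ≤ ((n : ℝ) + 2) * c := fun n => by
    gcongr; linarith [n.cast_nonneg (α := ℝ)]
  have hue : ∀ n : ℕ, ∃ e, (e ∈ D ∧ N e = 0) ∧ ‖e - w‖ ≤ K₂ * K₁ * α ∧
      ∀ t ∈ Icc c ((n + 2) * c), ‖u t - e‖ ≤ K₂ * K₁ * α * Real.exp (-(ω * t)) := fun n =>
    (good _ u (h2n n) (hu _ (hpos n))
      (fun t ht => by
        rw [hUn n ⟨hc0.trans_le ht.1, ht.2.trans (h2n n)⟩]; exact h1U n t ht)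
      (fun t ht => by rw [hUn n ⟨hc0.trans_le ht.1, ht.2⟩]; exact h2U n t ht)).1
  choose e he hew heu using hue
  -- For n, m ≥ k both equilibria are exponentially close to the one point u((k + 2)c), so the
  -- equilibria of the successive horizons form a Cauchy sequence.
  set b : ℕ → ℝ := fun n => 2 * (K₂ * K₁ * α * Real.exp (-(ω * ((n + 2) * c)))) with hbdef
  have hb0 : Tendsto b atTop (𝓝 0) := by
    have h1 : Tendsto (fun n : ℕ => ω * (((n : ℝ) + 2) * c)) atTop atTop :=
      ((tendsto_natCast_atTop_atTop.atTop_add tendsto_const_nhds).atTop_mul_const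
        hc0).const_mul_atTop hω
    have h2 := (Real.tendsto_exp_neg_atTop_nhds_zero.comp h1).const_mul (K₂ * K₁ * α)
    simpa using h2.const_mul 2
  have hcauchy : CauchySeq e := by
    refine cauchySeq_of_le_tendsto_0 b (fun n m k hn hm => ?_) hb0
    have hk : ∀ m : ℕ, k ≤ m → ((k : ℝ) + 2) * c ∈ Icc c ((m + 2) * c) := fun m hm =>
      ⟨by linarith [h2n k], by gcongr⟩
    have h1 := heu n _ (hk n hn)
    have h2 := heu m _ (hk m hm)
    rw [dist_eq_norm]
    have h3 : e n - e m = (u ((k + 2) * c) - e m) - (u ((k + 2) * c) - e n) := by abel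
    rw [h3]
    refine (norm_sub_le _ _).trans ?_
    rw [hbdef]
    linarith
  obtain ⟨e', he'⟩ := cauchySeq_tendsto_of_complete hcauchy
  have hle : ∀ t, c ≤ t → ‖u t - e'‖ ≤ K₂ * K₁ * α * Real.exp (-(ω * t)) := by
    intro t ht
    refine le_of_tendsto (he'.const_sub (u t)).norm ?_
    obtain ⟨n, hn⟩ := hlen t
    filter_upwards [eventually_ge_atTop n] with m hm
    refine heu m t ⟨ht, hn.trans ?_⟩
    gcongr
  have hew' : ‖e' - w‖ ≤ K₂ * K₁ * α :=
    le_of_tendsto (he'.sub_const w).norm (Eventually.of_forall hew)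
  have he'D : e' ∈ D := by
    refine hballD ?_
    rw [Metric.mem_ball, dist_eq_norm]
    linarith
  have hNe' : N e' = 0 := by
    have h1 : Tendsto (fun n => N (e n)) atTop (𝓝 (N e')) :=
      ((hN e' he'D).continuousAt (hD.mem_nhds he'D)).tendsto.comp he'
    refine tendsto_nhds_unique h1 (tendsto_const_nhds.congr fun n => ((he n).2).symm)
  refine ⟨u, hu, fun R v hv => ?_, fun t ht => ?_, e', ⟨he'D, hNe'⟩, fun t ht => ?_⟩
  · obtain ⟨n, hn⟩ := hlen R
    exact fun t ht => (hUu n R v hn hv ht).symm.trans (hUn n ⟨ht.1, ht.2.trans hn⟩).symm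
  · obtain ⟨n, hn⟩ := hlen t
    rw [hUn n ⟨ht, hn⟩]
    exact hbd n (U n) (hU n) (h1U n) (h2U n) (h3U n) t ⟨ht, hn⟩
  · refine (hle t (hc1.trans ht)).trans ?_
    gcongr
    calc K₂ * K₁ * α ≤ K₂ * K₁ := mul_le_of_le_one_right (by positivity) hα1
      _ ≤ M := by rw [hM]; linarith

end Global

end QuasiPar

/-! ### Assembly of stability and convergence -/

theorem theorem3p2 {E₀ E₁ : Type*}
    [NormedAddCommGroup E₀] [NormedSpace ℝ E₀] [CompleteSpace E₀]
    [NormedAddCommGroup E₁] [NormedSpace ℝ E₁] [CompleteSpace E₁]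
    (j : E₁ →L[ℝ] E₀) (hj : Function.Injective j) (hjd : DenseRange j)
    (μ β μbar : ℝ) (hμ : 0 < μ) (hβ : μ < β) (hμbar : β ≤ μbar) (hμbar1 : μbar < 1)
    (V : Set E₀) (hV : QuasiPar.IsOpenInInterp j μ V)
    (A : E₀ → E₁ →L[ℝ] E₀) (F₁ F₂ : E₀ → E₀)
    (hH1 : QuasiPar.HypH1 j μ V A F₁)
    (hH2 : QuasiPar.HypH2 j μ β V F₂)
    (hC1 : QuasiPar.HypC1 j μbar V A F₁ F₂)
    (ustar : E₁) (hustar : ustar ∈ QuasiPar.equilibria j V A F₁ F₂)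
    (hns : QuasiPar.NormallyStable j μbar ⟨(hμ.trans hβ).trans_le hμbar, hμbar1⟩ V A F₁ F₂ ustar) :
    QuasiPar.IsStable j μ V A F₁ F₂ ustar ∧
    ∃ δ : ℝ, 0 < δ ∧
      ∀ x₀ ∈ QuasiPar.contInterp j μ, QuasiPar.interpNorm j μ (x₀ - j ustar) < δ →
        x₀ ∈ V ∧
        ∃ u : ℝ → E₁, QuasiPar.IsGlobalSolution j μ V A F₁ F₂ x₀ u ∧
          ∃ uinf ∈ QuasiPar.equilibria j V A F₁ F₂, ∃ C ω : ℝ, 0 < ω ∧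
            ∀ t : ℝ, 1 ≤ t →
              QuasiPar.interpNorm j μbar (j (u t) - j uinf) ≤ C * Real.exp (-ω * t) := by
  open QuasiPar in
  have hθμ : μ ≤ μbar := hβ.le.trans hμbar
  have hθ : μbar ∈ Ioo (0 : ℝ) 1 := ⟨(hμ.trans hβ).trans_le hμbar, hμbar1⟩
  have hμ1 : μ ∈ Ioo (0 : ℝ) 1 := ⟨hμ, hθμ.trans_lt hμbar1⟩
  have hβ1 : β < 1 := hμbar.trans_lt hμbar1
  obtain ⟨⟨m, U, Ψ, hU, h0U, hΨ, hΨ0, hrank, ⟨ρ₁, -, hΨU⟩, hker⟩, hcompl, hspec⟩ := hns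
  set B := linearization j μbar hθ A F₁ F₂ ustar with hB
  set N := QuasiPar.residual j A F₁ F₂ with hN
  set D : Set E₁ := j ⁻¹' V with hD
  obtain ⟨hwV, hw0⟩ := mem_equilibria_iff.1 hustar
  have hQD : equilibria j V A F₁ F₂ = {e | e ∈ D ∧ N e = 0} := by
    ext e; exact mem_equilibria_iff
  -- Maximal regularity is used only at the frozen operator A(u_*), which governs the local
  -- nonlinear problem. The linearization A₀ = A(u_*) + (A₀ - A(u_*)) inherits the a priori estimate
  -- and homogeneous solvability as a lower-order perturbation.
  obtain ⟨T, C, hT, hC, hA, hS⟩ := exists_aPriori_of_maxReg hμ1 (hH1.1 _ hwV)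
  have hP := lowerOrder_linearization (j := j) (A := A) (F₁ := F₁) (F₂ := F₂) hμ1 hθμ hθ ustar
  obtain ⟨T', hT', -, hA'⟩ := hA.add_lowerOrder hT hC hP
  have hex : ∀ y, ∃ u, HomSol j μ B u (j y) := fun y => by
    have h1 := exists_homSol hμ1 hT hC hA hS hP (embed_mem j hμ1 y)
    rwa [add_sub_cancel, ← hB] at h1
  rw [add_sub_cancel, ← hB] at hA'
  obtain ⟨Pr, hPr⟩ := exists_isCenterProj hj hcompl
  have hNB : HasStrictFDerivAt N B ustar := hasStrictFDerivAt_residual hμ hθμ hθ hV hC1 hwV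
  have hΨQ : Ψ '' U ⊆ {e | e ∈ D ∧ N e = 0} := by
    rw [← hQD, ← hΨU]; exact inter_subset_left
  obtain ⟨ρ, C₁, hρ, hC₁, hgraph⟩ :=
    exists_equilibria_graph hPr hU h0U hΨ hΨ0 hrank hΨQ hker
  obtain ⟨H, ω, hH, hω, hdec⟩ := exists_decay_estimate hμ1 hT' (by positivity) hA' hPr hspec hex
    hNB (fun e he => he.2) hρ hC₁ hgraph
  obtain ⟨r₀, L, hr₀, hL, hr₀V, hΦ⟩ := exists_smallPert hμ1 hβ hβ1 hV hH1 hH2 hwV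
  have hNc : ContinuousOn N D := continuousOn_residual hμ hθμ hμbar1 hC1
  have hDo : IsOpen D := isOpen_embed_preimage hμ1 hV
  obtain ⟨h, δ, K, hh, hδ, hK, hloc⟩ := exists_solN_near (D := D) hμ1 hT hC hA hS hr₀ hL hΦ hw0
    (fun a ha => hr₀V _ (embed_mem j hμ1 _) (by rwa [map_add, add_sub_cancel_left])) hNc
  obtain ⟨r₁, hr₁, huniq⟩ := exists_unique_near (D := D) hμ1 hT hC hA hr₀ hL hΦ
  obtain ⟨δ₀, M, hδ₀, hM, hglob⟩ := exists_global_near hμ1 hh hδ hK hloc hr₁ huniq hH hω hdec hDo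
    hwV hNc
  have hglobal : ∀ (x : E₀) (u : ℝ → E₁), (∀ T, 0 < T → SolN j μ N D T u x) →
      (∀ T v, SolN j μ N D T v x → EqOn v u (Ioc 0 T)) →
      IsGlobalSolution j μ V A F₁ F₂ x u := fun x u h1 h2 =>
    ⟨fun T hT => (isSolution_iff_solN hT).2 (h1 T hT),
      fun T v hT hv => h2 T v ((isSolution_iff_solN hT).1 hv)⟩
  constructor
  · intro ε hε
    refine ⟨min (min δ₀ r₀) (min ε (ε / M)), by positivity, fun x hx hxδ => ?_⟩
    have h1 : interpNorm j μ (x - j ustar) < δ₀ :=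
      hxδ.trans_le ((min_le_left _ _).trans (min_le_left _ _))
    have h2 : interpNorm j μ (x - j ustar) < r₀ :=
      hxδ.trans_le ((min_le_left _ _).trans (min_le_right _ _))
    have h3 : interpNorm j μ (x - j ustar) < ε :=
      hxδ.trans_le ((min_le_right _ _).trans (min_le_left _ _))
    have h4 : interpNorm j μ (x - j ustar) < ε / M :=
      hxδ.trans_le ((min_le_right _ _).trans (min_le_right _ _))
    rw [lt_div_iff₀ hM] at h4
    obtain ⟨u, hu1, hu2, hu3, -⟩ := hglob x hx h1.le
    refine ⟨hr₀V x hx h2.le, h3, u, hglobal x u hu1 hu2, fun t ht => (hu3 t ht).trans_lt ?_⟩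
    linarith
  · refine ⟨min δ₀ r₀, by positivity, fun x hx hxδ => ?_⟩
    have h1 := hxδ.trans_le (min_le_left _ _)
    have h2 := hxδ.trans_le (min_le_right _ _)
    obtain ⟨u, hu1, hu2, -, e, he, hue⟩ := hglob x hx h1.le
    refine ⟨hr₀V x hx h2.le, u, hglobal x u hu1 hu2, e, by rw [hQD]; exact he,
      -- Convergence is known in E₁; the embedding of E₁ in E_μbar costs the factor 1 + ‖j‖.
      (1 + ‖j‖) * M, ω, hω, fun t ht => ?_⟩
    rw [← map_sub]
    refine (interpNorm_embed_le j hθ _).trans ?_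
    rw [mul_assoc, neg_mul]
    exact mul_le_mul_of_nonneg_left (hue t ht) (by positivity)
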